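/- **Setting.** For a function $g:\mathbb R^2\to\mathbb R$ with first and second partial derivatives write $d^2g=(g^{(2,0)},g^{(1,1)},g^{(0,2)})$, and let $\lambda_2(g;x)\le\lambda_1(g;x)$ be the eigenvalues of the Hessian $\nabla^2g(x)$. With $$G(u,v,w)=\begin{pmatrix}2u-2w+2v-2\sqrt{(w-u)^2+4v^2}\\ w-u+4v-\sqrt{(w-u)^2+4v^2}\end{pmatrix}$$ put $V_g(x)=G(d^2g(x))$, which satisfies $\nabla^2 g(x)V_g(x)=\lambda_2(g;x)V_g(x)$. Let $\mathfrak X^g_{x_0}:\mathbb R\to\mathbb R^2$ solve $\frac{d}{dt}\mathfrak X^g_{x_0}(t)=V_g(\mathfrak X^g_{x_0}(t))$, $\mathfrak X^g_{x_0}(0)=x_0$, and let $$\Theta^g_{x_0}=\{t\in\mathbb R:\ \langle\nabla g(\mathfrak X^g_{x_0}(t)),V_g(\mathfrak X^g_{x_0}(t))\rangle=0,\ \lambda_2(g;\mathfrak X^g_{x_0}(t))<0\}.$$ Let $X_1,X_2,\dots$ be i.i.d. random points of $\mathbb R^2$ with density $f$, let $\hat f_n(x)=\frac1{nh_n^2}\sum_{i=1}^nK\big(\frac{x-X_i}{h_n}\big)$,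 and write $V,\lambda_i,\mathfrak X,\Theta$ for the objects belonging to $g=f$ and $\hat{\mathfrak X},\hat\Theta$ for those belonging to $g=\hat f_n$. Let $H,\mathcal L\subset\mathbb R^2$, $a^*>0$ and $\mathcal G=\{\mathfrak X_{x_0}(t):x_0\in\mathcal L,\ |t|\le a^*\}$. For $x_0\in\mathcal G$ let $\theta_{x_0}$ be the element of $\Theta_{x_0}$ of smallest absolute value. Let $\hat\theta_{x_0}$ be an element of $\hat\Theta_{x_0}$ of smallest absolute value (any choice if there are several, and any number if $\hat\Theta_{x_0}\ne\emptyset$ but the minimum is not attained), and $\hat\theta_{x_0}=0$ if $\hat\Theta_{x_0}=\emptyset$. **Assumptions.** * $f$ is a four times continuously differentiable probability density with bounded partial derivatives of orders $1$ to $4$. * $H$ is compact, $f>0$ on an open $\varepsilon_0$-neighbourhood of $H$ for some $\varepsilon_0>0$, and $\lambda_1(x)\neq\lambda_2(x)$ for all $x\in H$. * $\mathcal L\subset H$ is compact, $\mathcal G\subset H$, for every $x_0\in\mathcal G$ the minimizer $\theta_{x_0}$ exists and is unique, and $\mathcal L=\{\mathfrak X_{x_0}(\theta_{x_0}):x_0\in\mathcal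 G\}$. * For some $\gamma>0$, $\big\|\frac1{u-s}\int_s^uV(\mathfrak X_{x_0}(t))\,dt\big\|\ge\gamma$ for all $x_0\in\mathcal L$ and $-a^*\le s<u\le a^*$. * $\big\langle\nabla\langle\nabla f,V\rangle(x),V(x)\big\rangle\neq0$ for all $x\in\mathcal L$. * There is no point at which both $\lambda_2=0$ and $\langle\nabla f,V\rangle=0$, neither in $H$ nor on an arc $\{\mathfrak X_{x_0}(t):|t|\le|\theta_{x_0}|\}$ with $x_0\in\mathcal G$. * $K$ is a probability density with $K(-z)=K(z)$ whose support (the closure of $\{K\ne0\}$) is the closed unit ball. It is four times differentiable with bounded partial derivatives of orders $1$ to $4$, $\int K(z)zz^T\,dz=\mu_2 I$ for some $\mu_2\in\mathbb R$, and the entries of $d^2K\,(d^2K)^T$ are integrable. * $h_n>0$, $h_n\to0$, $nh_n^8/(\log n)^3\to\infty$ and $nh_n^9\to\beta$ for some $\beta\ge0$. **Conclusion.** Let $V^\perp(x)$, $x\in\mathcal L$, be eigenvectors of $\nabla^2f(x)$ for the eigenvalue $\lambda_1(x)$, with $\|V^\perp\|$ bounded on $\mathcal L$. Then $$\sup_{x_0\in\mathcal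 G}\Big|\big\langle\hat{\mathfrak X}_{x_0}(\hat\theta_{x_0})-\mathfrak X_{x_0}(\theta_{x_0}),\,V^\perp(\mathfrak X_{x_0}(\theta_{x_0}))\big\rangle\Big|=O_p\Big(\frac{\log n}{nh_n^7}\Big).$$ Moreover, wherever the filament is not flat the tangential component is of smaller order than the normal one: for each $x_0\in\mathcal G$ with $\nabla f(\mathfrak X_{x_0}(\theta_{x_0}))\neq0$ and each $\varepsilon>0$, $$P\Big(\big|\langle\hat{\mathfrak X}_{x_0}(\hat\theta_{x_0})-\mathfrak X_{x_0}(\theta_{x_0}),V^\perp(\mathfrak X_{x_0}(\theta_{x_0}))\rangle\big|\ \ge\ \varepsilon\,\big|\langle\hat{\mathfrak X}_{x_0}(\hat\theta_{x_0})-\mathfrak X_{x_0}(\theta_{x_0}),V(\mathfrak X_{x_0}(\theta_{x_0}))\rangle\big|\Big)\to0 .$$ Here $P$ of a possibly non-measurable event means outer probability, and $Z_n=O_p(r_n)$ means: for every $\varepsilon>0$ there is $M$ with $P(Z_n>Mr_n)\le\varepsilon$ for all large $n$. -/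

import Mathlib

open MeasureTheory ProbabilityTheory Filter Topology

/-- The Euclidean plane. -/
abbrev Plane : Type := EuclideanSpace ℝ (Fin 2)

noncomputable section

namespace Filament

/-! Differential quantities attached to a function on the plane. They are used both for the
density and for its kernel estimate (plug-in). -/

/-- The partial derivative in the `i`-th coordinate. -/
def partialDeriv (i : Fin 2) (g : Plane → ℝ) (x : Plane) : ℝ :=
  fderiv ℝ g x (EuclideanSpace.single i 1)

/-- `g^(2,0)` -/
def d20 (g : Plane → ℝ) : Plane → ℝ := partialDeriv 0 (partialDeriv 0 g)

/-- `g^(1,1)` -/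
def d11 (g : Plane → ℝ) : Plane → ℝ := partialDeriv 0 (partialDeriv 1 g)

/-- `g^(0,2)` -/
def d02 (g : Plane → ℝ) : Plane → ℝ := partialDeriv 1 (partialDeriv 1 g)

/-- `d² g = (g^(2,0), g^(1,1), g^(0,2))` -/
def dTwo (g : Plane → ℝ) (x : Plane) : Fin 3 → ℝ := ![d20 g x, d11 g x, d02 g x]

/-- The Hessian matrix. -/
def hessian (g : Plane → ℝ) (x : Plane) : Matrix (Fin 2) (Fin 2) ℝ :=
  !![d20 g x, d11 g x; d11 g x, d02 g x]

/-- The function `G` that maps the entries `(u, v, w)` of a symmetric matrix `(u v; v w)` to an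
eigenvector for the smaller eigenvalue. -/
def eigenG (u v w : ℝ) : Plane :=
  !₂[2 * u - 2 * w + 2 * v - 2 * √((w - u) ^ 2 + 4 * v ^ 2),
     w - u + 4 * v - √((w - u) ^ 2 + 4 * v ^ 2)]

/-- The second eigenvector field `V(x) = G(d² g(x))` of the Hessian. -/
def V (g : Plane → ℝ) (x : Plane) : Plane := eigenG (d20 g x) (d11 g x) (d02 g x)

/-- The smaller eigenvalue of the Hessian. -/
def lam2 (g : Plane → ℝ) (x : Plane) : ℝ :=
  (d20 g x + d02 g x - √((d20 g x - d02 g x) ^ 2 + 4 * d11 g x ^ 2)) / 2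

/-- The larger eigenvalue of the Hessian. -/
def lam1 (g : Plane → ℝ) (x : Plane) : ℝ :=
  (d20 g x + d02 g x + √((d20 g x - d02 g x) ^ 2 + 4 * d11 g x ^ 2)) / 2

/-- `W` is an eigenvector of the Hessian of `g` at `x` for the larger eigenvalue. -/
def IsFirstEigenvector (g : Plane → ℝ) (x W : Plane) : Prop :=
  Module.End.HasEigenvector (Matrix.toEuclideanLin (hessian g x)) (lam1 g x) W

/-- `⟨∇g(x), V(x)⟩`, the slope of `g` at `x` along the second eigenvector. -/
def slope (g : Plane → ℝ) (x : Plane) : ℝ := inner ℝ (gradient g x) (V g x)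

/-! Integral curves and the times at which they meet the ridge. -/

/-- `γ` solves `γ' = W(γ)` on the whole line, with `γ(0) = x₀`. -/
def IsGlobalSolution (W : Plane → Plane) (x₀ : Plane) (γ : ℝ → Plane) : Prop :=
  γ 0 = x₀ ∧ ∀ t, HasDerivAt γ (W (γ t)) t

open Classical in
/-- The integral curve of the vector field `W` that starts in `x₀`. For a Lipschitz field, such
as the fields `V f` and `V f̂` below, it exists on the whole line and is unique. -/
def integralCurve (W : Plane → Plane) (x₀ : Plane) : ℝ → Plane :=
  if h : ∃ γ, IsGlobalSolution W x₀ γ then h.choose else fun _ => x₀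

/-- The integral curve `𝔛_{x₀}` driven by the second eigenvector of the Hessian of `g`. -/
def curve (g : Plane → ℝ) (x₀ : Plane) : ℝ → Plane := integralCurve (V g) x₀

/-- The set `Θ_{x₀}` of times at which the curve from `x₀` is at a filament point of `g`. -/
def ridgeTimes (g : Plane → ℝ) (x₀ : Plane) : Set ℝ :=
  {t | slope g (curve g x₀ t) = 0 ∧ lam2 g (curve g x₀ t) < 0}

/-- The minimizers of `|t|` over `S`. -/
def argminAbs (S : Set ℝ) : Set ℝ := {t | t ∈ S ∧ ∀ s ∈ S, |t| ≤ |s|}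

open Classical in
/-- `θ_{x₀}`, the element of `Θ_{x₀}` of smallest absolute value. -/
def hitTime (g : Plane → ℝ) (x₀ : Plane) : ℝ :=
  if h : (argminAbs (ridgeTimes g x₀)).Nonempty then h.some else 0

/-- `t` is an admissible choice of the argmin of `|·|` over `S`: it is one of the minimizers if
there are any, and it is `0` if `S` is empty. -/
def IsArgminChoice (S : Set ℝ) (t : ℝ) : Prop :=
  ((argminAbs S).Nonempty → t ∈ argminAbs S) ∧ (S = ∅ → t = 0)

/-- The filament point `𝔛_{x₀}(θ_{x₀})` of the curve that starts in `x₀`. -/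
def filamentPoint (g : Plane → ℝ) (x₀ : Plane) : Plane := curve g x₀ (hitTime g x₀)

/-- The set `𝒢(ℒ, a)` of starting points. -/
def startSet (f : Plane → ℝ) (L : Set Plane) (a : ℝ) : Set Plane :=
  {x | ∃ y ∈ L, ∃ t ∈ Set.Icc (-a) a, x = curve f y t}

/-- The kernel density estimate with kernel `K` and bandwidth `h` from the first `n` terms of the
sample `x`. -/
def kde (K : Plane → ℝ) (h : ℝ) (n : ℕ) (x : ℕ → Plane) (y : Plane) : ℝ :=
  1 / (n * h ^ 2) * ∑ i ∈ Finset.range n, K (h⁻¹ • (y - x i))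

/-! The assumptions. -/

/-- The density: a four times continuously differentiable probability density whose partial
derivatives of orders one to four are bounded. -/
structure DensityAssumptions (f : Plane → ℝ) : Prop where
  nonneg : ∀ x, 0 ≤ f x
  integral_one : ∫ x, f x = 1
  smooth : ContDiff ℝ 4 f
  bounded : ∀ k : ℕ, 1 ≤ k → k ≤ 4 → ∃ C : ℝ, ∀ x, ‖iteratedFDeriv ℝ k f x‖ ≤ C

/-- The region `H`, the filament `L` and the half-length `a` of the arcs of starting points. -/
structure FilamentAssumptions (f : Plane → ℝ) (H L : Set Plane) (a : ℝ) : Prop where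
  compact_region : IsCompact H
  pos_near : ∃ ε₀ > 0, ∀ x ∈ Metric.thickening ε₀ H, 0 < f x
  distinct : ∀ x ∈ H, lam2 f x ≠ lam1 f x
  compact_filament : IsCompact L
  filament_subset : L ⊆ H
  a_pos : 0 < a
  start_subset : startSet f L a ⊆ H
  hit_unique : ∀ x₀ ∈ startSet f L a, ∃! t, t ∈ argminAbs (ridgeTimes f x₀)
  filament_eq : L = filamentPoint f '' startSet f L a
  mean_speed : ∃ γ > 0, ∀ x₀ ∈ L, ∀ s u : ℝ, -a ≤ s → s < u → u ≤ a →
    γ ≤ ‖(u - s)⁻¹ • ∫ t in s..u, V f (curve f x₀ t)‖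
  transversal : ∀ x ∈ L, inner ℝ (gradient (slope f) x) (V f x) ≠ 0
  nondegenerate : ∀ x ∈ H, ¬ (lam2 f x = 0 ∧ slope f x = 0)
  /-- The same nondegeneracy on the arcs `{𝔛_{x₀}(t) : |t| ≤ |θ_{x₀}|}` that are searched for the
  filament point nearest to `x₀`; automatic if these arcs lie in `H`. -/
  nondegenerate_arc : ∀ x₀ ∈ startSet f L a, ∀ t : ℝ, |t| ≤ |hitTime f x₀| →
    ¬ (lam2 f (curve f x₀ t) = 0 ∧ slope f (curve f x₀ t) = 0)

/-- The kernel: a symmetric four times differentiable probability density, supported by the unit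
ball, with bounded partial derivatives of orders one to four, isotropic second moments, and square
integrable second derivatives. -/
structure KernelAssumptions (K : Plane → ℝ) : Prop where
  nonneg : ∀ z, 0 ≤ K z
  integral_one : ∫ z, K z = 1
  symmetric : ∀ z, K (-z) = K z
  support_eq : tsupport K = Metric.closedBall 0 1
  differentiable : ∀ k : ℕ, k < 4 → Differentiable ℝ (iteratedFDeriv ℝ k K)
  bounded : ∀ k : ℕ, 1 ≤ k → k ≤ 4 → ∃ C : ℝ, ∀ z, ‖iteratedFDeriv ℝ k K z‖ ≤ C
  second_moments : ∃ μ₂ : ℝ, ∀ i j : Fin 2,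
    ∫ z : Plane, K z * (z i * z j) = if i = j then μ₂ else 0
  roughness : ∀ i j : Fin 3, Integrable (fun z => dTwo K z i * dTwo K z j)

/-- The bandwidths. -/
structure BandwidthAssumptions (h : ℕ → ℝ) : Prop where
  pos : ∀ n, 0 < h n
  tendsto_zero : Tendsto h atTop (𝓝 0)
  not_too_small : Tendsto (fun n : ℕ => n * h n ^ 8 / Real.log n ^ 3) atTop atTop
  not_too_large : ∃ β : ℝ, 0 ≤ β ∧ Tendsto (fun n : ℕ => n * h n ^ 9) atTop (𝓝 β)

/-- `X₀, X₁, …` are independent random points with density `f`. -/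
structure IsSample {Ω : Type*} [MeasurableSpace Ω] (P : Measure Ω) (f : Plane → ℝ)
    (X : ℕ → Ω → Plane) : Prop where
  measurable : ∀ i, Measurable (X i)
  indep : iIndepFun X P
  law : ∀ i, P.map (X i) = volume.withDensity (fun x => ENNReal.ofReal (f x))

/-- `Z_n = O_p(r_n)` for extended nonnegative `Z_n`. (`P` of a set that is not measurable is its
outer probability.) -/
def IsBigOp {Ω : Type*} [MeasurableSpace Ω] (P : Measure Ω) (Z : ℕ → Ω → ENNReal)
    (r : ℕ → ℝ) : Prop :=
  ∀ ε : ℝ, 0 < ε → ∃ M : ℝ, 0 < M ∧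
    ∀ᶠ n in atTop, P {ω | ENNReal.ofReal (M * r n) < Z n ω} ≤ ENNReal.ofReal ε

/-- The kernel density estimate from `X₀(ω), …, X_{n-1}(ω)` with bandwidth `h n`. -/
def fHat {Ω : Type*} (K : Plane → ℝ) (h : ℕ → ℝ) (X : ℕ → Ω → Plane) (n : ℕ) (ω : Ω) :
    Plane → ℝ :=
  kde K (h n) n (fun i => X i ω)

/-- The estimation error `𝔛̂_{x₀}(θ̂_{x₀}) - 𝔛_{x₀}(θ_{x₀})` of the filament point. -/
def filamentError {Ω : Type*} (f K : Plane → ℝ) (h : ℕ → ℝ) (X : ℕ → Ω → Plane)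
    (θhat : ℕ → Ω → Plane → ℝ) (n : ℕ) (ω : Ω) (x₀ : Plane) : Plane :=
  curve (fHat K h X n ω) x₀ (θhat n ω x₀) - filamentPoint f x₀

end Filament

end

/-! Write r = log n / (n h⁷). The proof joins a deterministic perturbation theorem,
`FilamentAssumptions.exists_perturbation_bound`, to two probabilistic facts: the estimate satisfies
the hypotheses of that theorem with probability tending to one (`rare_not_close`), and a suitable
linear functional of its Hessian error at a fixed point exceeds every multiple of r in probability
(`tendsto_measure_secondComb_le`).

Deterministic part. Let g be `Close` to f: gradients agree up to O(r), second derivatives only up to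
O(√r), third derivatives of g are bounded, but the linearized difference of the eigenvector fields,
integrated along trajectories of f, is O(r). The linearization remainder is quadratic, so the full
difference of the fields integrates to O(r), and Gronwall's inequality puts the two curves within
O(r) of each other at the hitting time θ of f. Transversality and compactness confine the hitting
time of g to θ + O(√r) (`argmin_near`). Between these times the curve of g moves for a time O(√r)
with velocity V f(y) + O(√r), where y is the filament point of f, so it deviates from the direction
V f(y) by only O(r). Hence every component of the error orthogonal to V f(y), in particular the one
along V⊥, is O(r). For the converse direction, the slope of g vanishes at its own filament point, so
|slope g(y)| is at most a constant times (‖error‖ + r), while slope g(y) = ⟨∇f(y), `linErr`(y)⟩ +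
O(r).

Probabilistic part. Kernel sums are controlled by a Bernstein bound on polynomially large nets; the
bias h² is O(r) because n h⁹ is bounded. At a point, the estimated second derivatives have variance
of order 1/(n h⁶), which yields √r and no better. The mean speed condition lets a trajectory spend
only a time O(h) within distance h of an observation, so integration along it lowers the variance to
1/(n h⁵), and this does give r.

Conversely, ⟨∇f(y), `linErr`(y)⟩ is a combination of second derivative errors whose coefficients do
not all vanish when V f(y) and ∇f(y) are nonzero (`linCoef_ne_zero`). Its standard deviation, of
order (n h⁶)^(-1/2), is much larger than r since n h⁸ / (log n)² tends to infinity. An estimate of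
characteristic functions (`tendsto_measure_abs_sum_le`) replaces the central limit theorem and shows
that it is not O(r). So the error is not O(r) although its normal part is, and the tangential part
must dominate. -/

noncomputable section

namespace Filament

/-! ### Algebra of the eigenvector map -/

/-- The gap between the eigenvalues of the symmetric matrix with entries `u, v, w`. -/
def gap (u v w : ℝ) : ℝ := √((w - u) ^ 2 + 4 * v ^ 2)

/-- With the traceless part of the matrix read as a complex number, Lipschitz continuity of the gap
and the bounds on `cosPart` and `sinPart` reduce to properties of the modulus. -/
lemma gap_eq_norm (u v w : ℝ) : gap u v w = ‖(⟨w - u, 2 * v⟩ : ℂ)‖ := by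
  rw [Complex.norm_eq_sqrt_sq_add_sq, gap]
  congr 1; ring

lemma gap_nonneg (u v w : ℝ) : 0 ≤ gap u v w := Real.sqrt_nonneg _

lemma gap_sq (u v w : ℝ) : gap u v w ^ 2 = (w - u) ^ 2 + 4 * v ^ 2 :=
  Real.sq_sqrt (by positivity)

lemma abs_gap_sub_le (u v w u' v' w' : ℝ) :
    |gap u v w - gap u' v' w'| ≤ |u - u'| + 2 * |v - v'| + |w - w'| := by
  rw [gap_eq_norm, gap_eq_norm]
  refine (abs_norm_sub_norm_le _ _).trans ((Complex.norm_le_abs_re_add_abs_im _).trans ?_)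
  simp only [Complex.sub_re, Complex.sub_im]
  have h1 : |w - u - (w' - u')| ≤ |u - u'| + |w - w'| := by
    have : w - u - (w' - u') = (w - w') - (u - u') := by ring
    rw [this]; exact (abs_sub _ _).trans (by linarith)
  have h2 : |2 * v - 2 * v'| = 2 * |v - v'| := by
    rw [← mul_sub, abs_mul]; norm_num
  linarith

lemma norm_le_abs_add_abs (x : Plane) : ‖x‖ ≤ |x 0| + |x 1| := by
  rw [EuclideanSpace.norm_eq]
  apply Real.sqrt_le_iff.2 ⟨by positivity, ?_⟩
  simp only [Fin.sum_univ_two, Real.norm_eq_abs]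
  nlinarith [abs_nonneg (x 0), abs_nonneg (x 1)]

lemma abs_apply_le_norm (x : Plane) (i : Fin 2) : |x i| ≤ ‖x‖ := by
  simpa using PiLp.norm_apply_le x i

lemma inner_eq (x y : Plane) : inner ℝ x y = x 0 * y 0 + x 1 * y 1 := by
  simp [PiLp.inner_apply, Fin.sum_univ_two, mul_comm]

@[simp] lemma eigenG_apply_zero (u v w : ℝ) :
    eigenG u v w 0 = 2 * u - 2 * w + 2 * v - 2 * gap u v w := by
  simp [eigenG, gap]

@[simp] lemma eigenG_apply_one (u v w : ℝ) :
    eigenG u v w 1 = w - u + 4 * v - gap u v w := by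
  simp [eigenG, gap]

lemma norm_eigenG_sub_le (u v w u' v' w' : ℝ) :
    ‖eigenG u v w - eigenG u' v' w'‖ ≤ 12 * (|u - u'| + |v - v'| + |w - w'|) := by
  refine (norm_le_abs_add_abs _).trans ?_
  have h := abs_le.1 (abs_gap_sub_le u v w u' v' w')
  simp only [PiLp.sub_apply, eigenG_apply_zero, eigenG_apply_one]
  have hu := le_abs_self (u - u'); have hu' := neg_abs_le (u - u')
  have hv := le_abs_self (v - v'); have hv' := neg_abs_le (v - v')
  have hw := le_abs_self (w - w'); have hw' := neg_abs_le (w - w')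
  have h0 : |2 * u - 2 * w + 2 * v - 2 * gap u v w -
      (2 * u' - 2 * w' + 2 * v' - 2 * gap u' v' w')| ≤
      4 * |u - u'| + 6 * |v - v'| + 4 * |w - w'| := by
    rw [abs_le]; constructor <;> linarith [h.1, h.2]
  have h1 : |w - u + 4 * v - gap u v w - (w' - u' + 4 * v' - gap u' v' w')| ≤
      2 * |u - u'| + 6 * |v - v'| + 2 * |w - w'| := by
    rw [abs_le]; constructor <;> linarith [h.1, h.2]
  linarith [abs_nonneg (u - u'), abs_nonneg (w - w')]

lemma norm_eigenG_le (u v w : ℝ) : ‖eigenG u v w‖ ≤ 12 * (|u| + |v| + |w|) := by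
  have h := norm_eigenG_sub_le u v w 0 0 0
  have h0 : eigenG 0 0 0 = 0 := by
    ext i; fin_cases i <;> simp [gap]
  simpa [h0] using h

/-- `eigenG` is -2 times the gap times the orthogonal projection of the fixed vector (2, 1) onto the
lower eigenspace. In particular it also vanishes when (2, 1) spans the upper eigenspace, although
the gap is positive there. -/
lemma eigenG_eigen_zero (u v w : ℝ) :
    u * eigenG u v w 0 + v * eigenG u v w 1 = (u + w - gap u v w) / 2 * eigenG u v w 0 := by
  simp only [eigenG_apply_zero, eigenG_apply_one]
  linear_combination (-1) * gap_sq u v w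

lemma eigenG_eigen_one (u v w : ℝ) :
    v * eigenG u v w 0 + w * eigenG u v w 1 = (u + w - gap u v w) / 2 * eigenG u v w 1 := by
  simp only [eigenG_apply_zero, eigenG_apply_one]
  linear_combination (-1 / 2) * gap_sq u v w

/-- The cosine of the angle of the traceless part of a symmetric matrix. -/
def cosPart (u v w : ℝ) : ℝ := (w - u) / gap u v w

/-- The sine of the angle of the traceless part of a symmetric matrix. -/
def sinPart (u v w : ℝ) : ℝ := 2 * v / gap u v w

lemma cosPart_sq_add_sinPart_sq {u v w : ℝ} (h : 0 < gap u v w) :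
    cosPart u v w ^ 2 + sinPart u v w ^ 2 = 1 := by
  have := gap_sq u v w
  rw [cosPart, sinPart, div_pow, div_pow, ← add_div, div_eq_one_iff_eq (by positivity), this]
  ring

lemma abs_sub_le_gap (u v w : ℝ) : |w - u| ≤ gap u v w := by
  rw [gap_eq_norm]; exact Complex.abs_re_le_norm ⟨w - u, 2 * v⟩

lemma abs_two_mul_le_gap (u v w : ℝ) : |2 * v| ≤ gap u v w := by
  rw [gap_eq_norm]; exact Complex.abs_im_le_norm ⟨w - u, 2 * v⟩

/-- The derivative of `gap` at `(u, v, w)`. -/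
def gapDeriv (u v w a b c : ℝ) : ℝ := cosPart u v w * (c - a) + 2 * sinPart u v w * b

/-- The derivative of `eigenG` at `(u, v, w)`. -/
def linG (u v w a b c : ℝ) : Plane :=
  !₂[2 * a - 2 * c + 2 * b - 2 * gapDeriv u v w a b c, c - a + 4 * b - gapDeriv u v w a b c]

@[simp] lemma linG_apply_zero (u v w a b c : ℝ) :
    linG u v w a b c 0 = 2 * a - 2 * c + 2 * b - 2 * gapDeriv u v w a b c := by
  simp [linG]

@[simp] lemma linG_apply_one (u v w a b c : ℝ) :
    linG u v w a b c 1 = c - a + 4 * b - gapDeriv u v w a b c := by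
  simp [linG]

/-- The gap is a Euclidean norm, so the remainder of its linearization is (product of the norms
minus inner product) / gap. The numerator is nonnegative by Cauchy–Schwarz, and twice it is the
squared distance minus the squared difference of the norms. -/
lemma abs_gap_sub_gapDeriv_le {u v w : ℝ} (h : 0 < gap u v w) (u' v' w' : ℝ) :
    |gap u' v' w' - gap u v w - gapDeriv u v w (u' - u) (v' - v) (w' - w)| ≤
      (|u' - u| + 2 * |v' - v| + |w' - w|) ^ 2 / gap u v w := by
  set D := gap u v w with hD
  set D' := gap u' v' w' with hD'
  have e : D' - D - gapDeriv u v w (u' - u) (v' - v) (w' - w) =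
      (D' * D - ((w - u) * (w' - u') + 4 * v * v')) / D := by
    have hs := gap_sq u v w
    rw [gapDeriv, cosPart, sinPart, ← hD]
    field_simp
    rw [← hD] at hs
    linear_combination -hs
  rw [e, abs_div, abs_of_pos h]
  have hs := gap_sq u v w
  have hs' := gap_sq u' v' w'
  rw [← hD] at hs; rw [← hD'] at hs'
  have hnn : 0 ≤ D' := gap_nonneg _ _ _
  have key : |(w - u) * (w' - u') + 4 * v * v'| ≤ D' * D := by
    apply abs_le_of_sq_le_sq _ (by positivity)
    rw [mul_pow, hs, hs']
    nlinarith [sq_nonneg ((w - u) * (2 * v') - (w' - u') * (2 * v))]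
  have h1 := (abs_le.1 key).2
  rw [abs_of_nonneg (by linarith)]
  gcongr
  have e1 : 2 * (D' * D - ((w - u) * (w' - u') + 4 * v * v')) =
      (w' - w - (u' - u)) ^ 2 + (2 * (v' - v)) ^ 2 - (D - D') ^ 2 := by
    linear_combination hs + hs'
  have h2 : (w' - w - (u' - u)) ^ 2 ≤ (|u' - u| + |w' - w|) ^ 2 :=
    sq_le_sq' (by linarith [neg_abs_le (w' - w), le_abs_self (u' - u)])
      (by linarith [le_abs_self (w' - w), neg_abs_le (u' - u)])
  have h3 : (2 * (v' - v)) ^ 2 = (2 * |v' - v|) ^ 2 := by rw [mul_pow, mul_pow, sq_abs]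
  nlinarith [sq_nonneg (D - D'), abs_nonneg (u' - u), abs_nonneg (v' - v), abs_nonneg (w' - w),
    mul_nonneg (add_nonneg (abs_nonneg (u' - u)) (abs_nonneg (w' - w))) (abs_nonneg (v' - v))]

lemma norm_eigenG_sub_linG_le {u v w : ℝ} (h : 0 < gap u v w) (u' v' w' : ℝ) :
    ‖eigenG u' v' w' - eigenG u v w - linG u v w (u' - u) (v' - v) (w' - w)‖ ≤
      3 * ((|u' - u| + 2 * |v' - v| + |w' - w|) ^ 2 / gap u v w) := by
  refine (norm_le_abs_add_abs _).trans ?_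
  have h := abs_gap_sub_gapDeriv_le h u' v' w'
  set E := gap u' v' w' - gap u v w - gapDeriv u v w (u' - u) (v' - v) (w' - w) with hE
  have e0 : (eigenG u' v' w' - eigenG u v w - linG u v w (u' - u) (v' - v) (w' - w)) 0 =
      -2 * E := by
    simp only [PiLp.sub_apply, eigenG_apply_zero, linG_apply_zero]; rw [hE]; ring
  have e1 : (eigenG u' v' w' - eigenG u v w - linG u v w (u' - u) (v' - v) (w' - w)) 1 =
      -E := by
    simp only [PiLp.sub_apply, eigenG_apply_one, linG_apply_one]; rw [hE]; ring
  rw [e0, e1, abs_mul, abs_neg, abs_neg, abs_two]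
  linarith

/-- The coefficients of the linear form `B ↦ ⟨W, linG B⟩`. -/
def linCoef (u v w : ℝ) (W : Plane) : Fin 3 → ℝ :=
  ![W 0 * (2 + 2 * cosPart u v w) + W 1 * (-1 + cosPart u v w),
    W 0 * (2 - 4 * sinPart u v w) + W 1 * (4 - 2 * sinPart u v w),
    W 0 * (-2 - 2 * cosPart u v w) + W 1 * (1 - cosPart u v w)]

lemma inner_linG (u v w a b c : ℝ) (W : Plane) : inner ℝ W (linG u v w a b c) =
    linCoef u v w W 0 * a + linCoef u v w W 1 * b + linCoef u v w W 2 * c := by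
  rw [inner_eq]
  simp [linCoef, gapDeriv]
  ring

/-- The third coefficient is minus the first, so vanishing is a 2×2 linear system for W with
determinant 10 - 8Q + 6P. On the unit circle this determinant is zero only at (P, Q) = (-3/5, 4/5),
which is exactly where `eigenG` vanishes. -/
lemma linCoef_ne_zero {u v w : ℝ} (h : 0 < gap u v w) (hG : eigenG u v w ≠ 0) {W : Plane}
    (hW : W ≠ 0) : linCoef u v w W ≠ 0 := by
  intro h0
  have h1 : W 0 * (2 + 2 * cosPart u v w) + W 1 * (-1 + cosPart u v w) = 0 := by
    simpa [linCoef] using congrFun h0 0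
  have h2 : W 0 * (2 - 4 * sinPart u v w) + W 1 * (4 - 2 * sinPart u v w) = 0 := by
    simpa [linCoef] using congrFun h0 1
  have hPQ := cosPart_sq_add_sinPart_sq h
  have hp : w - u = cosPart u v w * gap u v w := by rw [cosPart]; field_simp
  have hq : 2 * v = sinPart u v w * gap u v w := by rw [sinPart]; field_simp
  set P := cosPart u v w
  set Q := sinPart u v w
  have d0 : W 0 * (10 - 8 * Q + 6 * P) = 0 := by
    linear_combination (4 - 2 * Q) * h1 + (1 - P) * h2
  have d1 : W 1 * (10 - 8 * Q + 6 * P) = 0 := by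
    linear_combination (4 * Q - 2) * h1 + (2 + 2 * P) * h2
  by_cases hd : 10 - 8 * Q + 6 * P = 0
  · apply hG
    have h5 : (5 * P + 3) ^ 2 + (5 * Q - 4) ^ 2 = 0 := by
      linear_combination 25 * hPQ + 5 * hd
    have hP : 5 * P + 3 = 0 := by nlinarith [sq_nonneg (5 * P + 3), sq_nonneg (5 * Q - 4)]
    have hQ : 5 * Q - 4 = 0 := by nlinarith [sq_nonneg (5 * P + 3), sq_nonneg (5 * Q - 4)]
    ext i
    fin_cases i
    · simp only [Fin.zero_eta, eigenG_apply_zero, PiLp.zero_apply]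
      linear_combination (-2) * hp + hq + gap u v w * (-2 / 5 * hP + 1 / 5 * hQ)
    · simp only [Fin.mk_one, eigenG_apply_one, PiLp.zero_apply]
      linear_combination hp + 2 * hq + gap u v w * (1 / 5 * hP + 2 / 5 * hQ)
  · apply hW
    ext i
    fin_cases i
    · simpa [hd] using d0
    · simpa [hd] using d1

/-! ### Global solutions of Lipschitz differential equations -/

section ODE

variable {W : Plane → Plane} {K C : ℝ}

/-- Since the speed is at most C everywhere, a ball of radius C T suffices for Picard–Lindelöf on
the whole interval at once. -/
lemma exists_solution_Icc (hK : 0 ≤ K) (hC : 0 ≤ C)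
    (hW : ∀ x y, ‖W x - W y‖ ≤ K * ‖x - y‖) (hb : ∀ x, ‖W x‖ ≤ C) (x₀ : Plane) {T : ℝ} (hT : 0 ≤ T) :
    ∃ γ : ℝ → Plane, γ 0 = x₀ ∧
      ∀ t ∈ Set.Icc (-T) T, HasDerivWithinAt γ (W (γ t)) (Set.Icc (-T) T) t := by
  have hpl : IsPicardLindelof (fun _ : ℝ => W) (tmin := -T) (tmax := T) ⟨0, by simp [hT]⟩ x₀
      ⟨C * T, by positivity⟩ 0 ⟨C, hC⟩ ⟨K, hK⟩ := by
    refine IsPicardLindelof.of_time_independent (fun x _ => hb x) ?_ ?_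
    · exact (LipschitzWith.of_dist_le_mul fun x y => by
        rw [dist_eq_norm, dist_eq_norm]; exact hW x y).lipschitzOnWith
    · simp only [NNReal.coe_zero, sub_zero, max_self, sub_neg_eq_add, zero_add]
      exact le_rfl
  exact hpl.exists_eq_forall_mem_Icc_hasDerivWithinAt₀

lemma exists_isGlobalSolution (hK : 0 ≤ K) (hC : 0 ≤ C)
    (hW : ∀ x y, ‖W x - W y‖ ≤ K * ‖x - y‖) (hb : ∀ x, ‖W x‖ ≤ C) (x₀ : Plane) :
    ∃ γ, IsGlobalSolution W x₀ γ := by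
  choose γ h0 hγ using fun n : ℕ =>
    exists_solution_Icc hK hC hW hb x₀ (T := (n : ℝ) + 1) (by positivity)
  have hd : ∀ n : ℕ, ∀ t ∈ Set.Ioo (-((n : ℝ) + 1)) (n + 1),
      HasDerivAt (γ n) (W (γ n t)) t := fun n t ht =>
    (hγ n t ⟨ht.1.le, ht.2.le⟩).hasDerivAt (Icc_mem_nhds ht.1 ht.2)
  have hlip : LipschitzWith ⟨K, hK⟩ W := LipschitzWith.of_dist_le_mul fun x y => by
    rw [dist_eq_norm, dist_eq_norm]; exact hW x y
  have huniq : ∀ m n : ℕ, m ≤ n → Set.EqOn (γ m) (γ n) (Set.Ioo (-((m : ℝ) + 1)) (m + 1)) := by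
    intro m n hmn
    have hmn' : (m : ℝ) ≤ n := by exact_mod_cast hmn
    refine ODE_solution_unique_of_mem_Ioo (v := fun _ => W) (s := fun _ => Set.univ)
      (K := ⟨K, hK⟩) (t₀ := 0) (fun t _ => hlip.lipschitzOnWith) ?_ ?_ ?_ ?_
    · constructor <;> linarith [(Nat.cast_nonneg m : (0 : ℝ) ≤ m)]
    · exact fun t ht => ⟨hd m t ht, trivial⟩
    · exact fun t ht => ⟨hd n t ⟨by linarith [ht.1], by linarith [ht.2]⟩, trivial⟩
    · rw [h0, h0]
  -- Time t is served by the solution of index ⌈|t|⌉₊. Its interval extends one unit further, so it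
  -- contains a neighbourhood of t, and there the solutions of different index agree by uniqueness.
  refine ⟨fun t => γ (⌈|t|⌉₊) t, ?_, fun t => ?_⟩
  · simp [h0]
  · set n := ⌈|t|⌉₊ with hn
    have hlt : ∀ s : ℝ, s ∈ Set.Ioo (-((⌈|s|⌉₊ : ℝ) + 1)) (⌈|s|⌉₊ + 1) := fun s => by
      have := Nat.le_ceil |s|
      constructor <;> linarith [neg_abs_le s, le_abs_self s]
    have hD := hd n t (hlt t)
    refine hD.congr_of_eventuallyEq ?_
    filter_upwards [Ioo_mem_nhds (hlt t).1 (hlt t).2] with s hs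
    rcases le_total (⌈|s|⌉₊) n with h | h
    · exact huniq _ _ h (hlt s)
    · exact (huniq _ _ h hs).symm

lemma integralCurve_spec (hK : 0 ≤ K) (hC : 0 ≤ C)
    (hW : ∀ x y, ‖W x - W y‖ ≤ K * ‖x - y‖) (hb : ∀ x, ‖W x‖ ≤ C) (x₀ : Plane) :
    IsGlobalSolution W x₀ (integralCurve W x₀) := by
  have h := exists_isGlobalSolution hK hC hW hb x₀
  rw [integralCurve, dif_pos h]
  exact h.choose_spec

lemma IsGlobalSolution.unique (hK : 0 ≤ K) (hW : ∀ x y, ‖W x - W y‖ ≤ K * ‖x - y‖) {x₀ : Plane}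
    {γ δ : ℝ → Plane} (hγ : IsGlobalSolution W x₀ γ) (hδ : IsGlobalSolution W x₀ δ) : γ = δ := by
  have hlip : LipschitzWith ⟨K, hK⟩ W := LipschitzWith.of_dist_le_mul fun x y => by
    rw [dist_eq_norm, dist_eq_norm]; exact hW x y
  exact ODE_solution_unique_univ (v := fun _ => W) (s := fun _ => Set.univ) (t₀ := 0)
    (fun _ => hlip.lipschitzOnWith) (fun t => ⟨hγ.2 t, trivial⟩) (fun t => ⟨hδ.2 t, trivial⟩)
    (hγ.1.trans hδ.1.symm)

lemma IsGlobalSolution.continuous {x₀ : Plane} {γ : ℝ → Plane} (hγ : IsGlobalSolution W x₀ γ) :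
    Continuous γ :=
  continuous_iff_continuousAt.2 fun t => (hγ.2 t).continuousAt

lemma IsGlobalSolution.shift {x₀ : Plane} {γ : ℝ → Plane} (hγ : IsGlobalSolution W x₀ γ) (s : ℝ) :
    IsGlobalSolution W (γ s) (fun t => γ (s + t)) :=
  ⟨by simp, fun t => by
    simpa using HasDerivAt.comp_const_add s t (hγ.2 (s + t))⟩

/-- Time reversal. -/
lemma IsGlobalSolution.reverse {x₀ : Plane} {γ : ℝ → Plane} (hγ : IsGlobalSolution W x₀ γ) :
    IsGlobalSolution (fun x => -W x) x₀ (fun t => γ (-t)) :=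
  ⟨by simp [hγ.1], fun t => by
    have := (hγ.2 (-t)).scomp t (hasDerivAt_neg t)
    simpa [Function.comp_def] using this⟩

/-- A trajectory does not leave a ball faster than the speed on the ball permits. -/
lemma IsGlobalSolution.norm_sub_le_of_bound {x₀ : Plane} {γ : ℝ → Plane}
    (hγ : IsGlobalSolution W x₀ γ) {T S : ℝ} (hS : 0 ≤ S)
    (hb : ∀ x, ‖x - x₀‖ ≤ S * T → ‖W x‖ < S) {t : ℝ} (ht : |t| ≤ T) : ‖γ t - x₀‖ ≤ S * |t| := by
  have main : ∀ (W : Plane → Plane) (γ : ℝ → Plane), IsGlobalSolution W x₀ γ →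
      (∀ x, ‖x - x₀‖ ≤ S * T → ‖W x‖ < S) → ∀ t ∈ Set.Icc 0 T, ‖γ t - x₀‖ ≤ S * t := by
    intro W γ hγ hb t ht
    -- The comparison only asks for the strict speed bound at instants when the distance equals S s.
    -- Such points lie in the ball on which the bound is assumed.
    refine image_norm_le_of_norm_deriv_right_lt_deriv_boundary (f := fun t => γ t - x₀)
      (f' := fun t => W (γ t)) (a := 0) (b := T) (B := fun t => S * t) (B' := fun _ => S)
      (hγ.continuous.sub continuous_const).continuousOn
      (fun x _ => ((hγ.2 x).sub_const x₀).hasDerivWithinAt) (by simp [hγ.1])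
      (fun x => by simpa using (hasDerivAt_id x).const_mul S) ?_ ht
    intro s hs hbd
    apply hb
    rw [hbd]
    exact mul_le_mul_of_nonneg_left hs.2.le hS
  rcases le_total 0 t with h | h
  · rw [abs_of_nonneg h] at ht ⊢
    exact main W γ hγ hb t ⟨h, ht⟩
  · rw [abs_of_nonpos h] at ht ⊢
    simpa using main _ _ hγ.reverse (fun x hx => by rw [norm_neg]; exact hb x hx) (-t)
      ⟨by linarith, ht⟩

/-- Two trajectories differ by at most a constant times the largest integrated difference of
the vector fields along the first trajectory. -/
lemma IsGlobalSolution.norm_sub_le_of_integral {W' : Plane → Plane} {x₀ x₁ : Plane}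
    {γ γ' : ℝ → Plane} (hγ : IsGlobalSolution W x₀ γ) (hγ' : IsGlobalSolution W' x₁ γ')
    {s : Set Plane} (hK : 0 < K) (hcW : Continuous W) (hcW' : Continuous W')
    (hW' : ∀ x ∈ s, ∀ y ∈ s, ‖W' x - W' y‖ ≤ K * ‖x - y‖) {T κ δ : ℝ} (hT : 0 ≤ T)
    (hs : ∀ t ∈ Set.Icc 0 T, γ t ∈ s) (hs' : ∀ t ∈ Set.Icc 0 T, γ' t ∈ s)
    (hδ : ‖x₁ - x₀‖ ≤ δ)
    (hκ : ∀ t ∈ Set.Icc 0 T, ‖∫ r in (0 : ℝ)..t, (W' (γ r) - W (γ r))‖ ≤ κ) :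
    ‖γ' T - γ T‖ ≤ (κ + δ) * Real.exp (K * T) := by
  -- Subtracting the integrated forcing q leaves a function whose derivative involves W' alone.
  -- Gronwall then sees the size of the integral and not that of the integrand, so cancellation
  -- along the trajectory is preserved.
  set q : ℝ → Plane := fun t => ∫ r in (0 : ℝ)..t, (W' (γ r) - W (γ r)) with hq
  have hqc : Continuous fun r => W' (γ r) - W (γ r) :=
    (hcW'.comp hγ.continuous).sub (hcW.comp hγ.continuous)
  have hqd : ∀ t, HasDerivAt q (W' (γ t) - W (γ t)) t := fun t =>
    intervalIntegral.integral_hasDerivAt_right (hqc.intervalIntegrable _ _)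
      (hqc.stronglyMeasurableAtFilter _ _) hqc.continuousAt
  have hd : ∀ t, HasDerivAt (fun t => γ' t - γ t - q t) (W' (γ' t) - W' (γ t)) t := fun t => by
    have e : W' (γ' t) - W' (γ t) = W' (γ' t) - W (γ t) - (W' (γ t) - W (γ t)) := by abel
    rw [e]
    exact ((hγ'.2 t).sub (hγ.2 t)).sub (hqd t)
  have key := norm_le_gronwallBound_of_norm_deriv_right_le (f := fun t => γ' t - γ t - q t)
    (f' := fun t => W' (γ' t) - W' (γ t)) (δ := δ) (K := K) (ε := K * κ) (a := 0) (b := T)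
    (continuous_iff_continuousAt.2 fun t => (hd t).continuousAt).continuousOn
    (fun t _ => (hd t).hasDerivWithinAt) (by simpa [hq, hγ.1, hγ'.1] using hδ) ?_ T ⟨hT, le_rfl⟩
  · rw [gronwallBound_of_K_ne_0 hK.ne'] at key
    simp only [sub_zero, mul_div_cancel_left₀ _ hK.ne'] at key
    have h2 : ‖γ' T - γ T‖ ≤ ‖γ' T - γ T - q T‖ + ‖q T‖ := by
      simpa using norm_add_le (γ' T - γ T - q T) (q T)
    have h3 := hκ T ⟨hT, le_rfl⟩
    have : (κ + δ) * Real.exp (K * T) =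
      δ * Real.exp (K * T) + κ * (Real.exp (K * T) - 1) + κ := by ring
    rw [this]
    exact h2.trans (add_le_add key h3)
  · intro t ht
    have ht' : t ∈ Set.Icc 0 T := ⟨ht.1, ht.2.le⟩
    refine (hW' _ (hs' t ht') _ (hs t ht')).trans ?_
    rw [← mul_add]
    refine mul_le_mul_of_nonneg_left ?_ hK.le
    have h2 : ‖γ' t - γ t‖ ≤ ‖γ' t - γ t - q t‖ + ‖q t‖ := by
      simpa using norm_add_le (γ' t - γ t - q t) (q t)
    exact h2.trans (by gcongr; exact hκ t ht')

/-- Negative end times follow by reversing both trajectories and the sign of both fields. -/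
lemma IsGlobalSolution.norm_sub_le_of_integral' {W' : Plane → Plane} {x₀ x₁ : Plane}
    {γ γ' : ℝ → Plane} (hγ : IsGlobalSolution W x₀ γ) (hγ' : IsGlobalSolution W' x₁ γ')
    {s : Set Plane} (hK : 0 < K) (hcW : Continuous W) (hcW' : Continuous W')
    (hW' : ∀ x ∈ s, ∀ y ∈ s, ‖W' x - W' y‖ ≤ K * ‖x - y‖) {T κ δ : ℝ}
    (hs : ∀ t ∈ Set.uIcc 0 T, γ t ∈ s) (hs' : ∀ t ∈ Set.uIcc 0 T, γ' t ∈ s)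
    (hδ : ‖x₁ - x₀‖ ≤ δ)
    (hκ : ∀ t ∈ Set.uIcc 0 T, ‖∫ r in (0 : ℝ)..t, (W' (γ r) - W (γ r))‖ ≤ κ) :
    ‖γ' T - γ T‖ ≤ (κ + δ) * Real.exp (K * |T|) := by
  rcases le_total 0 T with h | h
  · rw [Set.uIcc_of_le h] at hs hs' hκ
    rw [abs_of_nonneg h]
    exact hγ.norm_sub_le_of_integral hγ' hK hcW hcW' hW' h hs hs' hδ hκ
  · rw [Set.uIcc_of_ge h] at hs hs' hκ
    rw [abs_of_nonpos h]
    have hm : ∀ t ∈ Set.Icc 0 (-T), -t ∈ Set.Icc T 0 := fun t ht =>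
      ⟨by linarith [ht.2], by linarith [ht.1]⟩
    have := hγ.reverse.norm_sub_le_of_integral hγ'.reverse (s := s) (K := K) (κ := κ) (T := -T)
      hK hcW.neg hcW'.neg
      (fun x hx y hy => by rw [neg_sub_neg, norm_sub_rev]; exact hW' x hx y hy)
      (by linarith) (fun t ht => hs _ (hm t ht)) (fun t ht => hs' _ (hm t ht)) hδ
      (fun t ht => by
        have h1 := hκ (-t) (hm t ht)
        have h2 : ∫ r in (0 : ℝ)..t, (-W' (γ (-r)) - -W (γ (-r))) =
            ∫ r in (0 : ℝ)..(-t), (W' (γ r) - W (γ r)) := by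
          have h3 := intervalIntegral.integral_comp_neg (a := (0 : ℝ)) (b := t)
            (fun r => W' (γ r) - W (γ r))
          rw [neg_zero] at h3
          rw [intervalIntegral.integral_symm (-t) 0, ← h3, ← intervalIntegral.integral_neg]
          congr 1; ext1 r; abel
        rw [h2]; exact h1)
    simpa using this

end ODE

/-! ### Iterated partial derivatives -/

/-- Iterated partial derivatives; the head of the list is the last derivative taken. -/
def pd : List (Fin 2) → (Plane → ℝ) → Plane → ℝ
  | [], g => g
  | i :: l, g => partialDeriv i (pd l g)

@[simp] lemma pd_nil (g : Plane → ℝ) : pd [] g = g := rfl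

lemma pd_cons (i : Fin 2) (l : List (Fin 2)) (g : Plane → ℝ) :
    pd (i :: l) g = partialDeriv i (pd l g) := rfl

lemma d20_eq (g : Plane → ℝ) : d20 g = pd [0, 0] g := rfl
lemma d11_eq (g : Plane → ℝ) : d11 g = pd [0, 1] g := rfl
lemma d02_eq (g : Plane → ℝ) : d02 g = pd [1, 1] g := rfl

/-- The partial derivatives of orders less than `N` are differentiable and those of orders
`1, …, N` are bounded. -/
structure TameDeriv (N : ℕ) (g : Plane → ℝ) : Prop where
  diff : ∀ l : List (Fin 2), l.length < N → Differentiable ℝ (pd l g)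
  bdd : ∀ l : List (Fin 2), 1 ≤ l.length → l.length ≤ N → ∃ C : ℝ, ∀ x, |pd l g x| ≤ C

lemma TameDeriv.mono {M N : ℕ} {g : Plane → ℝ} (h : TameDeriv N g) (hMN : M ≤ N) :
    TameDeriv M g :=
  ⟨fun l hl => h.diff l (hl.trans_le hMN), fun l h1 hl => h.bdd l h1 (hl.trans hMN)⟩

lemma pd_eq_iteratedFDeriv {N : ℕ} {g : Plane → ℝ}
    (hd : ∀ k < N, Differentiable ℝ (iteratedFDeriv ℝ k g)) (l : List (Fin 2))
    (hl : l.length ≤ N) :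
    pd l g = fun x => iteratedFDeriv ℝ l.length g x fun j => EuclideanSpace.single (l.get j) 1 := by
  induction l with
  | nil => ext x; simp
  | cons i l ih =>
    have hl' : l.length < N := hl
    have hD := hd _ hl'
    rw [pd_cons, ih hl'.le]
    ext x
    have h1 : HasFDerivAt (fun x => iteratedFDeriv ℝ l.length g x
        fun j => EuclideanSpace.single (l.get j) 1)
        ((ContinuousMultilinearMap.apply ℝ (fun _ : Fin l.length => Plane) ℝ
          (fun j => EuclideanSpace.single (l.get j) 1)).comp
          (fderiv ℝ (iteratedFDeriv ℝ l.length g) x)) x :=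
      (ContinuousMultilinearMap.apply ℝ (fun _ : Fin l.length => Plane) ℝ
        (fun j => EuclideanSpace.single (l.get j) 1)).hasFDerivAt.comp x (hD x).hasFDerivAt
    rw [partialDeriv, h1.fderiv]
    change _ = iteratedFDeriv ℝ (l.length + 1) g x _
    rw [iteratedFDeriv_succ_apply_left]
    rfl

/-- Continuity of the derivative of top order is not required, because the kernel is only four times
differentiable. This covers the density and the kernel alike. -/
lemma tameDeriv_of_iteratedFDeriv {N : ℕ} {g : Plane → ℝ}
    (hd : ∀ k < N, Differentiable ℝ (iteratedFDeriv ℝ k g))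
    (hb : ∀ k : ℕ, 1 ≤ k → k ≤ N → ∃ C : ℝ, ∀ x, ‖iteratedFDeriv ℝ k g x‖ ≤ C) :
    TameDeriv N g := by
  refine ⟨fun l hl => ?_, fun l h1 hl => ?_⟩
  · rw [pd_eq_iteratedFDeriv hd l hl.le]
    intro x
    exact ((ContinuousMultilinearMap.apply ℝ (fun _ : Fin l.length => Plane) ℝ
      (fun j => EuclideanSpace.single (l.get j) 1)).differentiableAt).comp x (hd _ hl x)
  · obtain ⟨C, hC⟩ := hb _ h1 hl
    refine ⟨C, fun x => ?_⟩
    rw [pd_eq_iteratedFDeriv hd l hl]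
    refine ((iteratedFDeriv ℝ l.length g x).le_opNorm
      (fun j => EuclideanSpace.single (l.get j) 1)).trans ?_
    simpa using hC x

lemma fderiv_apply_eq (g : Plane → ℝ) (x v : Plane) :
    fderiv ℝ g x v = v 0 * partialDeriv 0 g x + v 1 * partialDeriv 1 g x := by
  have hv : v = v 0 • EuclideanSpace.single 0 (1 : ℝ) + v 1 • EuclideanSpace.single 1 (1 : ℝ) := by
    ext i; fin_cases i <;> simp
  conv_lhs => rw [hv]
  simp [partialDeriv]

lemma norm_fderiv_le (g : Plane → ℝ) (x : Plane) :
    ‖fderiv ℝ g x‖ ≤ |partialDeriv 0 g x| + |partialDeriv 1 g x| := by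
  refine ContinuousLinearMap.opNorm_le_bound _ (by positivity) fun v => ?_
  rw [fderiv_apply_eq, Real.norm_eq_abs]
  refine (abs_add_le _ _).trans ?_
  rw [abs_mul, abs_mul]
  have h0 := abs_apply_le_norm v 0
  have h1 := abs_apply_le_norm v 1
  nlinarith [abs_nonneg (partialDeriv 0 g x), abs_nonneg (partialDeriv 1 g x)]

lemma abs_sub_le_of_partialDeriv_le {g : Plane → ℝ} (hg : Differentiable ℝ g) {s : Set Plane}
    (hs : Convex ℝ s) {C : ℝ} (hC : ∀ i, ∀ x ∈ s, |partialDeriv i g x| ≤ C) {x y : Plane}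
    (hx : x ∈ s) (hy : y ∈ s) : |g x - g y| ≤ 2 * C * ‖x - y‖ := by
  refine hs.norm_image_sub_le_of_norm_fderiv_le (fun z _ => hg z) (fun z hz => ?_) hy hx
  refine (norm_fderiv_le g z).trans ?_
  linarith [hC 0 z hz, hC 1 z hz]

lemma TameDeriv.exists_bdd {N : ℕ} {g : Plane → ℝ} (h : TameDeriv N g) :
    ∃ C : ℝ, 0 < C ∧ ∀ l : List (Fin 2), 1 ≤ l.length → l.length ≤ N → ∀ x, |pd l g x| ≤ C := by
  have key : ∀ M ≤ N, ∃ C : ℝ, 0 < C ∧ ∀ l : List (Fin 2), 1 ≤ l.length → l.length ≤ M →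
      ∀ x, |pd l g x| ≤ C := by
    intro M hM
    have hfin : {l : List (Fin 2) | l.length ≤ M}.Finite := List.finite_length_le _ _
    choose! C hC using fun l (hl : 1 ≤ l.length ∧ l.length ≤ N) => h.bdd l hl.1 hl.2
    obtain ⟨B, hB⟩ := (hfin.image C).bddAbove
    refine ⟨max B 1, by positivity, fun l h1 hl x => (hC l ⟨h1, hl.trans hM⟩ x).trans ?_⟩
    exact (hB ⟨l, hl, rfl⟩).trans (le_max_left _ _)
  exact key N le_rfl

lemma TameDeriv.lipschitz {N : ℕ} {g : Plane → ℝ} (h : TameDeriv N g) :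
    ∃ C : ℝ, 0 < C ∧ ∀ l : List (Fin 2), l.length < N → ∀ x y,
      |pd l g x - pd l g y| ≤ C * ‖x - y‖ := by
  obtain ⟨C, hC, hb⟩ := h.exists_bdd
  refine ⟨2 * C, by positivity, fun l hl x y => ?_⟩
  exact abs_sub_le_of_partialDeriv_le (h.diff l hl) convex_univ
    (fun i z _ => hb (i :: l) (by simp) (by simpa using hl) z) trivial trivial

lemma TameDeriv.continuous {N : ℕ} {g : Plane → ℝ} (h : TameDeriv N g) {l : List (Fin 2)}
    (hl : l.length < N) : Continuous (pd l g) := (h.diff l hl).continuous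

/-! ### Dependence of the eigenvector field on the function -/

/-- The distance between the second derivatives of `g` at `x` and those of `g'` at `y`. -/
def dist2 (g : Plane → ℝ) (x : Plane) (g' : Plane → ℝ) (y : Plane) : ℝ :=
  |d20 g x - d20 g' y| + |d11 g x - d11 g' y| + |d02 g x - d02 g' y|

lemma norm_V_sub_le (g : Plane → ℝ) (x : Plane) (g' : Plane → ℝ) (y : Plane) :
    ‖V g x - V g' y‖ ≤ 12 * dist2 g x g' y := norm_eigenG_sub_le _ _ _ _ _ _

lemma norm_V_le (g : Plane → ℝ) (x : Plane) :
    ‖V g x‖ ≤ 12 * (|d20 g x| + |d11 g x| + |d02 g x|) := norm_eigenG_le _ _ _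

lemma lam2_eq (g : Plane → ℝ) (x : Plane) :
    lam2 g x = (d20 g x + d02 g x - gap (d20 g x) (d11 g x) (d02 g x)) / 2 := by
  rw [lam2, gap]; congr 4; ring

lemma lam1_eq (g : Plane → ℝ) (x : Plane) :
    lam1 g x = (d20 g x + d02 g x + gap (d20 g x) (d11 g x) (d02 g x)) / 2 := by
  rw [lam1, gap]; congr 4; ring

lemma gap_pos_of_ne {g : Plane → ℝ} {x : Plane} (h : lam2 g x ≠ lam1 g x) :
    0 < gap (d20 g x) (d11 g x) (d02 g x) := by
  rcases (gap_nonneg (d20 g x) (d11 g x) (d02 g x)).eq_or_lt with h0 | h0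
  · rw [lam2_eq, lam1_eq, ← h0] at h
    simp at h
  · exact h0

lemma abs_lam2_sub_le (g : Plane → ℝ) (x : Plane) (g' : Plane → ℝ) (y : Plane) :
    |lam2 g x - lam2 g' y| ≤ dist2 g x g' y := by
  rw [lam2_eq, lam2_eq, dist2]
  have h := abs_le.1 (abs_gap_sub_le (d20 g x) (d11 g x) (d02 g x) (d20 g' y) (d11 g' y) (d02 g' y))
  have hu := le_abs_self (d20 g x - d20 g' y); have hu' := neg_abs_le (d20 g x - d20 g' y)
  have hw := le_abs_self (d02 g x - d02 g' y); have hw' := neg_abs_le (d02 g x - d02 g' y)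
  rw [abs_le]
  constructor <;> linarith [h.1, h.2]

lemma gradient_apply (g : Plane → ℝ) (x : Plane) (i : Fin 2) :
    gradient g x i = partialDeriv i g x := by
  rw [partialDeriv, ← inner_gradient_left, EuclideanSpace.inner_single_right]
  simp

lemma slope_eq (g : Plane → ℝ) (x : Plane) :
    slope g x = partialDeriv 0 g x * V g x 0 + partialDeriv 1 g x * V g x 1 := by
  rw [slope, inner_eq, gradient_apply, gradient_apply]

/-- The distance between the gradients of `g` at `x` and of `g'` at `y`. -/
def dist1 (g : Plane → ℝ) (x : Plane) (g' : Plane → ℝ) (y : Plane) : ℝ :=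
  |partialDeriv 0 g x - partialDeriv 0 g' y| + |partialDeriv 1 g x - partialDeriv 1 g' y|

lemma norm_gradient_sub_le (g : Plane → ℝ) (x : Plane) (g' : Plane → ℝ) (y : Plane) :
    ‖gradient g x - gradient g' y‖ ≤ dist1 g x g' y := by
  refine (norm_le_abs_add_abs _).trans ?_
  simp [gradient_apply, dist1]

lemma norm_gradient_le (g : Plane → ℝ) (x : Plane) :
    ‖gradient g x‖ ≤ |partialDeriv 0 g x| + |partialDeriv 1 g x| := by
  refine (norm_le_abs_add_abs _).trans ?_
  simp [gradient_apply]

lemma abs_slope_sub_le (g : Plane → ℝ) (x : Plane) (g' : Plane → ℝ) (y : Plane) :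
    |slope g x - slope g' y| ≤ dist1 g x g' y * ‖V g x‖ + ‖gradient g' y‖ * (12 * dist2 g x g' y) := by
  have e : slope g x - slope g' y = inner ℝ (gradient g x - gradient g' y) (V g x) +
      inner ℝ (gradient g' y) (V g x - V g' y) := by
    simp only [slope, inner_sub_left, inner_sub_right]; ring
  rw [e]
  refine (abs_add_le _ _).trans (add_le_add ?_ ?_)
  · exact (abs_real_inner_le_norm _ _).trans
      (mul_le_mul_of_nonneg_right (norm_gradient_sub_le _ _ _ _) (norm_nonneg _))
  · exact (abs_real_inner_le_norm _ _).trans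
      (mul_le_mul_of_nonneg_left (norm_V_sub_le _ _ _ _) (norm_nonneg _))

/-! ### The eigenvector field of a function with bounded derivatives -/

lemma TameDeriv.dist2_le {g : Plane → ℝ} (h : TameDeriv 3 g) :
    ∃ C : ℝ, 0 < C ∧ ∀ x y, dist2 g x g y ≤ C * ‖x - y‖ := by
  obtain ⟨C, hC, hL⟩ := h.lipschitz
  refine ⟨3 * C, by positivity, fun x y => ?_⟩
  have h1 := hL [0, 0] (by simp) x y
  have h2 := hL [0, 1] (by simp) x y
  have h3 := hL [1, 1] (by simp) x y
  rw [dist2, d20_eq, d11_eq, d02_eq]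
  linarith

lemma TameDeriv.V_lipschitz {g : Plane → ℝ} (h : TameDeriv 3 g) :
    ∃ C : ℝ, 0 < C ∧ ∀ x y, ‖V g x - V g y‖ ≤ C * ‖x - y‖ := by
  obtain ⟨C, hC, hL⟩ := h.dist2_le
  exact ⟨12 * C, by positivity, fun x y => (norm_V_sub_le _ _ _ _).trans (by linarith [hL x y])⟩

lemma TameDeriv.V_bounded {g : Plane → ℝ} (h : TameDeriv 3 g) :
    ∃ C : ℝ, 0 < C ∧ ∀ x, ‖V g x‖ ≤ C := by
  obtain ⟨C, hC, hb⟩ := h.exists_bdd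
  refine ⟨36 * C, by positivity, fun x => (norm_V_le g x).trans ?_⟩
  have h1 := hb [0, 0] (by simp) (by simp) x
  have h2 := hb [0, 1] (by simp) (by simp) x
  have h3 := hb [1, 1] (by simp) (by simp) x
  rw [d20_eq, d11_eq, d02_eq]
  linarith

lemma TameDeriv.gradient_bounded {g : Plane → ℝ} (h : TameDeriv 3 g) :
    ∃ C : ℝ, 0 < C ∧ ∀ x, ‖gradient g x‖ ≤ C := by
  obtain ⟨C, hC, hb⟩ := h.exists_bdd
  refine ⟨2 * C, by positivity, fun x => (norm_gradient_le g x).trans ?_⟩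
  have h1 := hb [0] (by simp) (by simp) x
  have h2 := hb [1] (by simp) (by simp) x
  rw [pd_cons, pd_nil] at h1 h2
  linarith

lemma TameDeriv.V_continuous {g : Plane → ℝ} (h : TameDeriv 3 g) : Continuous (V g) := by
  obtain ⟨C, hC, hL⟩ := h.V_lipschitz
  exact (LipschitzWith.of_dist_le_mul (K := ⟨C, hC.le⟩) fun x y => by
    rw [dist_eq_norm, dist_eq_norm]; exact hL x y).continuous

/-- The eigenvector field is bounded and Lipschitz, so the constant fallback in the definition of
`integralCurve` never occurs for tame functions. -/
lemma TameDeriv.curve_spec {g : Plane → ℝ} (h : TameDeriv 3 g) (x₀ : Plane) :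
    IsGlobalSolution (V g) x₀ (curve g x₀) := by
  obtain ⟨K, hK, hL⟩ := h.V_lipschitz
  obtain ⟨C, hC, hb⟩ := h.V_bounded
  exact integralCurve_spec hK.le hC.le hL hb x₀

lemma TameDeriv.curve_add {g : Plane → ℝ} (h : TameDeriv 3 g) (x₀ : Plane) (s t : ℝ) :
    curve g (curve g x₀ s) t = curve g x₀ (s + t) := by
  obtain ⟨K, hK, hL⟩ := h.V_lipschitz
  exact congrFun ((h.curve_spec _).unique hK.le hL ((h.curve_spec x₀).shift s)) t

lemma TameDeriv.curve_zero {g : Plane → ℝ} (h : TameDeriv 3 g) (x₀ : Plane) :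
    curve g x₀ 0 = x₀ := (h.curve_spec x₀).1

lemma TameDeriv.curve_continuous {g : Plane → ℝ} (h : TameDeriv 3 g) (x₀ : Plane) :
    Continuous (curve g x₀) := (h.curve_spec x₀).continuous

lemma norm_curve_sub_le_of_V_bounded {g : Plane → ℝ} (h : TameDeriv 3 g) {C : ℝ}
    (hb : ∀ x, ‖V g x‖ ≤ C) (x₀ : Plane) (s t : ℝ) :
    ‖curve g x₀ s - curve g x₀ t‖ ≤ C * |s - t| := by
  have := convex_univ.norm_image_sub_le_of_norm_hasDerivWithin_le
    (f := curve g x₀) (f' := fun t => V g (curve g x₀ t)) (s := Set.univ) (C := C)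
    (fun t _ => ((h.curve_spec x₀).2 t).hasDerivWithinAt) (fun t _ => hb _)
    (Set.mem_univ t) (Set.mem_univ s)
  simpa using this

/-- Dependence of the trajectories on the starting point. -/
lemma TameDeriv.norm_curve_sub_curve_le {g : Plane → ℝ} (h : TameDeriv 3 g) :
    ∃ K : ℝ, 0 < K ∧ ∀ x y t, ‖curve g x t - curve g y t‖ ≤ ‖x - y‖ * Real.exp (K * |t|) := by
  obtain ⟨K, hK, hL⟩ := h.V_lipschitz
  refine ⟨K, hK, fun x y t => ?_⟩
  have := (h.curve_spec y).norm_sub_le_of_integral' (h.curve_spec x) (s := Set.univ) (T := t)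
    (κ := 0) (δ := ‖x - y‖)
    hK h.V_continuous h.V_continuous (fun x _ y _ => hL x y) (fun _ _ => trivial)
    (fun _ _ => trivial) le_rfl (fun t _ => by simp)
  simpa using this

/-- The flow is jointly continuous. -/
lemma TameDeriv.continuous_flow {g : Plane → ℝ} (h : TameDeriv 3 g) :
    Continuous fun p : Plane × ℝ => curve g p.1 p.2 := by
  obtain ⟨K, hK, hL⟩ := h.norm_curve_sub_curve_le
  obtain ⟨C, hC, hb⟩ := h.V_bounded
  rw [continuous_iff_continuousAt]
  rintro ⟨x, t⟩
  rw [ContinuousAt, tendsto_iff_norm_sub_tendsto_zero]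
  refine squeeze_zero (g := fun p : Plane × ℝ => ‖p.1 - x‖ * Real.exp (K * |p.2|) + C * |p.2 - t|)
    (fun _ => norm_nonneg _) (fun p => ?_) ?_
  · have h1 := hL p.1 x p.2
    have h2 := norm_curve_sub_le_of_V_bounded h hb x p.2 t
    have h3 := norm_add_le (curve g p.1 p.2 - curve g x p.2) (curve g x p.2 - curve g x t)
    simp only [sub_add_sub_cancel] at h3
    linarith
  · have : Continuous fun p : Plane × ℝ =>
        ‖p.1 - x‖ * Real.exp (K * |p.2|) + C * |p.2 - t| := by fun_prop
    simpa using this.tendsto (x, t)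

/-! ### The filament of the density -/

lemma contDiff_partialDeriv {g : Plane → ℝ} {m n : WithTop ℕ∞} (hg : ContDiff ℝ n g)
    (hmn : m + 1 ≤ n) (i : Fin 2) : ContDiff ℝ m (partialDeriv i g) :=
  (hg.fderiv_right hmn).clm_apply contDiff_const

/-- The square root in the gap is the only obstruction to smoothness, and it is smooth away from
zero. -/
lemma contDiffAt_slope {g : Plane → ℝ} (hg : ContDiff ℝ 4 g) {x : Plane}
    (hx : 0 < gap (d20 g x) (d11 g x) (d02 g x)) : ContDiffAt ℝ 1 (slope g) x := by
  have h1 : ∀ i, ContDiff ℝ 3 (partialDeriv i g) := fun i =>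
    contDiff_partialDeriv hg (by norm_num) i
  have h2 : ∀ i j, ContDiff ℝ 2 (partialDeriv i (partialDeriv j g)) := fun i j =>
    contDiff_partialDeriv (h1 j) (by norm_num) i
  have a0 : ContDiffAt ℝ 1 (partialDeriv 0 g) x := ((h1 0).of_le (by norm_num)).contDiffAt
  have a1 : ContDiffAt ℝ 1 (partialDeriv 1 g) x := ((h1 1).of_le (by norm_num)).contDiffAt
  have u : ContDiffAt ℝ 1 (d20 g) x := ((h2 0 0).of_le (by norm_num)).contDiffAt
  have v : ContDiffAt ℝ 1 (d11 g) x := ((h2 0 1).of_le (by norm_num)).contDiffAt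
  have w : ContDiffAt ℝ 1 (d02 g) x := ((h2 1 1).of_le (by norm_num)).contDiffAt
  have hne : (d02 g x - d20 g x) ^ 2 + 4 * d11 g x ^ 2 ≠ 0 := fun h0 => by
    rw [gap, h0, Real.sqrt_zero] at hx; exact lt_irrefl _ hx
  have D : ContDiffAt ℝ 1 (fun x => gap (d20 g x) (d11 g x) (d02 g x)) x := by
    unfold gap
    exact (((w.sub u).pow 2).add (contDiffAt_const.mul (v.pow 2))).sqrt hne
  have hs : slope g = fun x => partialDeriv 0 g x *
      (2 * d20 g x - 2 * d02 g x + 2 * d11 g x - 2 * gap (d20 g x) (d11 g x) (d02 g x)) +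
      partialDeriv 1 g x *
      (d02 g x - d20 g x + 4 * d11 g x - gap (d20 g x) (d11 g x) (d02 g x)) := by
    ext x
    rw [slope_eq, V, eigenG_apply_zero, eigenG_apply_one]
  rw [hs]
  fun_prop

lemma DensityAssumptions.tame {f : Plane → ℝ} (hf : DensityAssumptions f) : TameDeriv 4 f :=
  tameDeriv_of_iteratedFDeriv
    (fun k hk => hf.smooth.differentiable_iteratedFDeriv (by exact_mod_cast hk)) hf.bounded

lemma DensityAssumptions.tame3 {f : Plane → ℝ} (hf : DensityAssumptions f) : TameDeriv 3 f :=
  hf.tame.mono (by norm_num)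

lemma TameDeriv.continuous_lam2 {g : Plane → ℝ} (h : TameDeriv 3 g) : Continuous (lam2 g) := by
  obtain ⟨C, hC, hL⟩ := h.dist2_le
  exact (LipschitzWith.of_dist_le_mul (K := ⟨C, hC.le⟩) fun x y => by
    rw [Real.dist_eq, dist_eq_norm]
    exact (abs_lam2_sub_le _ _ _ _).trans (hL x y)).continuous

lemma TameDeriv.continuous_slope {g : Plane → ℝ} (h : TameDeriv 3 g) : Continuous (slope g) := by
  have hV := h.V_continuous
  have h0 : Continuous (partialDeriv 0 g) := h.continuous (l := [0]) (by simp)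
  have h1 : Continuous (partialDeriv 1 g) := h.continuous (l := [1]) (by simp)
  have hs : slope g = fun x => partialDeriv 0 g x * V g x 0 + partialDeriv 1 g x * V g x 1 := by
    ext x; rw [slope_eq]
  rw [hs]
  exact (h0.mul ((EuclideanSpace.proj (𝕜 := ℝ) 0).continuous.comp hV)).add
    (h1.mul ((EuclideanSpace.proj (𝕜 := ℝ) 1).continuous.comp hV))

section

variable {f : Plane → ℝ} {H L : Set Plane} {a : ℝ}

lemma FilamentAssumptions.hitTime_mem (hL : FilamentAssumptions f H L a) {x : Plane}
    (hx : x ∈ startSet f L a) : hitTime f x ∈ argminAbs (ridgeTimes f x) := by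
  obtain ⟨t, ht, -⟩ := hL.hit_unique x hx
  have h : (argminAbs (ridgeTimes f x)).Nonempty := ⟨t, ht⟩
  rw [hitTime, dif_pos h]
  exact h.some_mem

lemma FilamentAssumptions.eq_hitTime (hL : FilamentAssumptions f H L a) {x : Plane}
    (hx : x ∈ startSet f L a) {t : ℝ} (ht : t ∈ ridgeTimes f x) (h : |t| ≤ |hitTime f x|) :
    t = hitTime f x := by
  have h0 := hL.hitTime_mem hx
  exact (hL.hit_unique x hx).unique ⟨ht, fun s hs => h.trans (h0.2 s hs)⟩ h0

lemma FilamentAssumptions.filamentPoint_mem (hL : FilamentAssumptions f H L a) {x : Plane}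
    (hx : x ∈ startSet f L a) : filamentPoint f x ∈ L := by
  have h := hL.filament_eq
  rw [h]; exact ⟨x, hx, rfl⟩

lemma FilamentAssumptions.ridge (hL : FilamentAssumptions f H L a) {y : Plane} (hy : y ∈ L) :
    slope f y = 0 ∧ lam2 f y < 0 := by
  have h := hL.filament_eq
  rw [h] at hy
  obtain ⟨x, hx, rfl⟩ := hy
  exact (hL.hitTime_mem hx).1

lemma FilamentAssumptions.subset_startSet (hf : DensityAssumptions f)
    (hL : FilamentAssumptions f H L a) : L ⊆ startSet f L a := fun y hy =>
  ⟨y, hy, 0, by simp [hL.a_pos.le], (hf.tame3.curve_zero y).symm⟩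

lemma curve_mem_startSet {y : Plane} (hy : y ∈ L) {t : ℝ} (ht : |t| ≤ a) :
    curve f y t ∈ startSet f L a := ⟨y, hy, t, abs_le.1 ht, rfl⟩

/-- A starting point is reached from some y in L in time t, so running for time -t leads back to y,
which satisfies the ridge conditions. -/
lemma FilamentAssumptions.abs_hitTime_le (hf : DensityAssumptions f)
    (hL : FilamentAssumptions f H L a) {x : Plane} (hx : x ∈ startSet f L a) :
    |hitTime f x| ≤ a := by
  obtain ⟨y, hy, t, ht, rfl⟩ := hx
  have hm : -t ∈ ridgeTimes f (curve f y t) := by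
    have := hL.ridge hy
    rw [ridgeTimes, Set.mem_ofPred_eq, hf.tame3.curve_add, add_neg_cancel, hf.tame3.curve_zero]
    exact this
  refine ((hL.hitTime_mem ⟨y, hy, t, ht, rfl⟩).2 _ hm).trans ?_
  rw [abs_neg]; exact abs_le.2 ht

/-- Expressing trajectories through their filament points means that transversality and line
integrals need uniform control only for base points in L. -/
lemma FilamentAssumptions.curve_eq_curve_filamentPoint (hf : DensityAssumptions f) (x : Plane)
    (s : ℝ) : curve f x s = curve f (filamentPoint f x) (s - hitTime f x) := by
  rw [filamentPoint, hf.tame3.curve_add]; congr 1; ring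

lemma FilamentAssumptions.isCompact_startSet (hf : DensityAssumptions f)
    (hL : FilamentAssumptions f H L a) : IsCompact (startSet f L a) := by
  have : startSet f L a =
      (fun p : Plane × ℝ => curve f p.1 p.2) '' (L ×ˢ Set.Icc (-a) a) := by
    ext x
    constructor
    · rintro ⟨y, hy, t, ht, rfl⟩
      exact ⟨(y, t), ⟨hy, ht⟩, rfl⟩
    · rintro ⟨⟨y, t⟩, ⟨hy, ht⟩, rfl⟩
      exact ⟨y, hy, t, ht, rfl⟩
  rw [this]
  exact (hL.compact_filament.prod isCompact_Icc).image hf.tame3.continuous_flow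

lemma FilamentAssumptions.gap_pos (hL : FilamentAssumptions f H L a) {x : Plane} (hx : x ∈ H) :
    0 < gap (d20 f x) (d11 f x) (d02 f x) := gap_pos_of_ne (hL.distinct x hx)

/-- The slope changes sign transversally along the trajectories that cross the filament. -/
lemma FilamentAssumptions.exists_transversal (hf : DensityAssumptions f)
    (hL : FilamentAssumptions f H L a) :
    ∃ c > 0, ∃ η > 0, ∀ y ∈ L, ∃ σ : ℝ, |σ| = 1 ∧ ∀ τ : ℝ, |τ| ≤ η →
      c * τ ^ 2 ≤ σ * slope f (curve f y τ) * τ ∧ lam2 f (curve f y τ) ≤ -c := by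
  suffices h : ∃ c > 0, ∃ η > 0, ∀ y ∈ L ∩ L, ∃ σ : ℝ, |σ| = 1 ∧ ∀ τ : ℝ, |τ| ≤ η →
      c * τ ^ 2 ≤ σ * slope f (curve f y τ) * τ ∧ lam2 f (curve f y τ) ≤ -c by
    simpa using h
  -- Compactness reduces the uniform constants to a local statement, since finite unions only take
  -- minima. The sign σ may vary from point to point.
  refine hL.compact_filament.induction_on (p := fun S => ∃ c > 0, ∃ η > 0, ∀ y ∈ S ∩ L, ∃ σ : ℝ,
    |σ| = 1 ∧ ∀ τ : ℝ, |τ| ≤ η →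
      c * τ ^ 2 ≤ σ * slope f (curve f y τ) * τ ∧ lam2 f (curve f y τ) ≤ -c) ?_ ?_ ?_ ?_
  · exact ⟨1, one_pos, 1, one_pos, by simp⟩
  · rintro S T hST ⟨c, hc, η, hη, h⟩
    exact ⟨c, hc, η, hη, fun y hy => h y ⟨hST hy.1, hy.2⟩⟩
  · rintro S T ⟨c, hc, η, hη, h⟩ ⟨c', hc', η', hη', h'⟩
    refine ⟨min c c', lt_min hc hc', min η η', lt_min hη hη', fun y hy => ?_⟩
    rcases hy.1 with hS | hT
    · obtain ⟨σ, hσ, hh⟩ := h y ⟨hS, hy.2⟩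
      refine ⟨σ, hσ, fun τ hτ => ?_⟩
      obtain ⟨h1, h2⟩ := hh τ (hτ.trans (min_le_left _ _))
      have := min_le_left c c'
      exact ⟨(mul_le_mul_of_nonneg_right this (sq_nonneg τ)).trans h1, by linarith⟩
    · obtain ⟨σ, hσ, hh⟩ := h' y ⟨hT, hy.2⟩
      refine ⟨σ, hσ, fun τ hτ => ?_⟩
      obtain ⟨h1, h2⟩ := hh τ (hτ.trans (min_le_right _ _))
      have := min_le_right c c'
      exact ⟨(mul_le_mul_of_nonneg_right this (sq_nonneg τ)).trans h1, by linarith⟩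
  · intro y₀ hy₀
    obtain ⟨C, hC, hVb⟩ := hf.tame3.V_bounded
    have hgap := hL.gap_pos (hL.filament_subset hy₀)
    have hC1 := contDiffAt_slope hf.smooth hgap
    set φ : Plane → ℝ := fun x => fderiv ℝ (slope f) x (V f x) with hφ
    have hφ0 : φ y₀ ≠ 0 := by
      have := hL.transversal y₀ hy₀
      rwa [inner_gradient_left] at this
    have hφc : ContinuousAt φ y₀ :=
      (hC1.continuousAt_fderiv (by norm_num)).clm_apply hf.tame3.V_continuous.continuousAt
    -- σ is the sign of the derivative of the slope along V f at y₀.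
    obtain ⟨σ, hσ, hσφ⟩ : ∃ σ : ℝ, |σ| = 1 ∧ 0 < σ * φ y₀ := by
      rcases lt_or_gt_of_ne hφ0 with h | h
      · exact ⟨-1, by norm_num, by linarith⟩
      · exact ⟨1, by norm_num, by linarith⟩
    have hlam := (hL.ridge hy₀).2
    set c := min (σ * φ y₀ / 2) (-lam2 f y₀ / 2) with hc
    have hcpos : 0 < c := lt_min (by linarith) (by linarith)
    have e1 : ∀ᶠ x in 𝓝 y₀, c < σ * φ x :=
      (continuousAt_const.mul hφc).eventually (lt_mem_nhds
        (lt_of_le_of_lt (min_le_left _ _) (half_lt_self hσφ)))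
    have e2 : ∀ᶠ x in 𝓝 y₀, lam2 f x < -c :=
      hf.tame3.continuous_lam2.continuousAt.eventually (gt_mem_nhds (by
        have := min_le_right (σ * φ y₀ / 2) (-lam2 f y₀ / 2)
        linarith))
    have e3 : ∀ᶠ x in 𝓝 y₀, DifferentiableAt ℝ (slope f) x := by
      filter_upwards [hC1.eventually (by simp)] with x hx
      exact hx.differentiableAt (by norm_num)
    obtain ⟨ρ, hρ, hball⟩ := Metric.eventually_nhds_iff_ball.1 (e1.and (e2.and e3))
    -- At speed at most C, a time ρ / (4 C) covers a distance of at most ρ / 4, so curves that start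
    -- within ρ / 2 of y₀ stay within ρ.
    refine ⟨Metric.ball y₀ (ρ / 2), mem_nhdsWithin_of_mem_nhds (Metric.ball_mem_nhds _ (by linarith)),
      c, hcpos, ρ / (4 * C), by positivity, fun y hy => ⟨σ, hσ, fun τ hτ => ?_⟩⟩
    have hin : ∀ s, |s| ≤ ρ / (4 * C) → curve f y s ∈ Metric.ball y₀ ρ := by
      intro s hs
      have h1 := norm_curve_sub_le_of_V_bounded hf.tame3 hVb y s 0
      rw [hf.tame3.curve_zero, sub_zero] at h1
      have h2 : C * |s| ≤ ρ / 4 := by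
        calc C * |s| ≤ C * (ρ / (4 * C)) := by gcongr
          _ = ρ / 4 := by field_simp
      have h3 := hy.1
      rw [Metric.mem_ball] at h3 ⊢
      have := dist_triangle (curve f y s) y y₀
      rw [dist_eq_norm (curve f y s) y] at this
      linarith
    refine ⟨?_, (hball _ (hin τ hτ)).2.1.le⟩
    set I := Set.Icc (-(ρ / (4 * C))) (ρ / (4 * C)) with hI
    have hder : ∀ s ∈ I, HasDerivAt (fun s => σ * slope f (curve f y s) - c * s)
        (σ * φ (curve f y s) - c) s := by
      intro s hs
      have hd := (hball _ (hin s (abs_le.2 hs))).2.2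
      have h1 := hd.hasFDerivAt.comp_hasDerivAt s ((hf.tame3.curve_spec y).2 s)
      have h2 := (h1.const_mul σ).sub ((hasDerivAt_id s).const_mul c)
      rw [mul_one] at h2
      exact h2
    -- This function vanishes at time 0, so its monotonicity gives the crossing inequality for both
    -- signs of τ.
    have hmono : MonotoneOn (fun s => σ * slope f (curve f y s) - c * s) I := by
      refine monotoneOn_of_deriv_nonneg (convex_Icc _ _)
        (fun s hs => (hder s hs).continuousAt.continuousWithinAt)
        (fun s hs => (hder s (interior_subset hs)).differentiableAt.differentiableWithinAt)
        fun s hs => ?_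
      have hs' := interior_subset hs
      rw [(hder s hs').deriv]
      linarith [(hball _ (hin s (abs_le.2 hs'))).1]
    have h0I : (0 : ℝ) ∈ I := by
      have : 0 ≤ ρ / (4 * C) := by positivity
      exact ⟨by linarith, this⟩
    have hz : σ * slope f (curve f y 0) - c * 0 = 0 := by
      rw [hf.tame3.curve_zero, (hL.ridge hy.2).1]; ring
    rcases le_total 0 τ with h | h
    · have := hmono h0I (abs_le.1 hτ) h
      simp only [hz] at this
      nlinarith
    · have := hmono (abs_le.1 hτ) h0I h
      simp only [hz] at this
      nlinarith

/-- A continuous function with a sign change has a zero. -/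
lemma exists_zero_of_sign_change {p : ℝ → ℝ} {σ s t : ℝ} (hσ : |σ| = 1) (hst : s ≤ t)
    (hp : ContinuousOn p (Set.Icc s t)) (hs : σ * p s ≤ 0) (ht : 0 ≤ σ * p t) :
    ∃ r ∈ Set.Icc s t, p r = 0 := by
  obtain ⟨r, hr, h0⟩ := intermediate_value_Icc (f := fun r => σ * p r) hst
    (continuousOn_const.mul hp) ⟨hs, ht⟩
  have hσ0 : σ ≠ 0 := by rintro rfl; simp at hσ
  exact ⟨r, hr, by simpa [hσ0] using h0⟩

/-- Limits of hitting times are hitting times. -/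
lemma FilamentAssumptions.eq_hitTime_of_tendsto (hf : DensityAssumptions f)
    (hL : FilamentAssumptions f H L a) {u : ℕ → Plane} (hu : ∀ k, u k ∈ startSet f L a)
    {x : Plane} (hx : x ∈ startSet f L a) (hux : Tendsto u atTop (𝓝 x)) {τ : ℝ}
    (hτ : Tendsto (fun k => hitTime f (u k)) atTop (𝓝 τ)) : τ = hitTime f x := by
  have hflow := hf.tame3.continuous_flow
  have hlim : ∀ {v : ℕ → ℝ} {s : ℝ}, Tendsto v atTop (𝓝 s) →
      Tendsto (fun k => curve f (u k) (v k)) atTop (𝓝 (curve f x s)) := fun {v s} hv =>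
    (hflow.tendsto (x, s)).comp (hux.prodMk_nhds hv)
  -- Closedness of L is what carries the strict inequality for the lower eigenvalue over to the
  -- limit.
  have hmem : curve f x τ ∈ L := hL.compact_filament.isClosed.mem_of_tendsto (hlim hτ)
    (Eventually.of_forall fun k => hL.filamentPoint_mem (hu k))
  have hτr : τ ∈ ridgeTimes f x := hL.ridge hmem
  refine hL.eq_hitTime hx hτr ?_
  obtain ⟨c, hc, η, hη, htr⟩ := hL.exists_transversal hf
  obtain ⟨σ, hσ, hσt⟩ := htr _ (hL.filamentPoint_mem hx)
  obtain ⟨C, hC, hd2⟩ := hf.tame3.dist2_le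
  obtain ⟨K, hK, hcurve⟩ := hf.tame3.norm_curve_sub_curve_le
  set θ := hitTime f x with hθ
  -- It remains to exclude that τ is later, in absolute value, than θ. The slope changes sign across
  -- θ along the limit curve, hence also along the curves from u k for large k. The intermediate
  -- zero has negative lower eigenvalue, so it is a ridge time within ζ of θ and bounds the hitting
  -- time of u k.
  refine le_of_forall_pos_le_add fun ζ₀ hζ₀ => ?_
  set ζ := min ζ₀ η with hζ
  have hζp : 0 < ζ := lt_min hζ₀ hη
  have hcv : ∀ s, curve f x (θ + s) = curve f (filamentPoint f x) s := fun s => by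
    rw [FilamentAssumptions.curve_eq_curve_filamentPoint hf x]; congr 1; ring
  have hpos : 0 < σ * slope f (curve f x (θ + ζ)) := by
    rw [hcv]
    have h := (hσt ζ (by rw [abs_of_pos hζp]; exact min_le_right _ _)).1
    have : 0 < c * ζ ^ 2 := by positivity
    by_contra hn
    nlinarith
  have hneg : σ * slope f (curve f x (θ - ζ)) < 0 := by
    rw [sub_eq_add_neg, hcv]
    have h := (hσt (-ζ) (by rw [abs_neg, abs_of_pos hζp]; exact min_le_right _ _)).1
    have : 0 < c * (-ζ) ^ 2 := by rw [neg_sq]; positivity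
    by_contra hn
    nlinarith
  have hsl : ∀ s, Tendsto (fun k => σ * slope f (curve f (u k) s)) atTop
      (𝓝 (σ * slope f (curve f x s))) := fun s =>
    ((hf.tame3.continuous_slope.tendsto _).comp (hlim tendsto_const_nhds)).const_mul σ
  have hsmall : Tendsto (fun k => C * (‖u k - x‖ * Real.exp (K * (|θ| + ζ)))) atTop (𝓝 0) := by
    have := ((tendsto_iff_norm_sub_tendsto_zero.1 hux).mul_const
      (Real.exp (K * (|θ| + ζ)))).const_mul C
    simpa using this
  have hev : ∀ᶠ k in atTop, |hitTime f (u k)| ≤ |θ| + ζ := by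
    filter_upwards [(hsl (θ + ζ)).eventually (lt_mem_nhds hpos),
      (hsl (θ - ζ)).eventually (gt_mem_nhds hneg), hsmall.eventually (gt_mem_nhds hc)]
      with k h1 h2 h3
    obtain ⟨t, ht, h0⟩ := exists_zero_of_sign_change hσ (by linarith)
      (hf.tame3.continuous_slope.comp (hf.tame3.curve_continuous (u k))).continuousOn h2.le h1.le
    have htθ : |t - θ| ≤ ζ := abs_le.2 ⟨by linarith [ht.1], by linarith [ht.2]⟩
    have hta : |t| ≤ |θ| + ζ := by
      have := abs_add_le (t - θ) θ
      rw [sub_add_cancel] at this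
      linarith
    have hl := (hσt (t - θ) (htθ.trans (min_le_right _ _))).2
    rw [← hcv, add_sub_cancel] at hl
    have hl2 := abs_le.1 (abs_lam2_sub_le f (curve f (u k) t) f (curve f x t))
    have hl3 := hd2 (curve f (u k) t) (curve f x t)
    have hl4 : C * ‖curve f (u k) t - curve f x t‖ ≤
        C * (‖u k - x‖ * Real.exp (K * (|θ| + ζ))) := by
      gcongr
      refine (hcurve _ _ _).trans ?_
      gcongr
    have htr : t ∈ ridgeTimes f (u k) := ⟨h0, by linarith [hl2.2]⟩
    exact ((hL.hitTime_mem (hu k)).2 t htr).trans hta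
  exact (le_of_tendsto hτ.abs hev).trans (by gcongr; exact min_le_left _ _)

/-- On the arcs up to the hitting time, and slightly beyond, no point away from the filament
point is close to satisfying the ridge conditions. -/
lemma FilamentAssumptions.exists_separation (hf : DensityAssumptions f)
    (hL : FilamentAssumptions f H L a) {η : ℝ} (hη : 0 < η) :
    ∃ δ > 0, ∀ x ∈ startSet f L a, ∀ t : ℝ, |t| ≤ |hitTime f x| + δ →
      η ≤ |t - hitTime f x| → |slope f (curve f x t)| ≤ δ → δ < lam2 f (curve f x t) := by
  -- Counterexamples for δ = 1/(k + 1) accumulate at a time s ≠ θ with |s| ≤ |θ|, zero slope and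
  -- lower eigenvalue at most 0. Nondegeneracy on the arc makes the eigenvalue negative, which
  -- contradicts the uniqueness of the nearest ridge time.
  by_contra! hcon
  have hpos : ∀ k : ℕ, 0 < 1 / ((k : ℝ) + 1) := fun k => Nat.one_div_pos_of_nat
  choose! u hu t ht hne hsl hlam using fun k : ℕ => hcon _ (hpos k)
  have hle1 : ∀ k : ℕ, 1 / ((k : ℝ) + 1) ≤ 1 := fun k => by
    rw [div_le_one (by positivity)]; linarith [(Nat.cast_nonneg k : (0 : ℝ) ≤ k)]
  have hcomp : IsCompact (startSet f L a ×ˢ (Set.Icc (-(a + 1)) (a + 1) ×ˢ Set.Icc (-a) a)) :=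
    (hL.isCompact_startSet hf).prod (isCompact_Icc.prod isCompact_Icc)
  obtain ⟨⟨x, s, τ⟩, ⟨hx, -, -⟩, φ, hφ, hlim⟩ := hcomp.tendsto_subseq
    (x := fun k => (u k, t k, hitTime f (u k))) (fun k => by
      have h1 := hL.abs_hitTime_le hf (hu k)
      refine ⟨hu k, abs_le.1 ?_, abs_le.1 h1⟩
      linarith [ht k, hle1 k])
  rw [nhds_prod_eq, nhds_prod_eq, tendsto_prod_iff'] at hlim
  obtain ⟨hlx, hlim⟩ := hlim
  rw [tendsto_prod_iff'] at hlim
  obtain ⟨hlt, hlτ⟩ := hlim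
  have hτ : τ = hitTime f x := hL.eq_hitTime_of_tendsto hf (fun k => hu (φ k)) hx hlx hlτ
  have hzero : Tendsto (fun k => 1 / ((φ k : ℝ) + 1)) atTop (𝓝 0) :=
    tendsto_one_div_add_atTop_nhds_zero_nat.comp hφ.tendsto_atTop
  have hcl : Tendsto (fun k => curve f (u (φ k)) (t (φ k))) atTop (𝓝 (curve f x s)) :=
    (hf.tame3.continuous_flow.tendsto (x, s)).comp (hlx.prodMk_nhds hlt)
  have h1 : |s| ≤ |hitTime f x| := by
    have := le_of_tendsto_of_tendsto' hlt.abs (hlτ.abs.add hzero) (fun k => ht (φ k))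
    rwa [hτ, add_zero] at this
  have h2 : η ≤ |s - hitTime f x| := by
    rw [← hτ]
    exact ge_of_tendsto' (hlt.sub hlτ).abs (fun k => hne (φ k))
  have h3 : slope f (curve f x s) = 0 := by
    have := le_of_tendsto_of_tendsto' ((hf.tame3.continuous_slope.tendsto _).comp hcl).abs hzero
      (fun k => hsl (φ k))
    exact abs_eq_zero.1 (le_antisymm this (abs_nonneg _))
  have h4 : lam2 f (curve f x s) ≤ 0 :=
    le_of_tendsto_of_tendsto' ((hf.tame3.continuous_lam2.tendsto _).comp hcl) hzero
      (fun k => hlam (φ k))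
  have h5 := hL.nondegenerate_arc x hx s h1
  have h6 : lam2 f (curve f x s) < 0 := lt_of_le_of_ne h4 fun h => h5 ⟨h, h3⟩
  rw [hL.eq_hitTime hx ⟨h3, h6⟩ h1, sub_self, abs_zero] at h2
  exact hη.not_ge h2

end

/-! ### Perturbation of the filament -/

/-- The linearization of `V g - V f`. -/
def linErr (f g : Plane → ℝ) (x : Plane) : Plane :=
  linG (d20 f x) (d11 f x) (d02 f x) (d20 g x - d20 f x) (d11 g x - d11 f x) (d02 g x - d02 f x)

/-- The function `g` is close to `f`: the partial derivatives of order one at rate `r` and those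
of order two at rate `√r`, while those of order three are bounded; the linearized difference of
the eigenvector fields, integrated along the trajectories from `L`, has rate `r`. -/
structure Close (f g : Plane → ℝ) (L : Set Plane) (a R M r : ℝ) : Prop where
  tame : TameDeriv 3 g
  first : ∀ x ∈ Metric.closedBall (0 : Plane) R, dist1 g x f x ≤ M * r
  second : ∀ x ∈ Metric.closedBall (0 : Plane) R, dist2 g x f x ≤ M * √r
  third : ∀ x ∈ Metric.closedBall (0 : Plane) R, ∀ i,
    |pd [i, 0, 0] g x| ≤ M ∧ |pd [i, 0, 1] g x| ≤ M ∧ |pd [i, 1, 1] g x| ≤ M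
  line : ∀ y ∈ L, ∀ s : ℝ, |s| ≤ a → ‖∫ t in (0 : ℝ)..s, linErr f g (curve f y t)‖ ≤ M * r

/-- This is the one-dimensional core: p, l are the slope and lower eigenvalue along the curve of f,
and q, m the same quantities along the curve of g, uniformly within E. Since p grows at rate c
through its zero θ, q has a zero within E / c of θ. Separation forces any zero of q with m < 0 that
is no farther from 0 to lie within η of θ, and then the growth of p forces it within E / c. -/
lemma argmin_near {p q l m : ℝ → ℝ} {a θ c η σ δ E t : ℝ} (hθ : |θ| ≤ a) (hc : 0 < c)
    (hσ : |σ| = 1) (hcross : ∀ τ : ℝ, |τ| ≤ η → c * τ ^ 2 ≤ σ * p (θ + τ) * τ ∧ l (θ + τ) ≤ -c)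
    (hsep : ∀ t : ℝ, |t| ≤ |θ| + δ → η ≤ |t - θ| → |p t| ≤ δ → δ < l t)
    (hE : 0 < E) (hq : ∀ t, |t| ≤ a + 1 → |q t - p t| ≤ E) (hm : ∀ t, |t| ≤ a + 1 → |m t - l t| ≤ E)
    (hqc : Continuous q) (h1 : E / c < η) (h2 : E < c) (h3 : E ≤ δ) (h4 : E / c ≤ δ) (h5 : E / c ≤ 1)
    (ht : IsArgminChoice {t | q t = 0 ∧ m t < 0} t) :
    (q t = 0 ∧ m t < 0) ∧ |t - θ| ≤ E / c := by
  set ζ := E / c with hζ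
  have hζp : 0 < ζ := by positivity
  have hcζ : c * ζ = E := by rw [hζ]; field_simp
  have habs : ∀ s, |s - θ| ≤ ζ → |s| ≤ |θ| + ζ := fun s hs => by
    have := abs_add_le (s - θ) θ
    rw [sub_add_cancel] at this; linarith
  have hmneg : ∀ s, |s - θ| ≤ ζ → m s < 0 := fun s hs => by
    have h := (hcross (s - θ) (hs.trans h1.le)).2
    rw [add_sub_cancel] at h
    have := (abs_le.1 (hm s (by linarith [habs s hs]))).2
    linarith
  have hσq : ∀ s, |s| ≤ a + 1 → |σ * q s - σ * p s| ≤ E := fun s hs => by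
    rw [← mul_sub, abs_mul, hσ, one_mul]; exact hq s hs
  obtain ⟨t₁, ht₁, hqt₁⟩ : ∃ r ∈ Set.Icc (θ - ζ) (θ + ζ), q r = 0 := by
    refine exists_zero_of_sign_change hσ (by linarith) hqc.continuousOn ?_ ?_
    · have e : |θ + -ζ - θ| ≤ ζ := by
        rw [add_sub_cancel_left, abs_neg, abs_of_pos hζp]
      have h := (hcross (-ζ) (by rw [abs_neg, abs_of_pos hζp]; exact h1.le)).1
      have h' := (abs_le.1 (hσq (θ + -ζ) (by linarith [habs _ e]))).2
      have h6 : σ * p (θ + -ζ) ≤ -(c * ζ) := by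
        by_contra hn
        push Not at hn
        nlinarith
      rw [sub_eq_add_neg]
      linarith
    · have e : |θ + ζ - θ| ≤ ζ := by rw [add_sub_cancel_left, abs_of_pos hζp]
      have h := (hcross ζ (by rw [abs_of_pos hζp]; exact h1.le)).1
      have h' := (abs_le.1 (hσq (θ + ζ) (by linarith [habs _ e]))).1
      have h6 : c * ζ ≤ σ * p (θ + ζ) := by
        by_contra hn
        push Not at hn
        nlinarith
      linarith
  have ht₁θ : |t₁ - θ| ≤ ζ := abs_le.2 ⟨by linarith [ht₁.1], by linarith [ht₁.2]⟩
  have hnear : ∀ s, |s| ≤ |t₁| → q s = 0 → m s < 0 → |s - θ| ≤ ζ := by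
    intro s hs hqs hms
    have hs1 : |s| ≤ |θ| + ζ := hs.trans (habs t₁ ht₁θ)
    have hps := hq s (by linarith)
    rw [hqs, zero_sub, abs_neg] at hps
    have hlt : |s - θ| < η := by
      by_contra hn
      push Not at hn
      have h6 := hsep s (by linarith) hn (by linarith)
      have h7 := (abs_le.1 (hm s (by linarith))).1
      linarith
    have h8 := (hcross (s - θ) hlt.le).1
    rw [add_sub_cancel] at h8
    have h9 : σ * p s * (s - θ) ≤ E * |s - θ| := by
      refine (le_abs_self _).trans ?_
      rw [abs_mul, abs_mul, hσ, one_mul]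
      gcongr
    rw [← sq_abs] at h8
    rw [hζ, le_div_iff₀ hc]
    by_contra hn
    push Not at hn
    have h10 : 0 < |s - θ| := by
      by_contra h0
      push Not at h0
      nlinarith [abs_nonneg (s - θ)]
    nlinarith
  -- The zeros of q near θ form a compact set, so |·| attains its minimum there. Competitors closer
  -- to 0 than t₁ belong to that set by `hnear`, so the minimum is global and the arbitrary choice
  -- for unattained minima is ruled out.
  have hne : (argminAbs {t | q t = 0 ∧ m t < 0}).Nonempty := by
    have hcomp : IsCompact (Set.Icc (θ - ζ) (θ + ζ) ∩ {s | q s = 0}) :=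
      isCompact_Icc.inter_right (isClosed_eq hqc continuous_const)
    obtain ⟨t₂, ⟨ht₂, hq₂⟩, hmin⟩ := hcomp.exists_isMinOn ⟨t₁, ht₁, hqt₁⟩
      (continuous_abs.continuousOn (s := Set.Icc (θ - ζ) (θ + ζ) ∩ {s | q s = 0}))
    have ht₂θ : |t₂ - θ| ≤ ζ := abs_le.2 ⟨by linarith [ht₂.1], by linarith [ht₂.2]⟩
    refine ⟨t₂, ⟨hq₂, hmneg _ ht₂θ⟩, fun s hs => ?_⟩
    rcases le_or_gt (|t₁|) (|s|) with h | h
    · exact (hmin ⟨ht₁, hqt₁⟩).trans h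
    · have := abs_le.1 (hnear s h.le hs.1 hs.2)
      exact hmin ⟨⟨by linarith [this.1], by linarith [this.2]⟩, hs.1⟩
  have htm := ht.1 hne
  exact ⟨htm.1, hnear t (htm.2 t₁ ⟨hqt₁, hmneg _ ht₁θ⟩) htm.1.1 htm.1.2⟩

lemma dist1_triangle (f g : Plane → ℝ) (x y : Plane) :
    dist1 g x f y ≤ dist1 g x f x + dist1 f x f y := by
  have h0 := abs_sub_le (partialDeriv 0 g x) (partialDeriv 0 f x) (partialDeriv 0 f y)
  have h1 := abs_sub_le (partialDeriv 1 g x) (partialDeriv 1 f x) (partialDeriv 1 f y)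
  rw [dist1, dist1, dist1]; linarith

lemma dist2_triangle (f g : Plane → ℝ) (x y : Plane) :
    dist2 g x f y ≤ dist2 g x f x + dist2 f x f y := by
  have h0 := abs_sub_le (d20 g x) (d20 f x) (d20 f y)
  have h1 := abs_sub_le (d11 g x) (d11 f x) (d11 f y)
  have h2 := abs_sub_le (d02 g x) (d02 f x) (d02 f y)
  rw [dist2, dist2, dist2]; linarith

lemma dist2_nonneg (f g : Plane → ℝ) (x y : Plane) : 0 ≤ dist2 g x f y := by
  rw [dist2]; positivity

lemma TameDeriv.dist1_le {g : Plane → ℝ} (h : TameDeriv 3 g) :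
    ∃ C : ℝ, 0 < C ∧ ∀ x y, dist1 g x g y ≤ C * ‖x - y‖ := by
  obtain ⟨C, hC, hL⟩ := h.lipschitz
  refine ⟨2 * C, by positivity, fun x y => ?_⟩
  have h1 := hL [0] (by simp) x y
  have h2 := hL [1] (by simp) x y
  rw [pd_cons, pd_nil] at h1 h2
  rw [dist1]
  linarith

section

variable {f g : Plane → ℝ} {H L : Set Plane} {a R M r : ℝ}

lemma Close.dist2_le (h : Close f g L a R M r) {x y : Plane}
    (hx : x ∈ Metric.closedBall (0 : Plane) R) (hy : y ∈ Metric.closedBall (0 : Plane) R) :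
    dist2 g x g y ≤ 6 * M * ‖x - y‖ := by
  have hcv := convex_closedBall (0 : Plane) R
  have h1 := abs_sub_le_of_partialDeriv_le (h.tame.diff [0, 0] (by simp)) hcv
    (fun i z hz => (h.third z hz i).1) hx hy
  have h2 := abs_sub_le_of_partialDeriv_le (h.tame.diff [0, 1] (by simp)) hcv
    (fun i z hz => (h.third z hz i).2.1) hx hy
  have h3 := abs_sub_le_of_partialDeriv_le (h.tame.diff [1, 1] (by simp)) hcv
    (fun i z hz => (h.third z hz i).2.2) hx hy
  rw [dist2, d20_eq, d11_eq, d02_eq]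
  linarith

lemma Close.V_lipschitzOn (h : Close f g L a R M r) {x y : Plane}
    (hx : x ∈ Metric.closedBall (0 : Plane) R) (hy : y ∈ Metric.closedBall (0 : Plane) R) :
    ‖V g x - V g y‖ ≤ 72 * M * ‖x - y‖ := by
  have := h.dist2_le hx hy
  exact (norm_V_sub_le _ _ _ _).trans (by linarith)

lemma Close.norm_V_sub_V_le (h : Close f g L a R M r) {x : Plane}
    (hx : x ∈ Metric.closedBall (0 : Plane) R) : ‖V g x - V f x‖ ≤ 12 * M * √r := by
  have := h.second x hx
  exact (norm_V_sub_le _ _ _ _).trans (by linarith)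

/-- The remainder is quadratic in second derivative errors of size √r, hence of order r wherever the
gap is bounded below. -/
lemma Close.norm_V_sub_linErr_le (h : Close f g L a R M r) (hr : 0 ≤ r) {c : ℝ} (hc : 0 < c) {x : Plane}
    (hx : x ∈ Metric.closedBall (0 : Plane) R) (hgap : c ≤ gap (d20 f x) (d11 f x) (d02 f x)) :
    ‖V g x - V f x - linErr f g x‖ ≤ 12 * M ^ 2 / c * r := by
  refine (norm_eigenG_sub_linG_le (hc.trans_le hgap) _ _ _).trans ?_
  have h1 := h.second x hx
  have h0 := dist2_nonneg f g x x
  rw [dist2] at h1 h0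
  have h2 : |d20 g x - d20 f x| + 2 * |d11 g x - d11 f x| + |d02 g x - d02 f x| ≤
      2 * (M * √r) := by
    linarith [abs_nonneg (d20 g x - d20 f x), abs_nonneg (d02 g x - d02 f x)]
  calc 3 * ((|d20 g x - d20 f x| + 2 * |d11 g x - d11 f x| + |d02 g x - d02 f x|) ^ 2 /
        gap (d20 f x) (d11 f x) (d02 f x)) ≤ 3 * ((2 * (M * √r)) ^ 2 / c) := by gcongr
    _ = 12 * M ^ 2 / c * r := by
      rw [mul_pow, mul_pow, Real.sq_sqrt hr]; ring

/-- Both trajectories stay in the ball on which the functions are compared. -/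
lemma curve_mem_ball (hg : TameDeriv 3 g) {x : Plane} {S T : ℝ} (hS : 0 ≤ S)
    (hball : ∀ z, ‖z - x‖ ≤ S * T → z ∈ Metric.closedBall (0 : Plane) R)
    (hV : ∀ z ∈ Metric.closedBall (0 : Plane) R, ‖V g z‖ < S) {t : ℝ} (ht : |t| ≤ T) :
    curve g x t ∈ Metric.closedBall (0 : Plane) R := by
  refine hball _ (((hg.curve_spec x).norm_sub_le_of_bound hS
    (fun z hz => hV z (hball z hz)) ht).trans ?_)
  gcongr

/-- This crude comparison uses the pointwise difference of the fields and ignores cancellation. It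
is enough to locate the hitting time of g. -/
lemma Close.norm_curve_sub_le (h : Close f g L a R M r) (hf : TameDeriv 3 f) (hM : 0 < M) {x : Plane}
    {T : ℝ} (hT : 0 ≤ T)
    (hfB : ∀ t, |t| ≤ T → curve f x t ∈ Metric.closedBall (0 : Plane) R)
    (hgB : ∀ t, |t| ≤ T → curve g x t ∈ Metric.closedBall (0 : Plane) R) {t : ℝ} (ht : |t| ≤ T) :
    ‖curve g x t - curve f x t‖ ≤ 12 * M * T * Real.exp (72 * M * T) * √r := by
  have hu : ∀ s ∈ Set.uIcc 0 t, |s| ≤ |t| := fun s hs => by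
    have := Set.abs_sub_left_of_mem_uIcc hs
    simpa using this
  have key := (hf.curve_spec x).norm_sub_le_of_integral' (h.tame.curve_spec x)
    (s := Metric.closedBall (0 : Plane) R) (K := 72 * M) (T := t) (κ := 12 * M * T * √r) (δ := 0)
    (by positivity) hf.V_continuous h.tame.V_continuous
    (fun x hx y hy => h.V_lipschitzOn hx hy) (fun s hs => hfB s ((hu s hs).trans ht))
    (fun s hs => hgB s ((hu s hs).trans ht)) (by simp) (fun s hs => ?_)
  · refine key.trans ?_
    rw [add_zero]
    have : Real.exp (72 * M * |t|) ≤ Real.exp (72 * M * T) := by gcongr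
    calc 12 * M * T * √r * Real.exp (72 * M * |t|)
        ≤ 12 * M * T * √r * Real.exp (72 * M * T) := by gcongr
      _ = _ := by ring
  · have hst := (hu s hs).trans ht
    have := intervalIntegral.norm_integral_le_of_norm_le_const (a := 0) (b := s)
      (f := fun r => V g (curve f x r) - V f (curve f x r)) (C := 12 * M * √r)
      (fun v hv => h.norm_V_sub_V_le (hfB v (by
        have h1 := Set.abs_sub_left_of_mem_uIcc (Set.uIoc_subset_uIcc hv)
        simp only [sub_zero] at h1
        exact h1.trans hst)))
    refine this.trans ?_
    rw [sub_zero]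
    calc 12 * M * √r * |s| ≤ 12 * M * √r * T := by gcongr
      _ = _ := by ring

lemma FilamentAssumptions.exists_gap_le (hf : DensityAssumptions f)
    (hL : FilamentAssumptions f H L a) :
    ∃ c > 0, ∀ x ∈ startSet f L a, c ≤ gap (d20 f x) (d11 f x) (d02 f x) := by
  have hc : Continuous fun x => gap (d20 f x) (d11 f x) (d02 f x) := by
    have u : Continuous (d20 f) := hf.tame.continuous (l := [0, 0]) (by simp)
    have v : Continuous (d11 f) := hf.tame.continuous (l := [0, 1]) (by simp)
    have w : Continuous (d02 f) := hf.tame.continuous (l := [1, 1]) (by simp)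
    unfold gap
    fun_prop
  exact (hL.isCompact_startSet hf).exists_forall_le' hc.continuousOn
    (fun x hx => hL.gap_pos (hL.start_subset hx))

lemma continuousOn_linErr (hf : TameDeriv 3 f) (hg : TameDeriv 3 g) :
    ContinuousOn (linErr f g) {x | 0 < gap (d20 f x) (d11 f x) (d02 f x)} := by
  have u : Continuous (d20 f) := hf.continuous (l := [0, 0]) (by simp)
  have v : Continuous (d11 f) := hf.continuous (l := [0, 1]) (by simp)
  have w : Continuous (d02 f) := hf.continuous (l := [1, 1]) (by simp)
  have u' : Continuous (d20 g) := hg.continuous (l := [0, 0]) (by simp)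
  have v' : Continuous (d11 g) := hg.continuous (l := [0, 1]) (by simp)
  have w' : Continuous (d02 g) := hg.continuous (l := [1, 1]) (by simp)
  have hgap : Continuous fun x => gap (d20 f x) (d11 f x) (d02 f x) := by unfold gap; fun_prop
  have hD : ContinuousOn (fun x => gapDeriv (d20 f x) (d11 f x) (d02 f x) (d20 g x - d20 f x)
      (d11 g x - d11 f x) (d02 g x - d02 f x)) {x | 0 < gap (d20 f x) (d11 f x) (d02 f x)} := by
    unfold gapDeriv cosPart sinPart
    have h1 := ((w.sub u).continuousOn (s := {x | 0 < gap (d20 f x) (d11 f x) (d02 f x)})).div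
      hgap.continuousOn (fun x hx => ne_of_gt hx)
    have h2 := ((continuous_const.mul v).continuousOn
      (s := {x | 0 < gap (d20 f x) (d11 f x) (d02 f x)})).div
      hgap.continuousOn (fun x hx => ne_of_gt hx) (f := fun x => 2 * d11 f x)
    exact (h1.mul ((w'.sub w).sub (u'.sub u)).continuousOn).add
      ((continuousOn_const.mul h2).mul (v'.sub v).continuousOn)
  unfold linErr linG
  refine (PiLp.continuous_toLp 2 _).comp_continuousOn (continuousOn_pi.2 fun i => ?_)
  fin_cases i
  · exact (by fun_prop : Continuous fun x => 2 * (d20 g x - d20 f x) - 2 * (d02 g x - d02 f x) +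
      2 * (d11 g x - d11 f x)).continuousOn.sub (continuousOn_const.mul hD)
  · exact (by fun_prop : Continuous fun x => (d02 g x - d02 f x) - (d20 g x - d20 f x) +
      4 * (d11 g x - d11 f x)).continuousOn.sub hD

/-- The trajectories of `f` and `g` differ by `O(r)` up to the filament. -/
lemma Close.norm_curve_hitTime_sub_le (h : Close f g L a R M r) (hf : DensityAssumptions f)
    (hL : FilamentAssumptions f H L a) (hM : 0 < M) (hr : 0 ≤ r) {c : ℝ} (hc : 0 < c)
    (hgap : ∀ x ∈ startSet f L a, c ≤ gap (d20 f x) (d11 f x) (d02 f x)) {x : Plane}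
    (hx : x ∈ startSet f L a)
    (hfB : ∀ t, |t| ≤ a → curve f x t ∈ Metric.closedBall (0 : Plane) R)
    (hgB : ∀ t, |t| ≤ a → curve g x t ∈ Metric.closedBall (0 : Plane) R) :
    ‖curve g x (hitTime f x) - curve f x (hitTime f x)‖ ≤
      (12 * M ^ 2 / c * a + 2 * M) * Real.exp (72 * M * a) * r := by
  set θ := hitTime f x with hθ
  set y := filamentPoint f x with hy
  have ha := hL.a_pos
  have hyL : y ∈ L := hL.filamentPoint_mem hx
  have hθa : |θ| ≤ a := hL.abs_hitTime_le hf hx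
  have hu : ∀ s ∈ Set.uIcc 0 θ, |s| ≤ |θ| := fun s hs => by
    have := Set.abs_sub_left_of_mem_uIcc hs
    simpa using this
  have hu2 : ∀ s ∈ Set.uIcc 0 θ, |s - θ| ≤ a := fun s hs => by
    have := Set.abs_sub_right_of_mem_uIcc hs
    rw [sub_zero] at this
    rw [abs_sub_comm]
    exact this.trans hθa
  have hcv : ∀ s, curve f x s = curve f y (s - θ) :=
    FilamentAssumptions.curve_eq_curve_filamentPoint hf x
  have hst : ∀ s ∈ Set.uIcc 0 θ, curve f x s ∈ startSet f L a := fun s hs => by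
    rw [hcv]; exact curve_mem_startSet hyL (hu2 s hs)
  have key := (hf.tame3.curve_spec x).norm_sub_le_of_integral' (h.tame.curve_spec x)
    (s := Metric.closedBall (0 : Plane) R) (K := 72 * M) (T := θ)
    (κ := (12 * M ^ 2 / c * a + 2 * M) * r) (δ := 0)
    (by positivity) hf.tame3.V_continuous h.tame.V_continuous
    (fun x hx y hy => h.V_lipschitzOn hx hy) (fun s hs => hfB s ((hu s hs).trans hθa))
    (fun s hs => hgB s ((hu s hs).trans hθa)) (by simp) (fun s hs => ?_)
  · refine key.trans ?_
    rw [add_zero]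
    have : Real.exp (72 * M * |θ|) ≤ Real.exp (72 * M * a) := by gcongr
    calc (12 * M ^ 2 / c * a + 2 * M) * r * Real.exp (72 * M * |θ|)
        ≤ (12 * M ^ 2 / c * a + 2 * M) * r * Real.exp (72 * M * a) := by gcongr
      _ = _ := by ring
  · have hsub : Set.uIcc 0 s ⊆ Set.uIcc 0 θ := Set.uIcc_subset_uIcc Set.left_mem_uIcc hs
    have hcontx := (hf.tame3.curve_continuous x)
    have hlin : ContinuousOn (fun v => linErr f g (curve f x v)) (Set.uIcc 0 s) :=
      (continuousOn_linErr hf.tame3 h.tame).comp hcontx.continuousOn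
        (fun v hv => hc.trans_le (hgap _ (hst v (hsub hv))))
    have hVc : Continuous fun v => V g (curve f x v) - V f (curve f x v) :=
      (h.tame.V_continuous.comp hcontx).sub (hf.tame3.V_continuous.comp hcontx)
    have e : ∫ v in (0 : ℝ)..s, (V g (curve f x v) - V f (curve f x v)) =
        (∫ v in (0 : ℝ)..s, (V g (curve f x v) - V f (curve f x v) - linErr f g (curve f x v))) +
        ∫ v in (0 : ℝ)..s, linErr f g (curve f x v) := by
      rw [← intervalIntegral.integral_add]
      · simp
      · exact (hVc.intervalIntegrable _ _).sub hlin.intervalIntegrable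
      · exact hlin.intervalIntegrable
    have b1 : ‖∫ v in (0 : ℝ)..s, (V g (curve f x v) - V f (curve f x v) -
        linErr f g (curve f x v))‖ ≤ 12 * M ^ 2 / c * r * |s - 0| :=
      intervalIntegral.norm_integral_le_of_norm_le_const fun v hv => by
        have hv' := hsub (Set.uIoc_subset_uIcc hv)
        exact h.norm_V_sub_linErr_le hr hc (hfB v ((hu v hv').trans hθa)) (hgap _ (hst v hv'))
    have hI : ∀ p q : ℝ, |p| ≤ a → |q| ≤ a →
        IntervalIntegrable (fun v => linErr f g (curve f y v)) volume p q := fun p q hp hq => by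
      refine ContinuousOn.intervalIntegrable ?_
      refine (continuousOn_linErr hf.tame3 h.tame).comp
        (hf.tame3.curve_continuous y).continuousOn (fun v hv => ?_)
      refine hc.trans_le (hgap _ (curve_mem_startSet hyL (abs_le.2 ?_)))
      exact Set.uIcc_subset_Icc (abs_le.1 hp) (abs_le.1 hq) hv
    -- Closeness controls line integrals based at points of L only. The integral along the curve
    -- from x is the difference of two such integrals based at its filament point y, which accounts
    -- for the factor 2 in `b2`.
    have e2 : ∫ v in (0 : ℝ)..s, linErr f g (curve f x v) =
        (∫ v in (0 : ℝ)..(s - θ), linErr f g (curve f y v)) -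
        ∫ v in (0 : ℝ)..(0 - θ), linErr f g (curve f y v) := by
      have h0a : |(0 : ℝ)| ≤ a := by simp [ha.le]
      have h0θ : |0 - θ| ≤ a := by rw [zero_sub, abs_neg]; exact hθa
      rw [intervalIntegral.integral_interval_sub_left (hI _ _ h0a (hu2 s hs)) (hI _ _ h0a h0θ)]
      rw [← intervalIntegral.integral_comp_sub_right (fun v => linErr f g (curve f y v)) θ]
      simp only [hcv]
    have b2 : ‖∫ v in (0 : ℝ)..s, linErr f g (curve f x v)‖ ≤ 2 * (M * r) := by
      rw [e2]
      have h1 := h.line y hyL (s - θ) (hu2 s hs)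
      have h2 := h.line y hyL (0 - θ) (by rw [zero_sub, abs_neg]; exact hθa)
      exact (norm_sub_le _ _).trans (by linarith)
    rw [e]
    refine (norm_add_le _ _).trans ?_
    have hsa : |s - 0| ≤ a := by rw [sub_zero]; exact (hu s hs).trans hθa
    have b3 : 12 * M ^ 2 / c * r * |s - 0| ≤ 12 * M ^ 2 / c * r * a := by gcongr
    linarith

end

section

variable {f : Plane → ℝ} {H L : Set Plane} {a : ℝ}

/-- The gradient of g is Lipschitz up to an error O(r), being that close to ∇f, and its second
derivatives are Lipschitz on the ball by the third derivative bound. So the slope at y cannot exceed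
its value 0 at Y by more than O(‖Y - y‖ + r). -/
lemma Close.abs_slope_le {R M r : ℝ} {g : Plane → ℝ} (hclose : Close f g L a R M r) (hM : 0 < M)
    (hr1 : r ≤ 1) {Cv Cg D1 : ℝ} (hCv : 0 ≤ Cv) (hCg : 0 ≤ Cg)
    (hD1 : 0 ≤ D1) (hGb : ∀ x, ‖gradient f x‖ ≤ Cg) (hd1 : ∀ x y, dist1 f x f y ≤ D1 * ‖x - y‖)
    {y Y : Plane} (hyB : y ∈ Metric.closedBall (0 : Plane) R)
    (hYB : Y ∈ Metric.closedBall (0 : Plane) R) (h4 : ‖V g y‖ ≤ Cv + 1) (hroot : slope g Y = 0)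
    (hr : 0 ≤ r) :
    |slope g y| ≤ (2 * M * (Cv + 1) + D1 * (Cv + 1) + (Cg + M) * (72 * M)) * (‖Y - y‖ + r) := by
  have h0 := abs_slope_sub_le g y g Y
  rw [hroot, sub_zero] at h0
  refine h0.trans ?_
  set e := ‖Y - y‖ with he
  have he' : ‖y - Y‖ = e := norm_sub_rev _ _
  have h1 : dist1 g y g Y ≤ 2 * M * r + D1 * e := by
    have k1 := dist1_triangle f g y Y
    have k2 := dist1_triangle g f y Y
    have k3 := hclose.first y hyB
    have k4 := hclose.first Y hYB
    have k5 := hd1 y Y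
    rw [he'] at k5
    have k6 : dist1 g y g Y ≤ dist1 g y f y + dist1 f y f Y + dist1 g Y f Y := by
      have h0 := abs_sub_le (partialDeriv 0 g y) (partialDeriv 0 f Y) (partialDeriv 0 g Y)
      have h1 := abs_sub_le (partialDeriv 1 g y) (partialDeriv 1 f Y) (partialDeriv 1 g Y)
      rw [abs_sub_comm (partialDeriv 0 f Y)] at h0
      rw [abs_sub_comm (partialDeriv 1 f Y)] at h1
      have k7 : dist1 g y g Y ≤ dist1 g y f Y + dist1 g Y f Y := by
        rw [dist1, dist1, dist1]; linarith
      linarith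
    linarith
  have h2 : dist2 g y g Y ≤ 6 * M * e := by
    have := hclose.dist2_le hyB hYB
    rwa [he'] at this
  have h3 : ‖gradient g Y‖ ≤ Cg + M := by
    have k1 := norm_gradient_sub_le g Y f Y
    have k2 := hclose.first Y hYB
    have k3 := norm_add_le (gradient g Y - gradient f Y) (gradient f Y)
    rw [sub_add_cancel] at k3
    have : M * r ≤ M := by nlinarith
    linarith [hGb Y]
  calc dist1 g y g Y * ‖V g y‖ + ‖gradient g Y‖ * (12 * dist2 g y g Y)
      ≤ (2 * M * r + D1 * e) * (Cv + 1) + (Cg + M) * (12 * (6 * M * e)) := by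
        have := dist2_nonneg g g y Y
        gcongr
    _ ≤ (2 * M * (Cv + 1) + D1 * (Cv + 1) + (Cg + M) * (72 * M)) * (e + r) := by
        have k1 : 0 ≤ D1 * (Cv + 1) * r := by positivity
        have k2 : 0 ≤ (Cg + M) * (72 * M) * r := by positivity
        have k3 : 0 ≤ 2 * M * (Cv + 1) * e := by positivity
        linarith

/-- At a zero of the slope of f, slope g = ⟨∇g - ∇f, V g⟩ + ⟨∇f, V g - V f⟩. The first term is O(r),
and the second equals its linearization up to O(r). -/
lemma Close.abs_slope_sub_linErr_le {R M r : ℝ} {g : Plane → ℝ} (hclose : Close f g L a R M r)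
    (hM : 0 < M) (hr : 0 ≤ r) {Cv Cg gm : ℝ} (hCg : 0 ≤ Cg)
    (hGb : ∀ x, ‖gradient f x‖ ≤ Cg) {y : Plane} (hyB : y ∈ Metric.closedBall (0 : Plane) R)
    (hVy : ‖V g y‖ ≤ Cv + 1) (hgm : 0 < gm) (hgap : gm ≤ gap (d20 f y) (d11 f y) (d02 f y))
    (hy : slope f y = 0) :
    |slope g y - inner ℝ (gradient f y) (linErr f g y)| ≤
      (M * (Cv + 1) + Cg * (12 * M ^ 2 / gm)) * r := by
  have h0 : slope g y - inner ℝ (gradient f y) (linErr f g y) =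
      inner ℝ (gradient g y - gradient f y) (V g y) +
      inner ℝ (gradient f y) (V g y - V f y - linErr f g y) := by
    have : inner ℝ (gradient f y) (V f y) = (0 : ℝ) := hy
    rw [slope, inner_sub_left, inner_sub_right, inner_sub_right, this]; ring
  rw [h0]
  refine (abs_add_le _ _).trans ?_
  have k1 := (norm_gradient_sub_le g y f y).trans (hclose.first y hyB)
  have k2 := hclose.norm_V_sub_linErr_le hr hgm hyB hgap
  have k3 : |inner ℝ (gradient g y - gradient f y) (V g y)| ≤ M * r * (Cv + 1) :=
    (abs_real_inner_le_norm _ _).trans (by gcongr)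
  have k4 : |inner ℝ (gradient f y) (V g y - V f y - linErr f g y)| ≤
      Cg * (12 * M ^ 2 / gm * r) :=
    (abs_real_inner_le_norm _ _).trans (by gcongr; exact hGb y)
  linarith

set_option maxHeartbeats 1000000 in
/-- Functions that are close to the density have a nearby filament; the displacement is of order
`r` in directions orthogonal to `V f`, and it dominates the slope at the filament point. -/
theorem FilamentAssumptions.exists_perturbation_bound (hf : DensityAssumptions f)
    (hL : FilamentAssumptions f H L a) :
    ∃ R > 0, startSet f L a ⊆ Metric.closedBall 0 R ∧ ∀ M > 0, ∃ r₀ > 0, ∃ C > 0,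
      ∀ (g : Plane → ℝ) (r : ℝ), 0 < r → r < r₀ → Close f g L a R M r →
      ∀ x ∈ startSet f L a, ∀ t, IsArgminChoice (ridgeTimes g x) t →
      (∀ W : Plane, inner ℝ (V f (filamentPoint f x)) W = 0 →
        |inner ℝ (curve g x t - filamentPoint f x) W| ≤ C * r * ‖W‖) ∧
      |slope g (filamentPoint f x)| ≤ C * (‖curve g x t - filamentPoint f x‖ + r) ∧
      |slope g (filamentPoint f x) -
        inner ℝ (gradient f (filamentPoint f x)) (linErr f g (filamentPoint f x))| ≤ C * r := by
  have ha := hL.a_pos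
  obtain ⟨Cv, hCv, hVb⟩ := hf.tame3.V_bounded
  obtain ⟨LV, hLV, hVL⟩ := hf.tame3.V_lipschitz
  obtain ⟨Cg, hCg, hGb⟩ := hf.tame3.gradient_bounded
  obtain ⟨D1, hD1, hd1⟩ := hf.tame3.dist1_le
  obtain ⟨D2, hD2, hd2⟩ := hf.tame3.dist2_le
  obtain ⟨gm, hgm, hgap⟩ := hL.exists_gap_le hf
  obtain ⟨c, hc, η, hη, htr⟩ := hL.exists_transversal hf
  obtain ⟨δ, hδ, hsep⟩ := hL.exists_separation hf hη
  obtain ⟨R0, hR0⟩ := (hL.isCompact_startSet hf).isBounded.subset_closedBall 0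
  -- Trajectories are followed up to time a + 1, to leave room beyond the hitting times, and Cv + 1
  -- bounds the speed for f and for close g.
  set R := |R0| + (Cv + 1) * (a + 1) with hR
  have hRball : ∀ x ∈ startSet f L a, ∀ z : Plane, ‖z - x‖ ≤ (Cv + 1) * (a + 1) →
      z ∈ Metric.closedBall (0 : Plane) R := fun x hx z hz => by
    have h1 := hR0 hx
    rw [mem_closedBall_zero_iff] at h1 ⊢
    have := norm_add_le (z - x) x
    rw [sub_add_cancel] at this
    linarith [le_abs_self R0]
  have hsub : startSet f L a ⊆ Metric.closedBall 0 R := fun x hx =>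
    hRball x hx x (by simp; positivity)
  refine ⟨R, by positivity, hsub, fun M hM => ?_⟩
  set C1 := 12 * M * (a + 1) * Real.exp (72 * M * (a + 1)) with hC1
  have hC1p : 0 < C1 := by positivity
  set C2 := (M + D1 * C1) * (Cv + 1) + Cg * (12 * (M + D2 * C1)) + (M + D2 * C1) with hC2
  have hC2p : 0 < C2 := by positivity
  set C3 := C2 / c with hC3
  have hC3p : 0 < C3 := by positivity
  set C4 := 12 * M + LV * (C1 + Cv * C3) with hC4
  have hC4p : 0 < C4 := by positivity
  set C5 := (12 * M ^ 2 / gm * a + 2 * M) * Real.exp (72 * M * a) with hC5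
  have hC5p : 0 < C5 := by positivity
  -- m is the upper bound imposed on √r. The condition on 12 M m keeps the speed of g below Cv + 1,
  -- and those on C2 m are the smallness conditions of `argmin_near` with E = C2 √r.
  obtain ⟨m, hm, hm1, hm2, hm3, hm4, hm5, hm6, hm7⟩ : ∃ m > 0, m ≤ 1 ∧ 12 * M * m ≤ 1 ∧
      C2 * m / c ≤ η / 2 ∧ C2 * m ≤ c / 2 ∧ C2 * m ≤ δ ∧ C2 * m / c ≤ δ ∧ C2 * m / c ≤ 1 := by
    have hev : ∀ k : ℝ, ∀ u > 0, ∀ᶠ m in 𝓝 (0 : ℝ), k * m ≤ u := fun k u hu => by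
      have : Tendsto (fun m : ℝ => k * m) (𝓝 0) (𝓝 (k * 0)) := tendsto_id.const_mul k
      rw [mul_zero] at this
      exact (this.eventually (gt_mem_nhds hu)).mono fun _ h => h.le
    have hall := (hev 1 1 one_pos).and ((hev (12 * M) 1 one_pos).and
      ((hev (C2 / c) (η / 2) (by positivity)).and ((hev C2 (c / 2) (by positivity)).and
      ((hev C2 δ hδ).and ((hev (C2 / c) δ hδ).and (hev (C2 / c) 1 one_pos))))))
    obtain ⟨m, ⟨k1, k2, k3, k4, k5, k6, k7⟩, hm⟩ :=
      ((hall.filter_mono nhdsWithin_le_nhds).and self_mem_nhdsWithin :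
        ∀ᶠ m in 𝓝[>] (0 : ℝ), _).exists
    rw [div_mul_eq_mul_div] at k3 k6 k7
    exact ⟨m, hm, by linarith, k2, k3, k4, k5, k6, k7⟩
  set C := C5 + C4 * C3 + (2 * M * (Cv + 1) + D1 * (Cv + 1) + (Cg + M) * (72 * M)) +
    (M * (Cv + 1) + Cg * (12 * M ^ 2 / gm)) with hC
  refine ⟨m ^ 2, by positivity, C, by positivity, fun g r hr hrm hclose x hx t ht => ?_⟩
  set ε := √r with hε
  have hεp : 0 < ε := Real.sqrt_pos.2 hr
  have hεm : ε < m := (Real.sqrt_lt' hm).2 hrm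
  have hε2 : ε ^ 2 = r := Real.sq_sqrt hr.le
  have hrε : r ≤ ε := by nlinarith
  have hr1 : r ≤ 1 := by linarith
  set θ := hitTime f x with hθ
  set y := filamentPoint f x with hy
  have hyL : y ∈ L := hL.filamentPoint_mem hx
  have hyst : y ∈ startSet f L a := hL.subset_startSet hf hyL
  have hyB := hsub hyst
  have hθa : |θ| ≤ a := hL.abs_hitTime_le hf hx
  have hVg : ∀ z ∈ Metric.closedBall (0 : Plane) R, ‖V g z‖ < Cv + 1 := fun z hz => by
    have h1 := hclose.norm_V_sub_V_le hz
    have h2 := norm_add_le (V g z - V f z) (V f z)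
    rw [sub_add_cancel] at h2
    have h3 : 12 * M * ε < 1 := lt_of_lt_of_le (by gcongr) hm2
    linarith [hVb z]
  have hfB : ∀ s, |s| ≤ a + 1 → curve f x s ∈ Metric.closedBall (0 : Plane) R := fun s hs =>
    curve_mem_ball hf.tame3 (by positivity) (hRball x hx)
      (fun z _ => lt_of_le_of_lt (hVb z) (by linarith)) hs
  have hgB : ∀ s, |s| ≤ a + 1 → curve g x s ∈ Metric.closedBall (0 : Plane) R := fun s hs =>
    curve_mem_ball hclose.tame (by positivity) (hRball x hx) hVg hs
  have hcur : ∀ s, |s| ≤ a + 1 → ‖curve g x s - curve f x s‖ ≤ C1 * ε := fun s hs =>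
    hclose.norm_curve_sub_le hf.tame3 hM (by linarith) hfB hgB hs
  have hdist2 : ∀ s, |s| ≤ a + 1 →
      dist2 g (curve g x s) f (curve f x s) ≤ (M + D2 * C1) * ε := fun s hs => by
    have h1 := hclose.second _ (hgB s hs)
    have h2 := hd2 (curve g x s) (curve f x s)
    have h3 : D2 * ‖curve g x s - curve f x s‖ ≤ D2 * (C1 * ε) := by gcongr; exact hcur s hs
    have := dist2_triangle f g (curve g x s) (curve f x s)
    linarith
  have hdist1 : ∀ s, |s| ≤ a + 1 →
      dist1 g (curve g x s) f (curve f x s) ≤ (M + D1 * C1) * ε := fun s hs => by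
    have h1 := hclose.first _ (hgB s hs)
    have h2 := hd1 (curve g x s) (curve f x s)
    have h3 : D1 * ‖curve g x s - curve f x s‖ ≤ D1 * (C1 * ε) := by gcongr; exact hcur s hs
    have := dist1_triangle f g (curve g x s) (curve f x s)
    have : M * r ≤ M * ε := by gcongr
    linarith
  have hslope : ∀ s, |s| ≤ a + 1 →
      |slope g (curve g x s) - slope f (curve f x s)| ≤ C2 * ε := fun s hs => by
    refine (abs_slope_sub_le _ _ _ _).trans ?_
    have h1 : dist1 g (curve g x s) f (curve f x s) * ‖V g (curve g x s)‖ ≤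
        ((M + D1 * C1) * ε) * (Cv + 1) := by
      gcongr
      · exact hdist1 s hs
      · exact (hVg _ (hgB s hs)).le
    have h2 : ‖gradient f (curve f x s)‖ * (12 * dist2 g (curve g x s) f (curve f x s)) ≤
        Cg * (12 * ((M + D2 * C1) * ε)) := by
      gcongr
      · have := dist2_nonneg f g (curve g x s) (curve f x s)
        positivity
      · exact hGb _
      · exact hdist2 s hs
    have h3 : 0 ≤ (M + D2 * C1) * ε := by positivity
    calc _ ≤ ((M + D1 * C1) * ε) * (Cv + 1) + Cg * (12 * ((M + D2 * C1) * ε)) +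
          (M + D2 * C1) * ε := by linarith
      _ = C2 * ε := by rw [hC2]; ring
  have hlam : ∀ s, |s| ≤ a + 1 →
      |lam2 g (curve g x s) - lam2 f (curve f x s)| ≤ C2 * ε := fun s hs => by
    refine (abs_lam2_sub_le _ _ _ _).trans ((hdist2 s hs).trans ?_)
    have h1 : 0 ≤ (M + D1 * C1) * (Cv + 1) + Cg * (12 * (M + D2 * C1)) := by positivity
    exact mul_le_mul_of_nonneg_right (by rw [hC2]; linarith only [h1]) hεp.le
  obtain ⟨σ, hσ, hcross⟩ := htr y hyL
  have hcvy : ∀ s, curve f x (θ + s) = curve f y s := fun s => by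
    rw [FilamentAssumptions.curve_eq_curve_filamentPoint hf x]; congr 1; ring
  have hEm : C2 * ε ≤ C2 * m := by gcongr
  have hEmc : C2 * ε / c ≤ C2 * m / c := by gcongr
  obtain ⟨⟨hroot, -⟩, htθ⟩ := argmin_near (p := fun s => slope f (curve f x s))
    (q := fun s => slope g (curve g x s)) (l := fun s => lam2 f (curve f x s))
    (m := fun s => lam2 g (curve g x s)) (E := C2 * ε) hθa hc hσ
    (fun τ hτ => by simpa only [hcvy] using hcross τ hτ) (hsep x hx) (by positivity) hslope hlam
    (hclose.tame.continuous_slope.comp (hclose.tame.curve_continuous x)) (by linarith)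
    (by linarith) (by linarith) (by linarith) (by linarith) ht
  have htθ' : |t - θ| ≤ C3 * ε := by rw [hC3, div_mul_eq_mul_div]; exact htθ
  have hta : |t| ≤ a + 1 := by
    have := abs_add_le (t - θ) θ
    rw [sub_add_cancel] at this
    linarith
  have hYB := hgB t hta
  set Y := curve g x t with hY
  have hyx : curve f x θ = y := rfl
  refine ⟨fun W hW => ?_, ?_, ?_⟩
  · have h1 := hclose.norm_curve_hitTime_sub_le hf hL hM hr.le hgm hgap hx
      (fun s hs => hfB s (by linarith)) (fun s hs => hgB s (by linarith))
    rw [← hC5, ← hθ, hyx] at h1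
    -- Over a time of at most C3 ε the velocity differs from V f y by at most C4 ε, so the deviation
    -- is of order ε² = r. The multiple of V f y is annihilated by W.
    have h2 : ‖Y - curve g x θ - (t - θ) • V f y‖ ≤ C4 * ε * (C3 * ε) := by
      have hder : ∀ s ∈ Set.uIcc θ t, HasDerivWithinAt (fun s => curve g x s - s • V f y)
          (V g (curve g x s) - V f y) (Set.uIcc θ t) s := fun s _ => by
        have := ((hclose.tame.curve_spec x).2 s).sub ((hasDerivAt_id s).smul_const (V f y))
        rw [one_smul] at this
        exact this.hasDerivWithinAt
      have hbd : ∀ s ∈ Set.uIcc θ t, ‖V g (curve g x s) - V f y‖ ≤ C4 * ε := fun s hs => by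
        have hsθ : |s - θ| ≤ C3 * ε := (Set.abs_sub_left_of_mem_uIcc hs).trans htθ'
        have hsa : |s| ≤ a + 1 := by
          have := abs_add_le (s - θ) θ
          rw [sub_add_cancel] at this
          have h7 : C3 * ε = C2 * ε / c := by rw [hC3]; ring
          linarith
        have k1 := hclose.norm_V_sub_V_le (hgB s hsa)
        have k2 := hVL (curve g x s) y
        have k3 := norm_curve_sub_le_of_V_bounded hf.tame3 hVb x s θ
        rw [hyx] at k3
        have k4 : ‖curve g x s - y‖ ≤ C1 * ε + Cv * (C3 * ε) := by
          have := norm_add_le (curve g x s - curve f x s) (curve f x s - y)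
          rw [sub_add_sub_cancel] at this
          have k5 : Cv * |s - θ| ≤ Cv * (C3 * ε) := by gcongr
          linarith [hcur s hsa]
        have k6 := norm_add_le (V g (curve g x s) - V f (curve g x s)) (V f (curve g x s) - V f y)
        rw [sub_add_sub_cancel] at k6
        have k7 : LV * ‖curve g x s - y‖ ≤ LV * (C1 * ε + Cv * (C3 * ε)) := by gcongr
        rw [hC4]
        linarith
      have := (convex_uIcc θ t).norm_image_sub_le_of_norm_hasDerivWithin_le hder hbd
        Set.left_mem_uIcc Set.right_mem_uIcc
      have e : Y - curve g x θ - (t - θ) • V f y =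
          (curve g x t - t • V f y) - (curve g x θ - θ • V f y) := by
        rw [hY, sub_smul]; abel
      rw [e]
      refine this.trans ?_
      rw [Real.norm_eq_abs]
      gcongr
    have e : Y - y = (curve g x θ - y) + (Y - curve g x θ - (t - θ) • V f y) +
        (t - θ) • V f y := by abel
    rw [e, inner_add_left, inner_add_left, inner_smul_left, hW, mul_zero, add_zero]
    refine (abs_add_le _ _).trans ?_
    have i1 := (abs_real_inner_le_norm (curve g x θ - y) W).trans
      (mul_le_mul_of_nonneg_right h1 (norm_nonneg W))
    have i2 := (abs_real_inner_le_norm (Y - curve g x θ - (t - θ) • V f y) W).trans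
      (mul_le_mul_of_nonneg_right h2 (norm_nonneg W))
    have h3 : C4 * ε * (C3 * ε) = C4 * C3 * r := by rw [← hε2]; ring
    rw [h3] at i2
    have h4 : (C5 + C4 * C3) * r * ‖W‖ ≤ C * r * ‖W‖ := by
      gcongr
      have : 0 ≤ (2 * M * (Cv + 1) + D1 * (Cv + 1) + (Cg + M) * (72 * M)) +
        (M * (Cv + 1) + Cg * (12 * M ^ 2 / gm)) := by positivity
      linarith
    linarith
  · refine (hclose.abs_slope_le hM hr1 hCv.le hCg.le hD1.le hGb hd1 hyB hYB (hVg y hyB).le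
      hroot hr.le).trans ?_
    refine mul_le_mul_of_nonneg_right ?_ (by positivity)
    have : 0 ≤ C5 + C4 * C3 + (M * (Cv + 1) + Cg * (12 * M ^ 2 / gm)) := by positivity
    rw [hC]; linarith only [this]
  · refine (hclose.abs_slope_sub_linErr_le hM hr.le hCg.le hGb hyB (hVg y hyB).le
      hgm (hgap y hyst) (hL.ridge hyL).1).trans ?_
    refine mul_le_mul_of_nonneg_right ?_ hr.le
    have : 0 ≤ C5 + C4 * C3 + (2 * M * (Cv + 1) + D1 * (Cv + 1) + (Cg + M) * (72 * M)) := by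
      positivity
    rw [hC]; linarith only [this]

end

/-! ### Uniform deviation of sums of independent random variables -/

section Deviation

variable {Ω E : Type*} [MeasurableSpace Ω] [MeasurableSpace E] {P : Measure Ω}
  [IsProbabilityMeasure P] {μ : Measure E} [IsProbabilityMeasure μ] {X : ℕ → Ω → E}

lemma integrable_of_abs_le {F : E → ℝ} (hF : Measurable F) {b : ℝ} (hb : ∀ x, |F x| ≤ b) :
    Integrable F μ :=
  Integrable.of_bound hF.aestronglyMeasurable b (Eventually.of_forall hb)

lemma abs_integral_le_of_abs_le {F : E → ℝ} {b : ℝ} (hb : ∀ x, |F x| ≤ b) :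
    |∫ x, F x ∂μ| ≤ b := by
  have := norm_integral_le_of_norm_le_const (μ := μ) (f := F) (C := b) (Eventually.of_forall hb)
  simpa using this

/-- Use exp x ≤ 1 + x + x² for |x| ≤ 1. The linear term integrates to zero, and the variance is at
most the second moment. -/
lemma integral_exp_centered_le {F : E → ℝ} (hF : Measurable F) {b v l : ℝ} (hb : ∀ x, |F x| ≤ b)
    (hv : ∫ x, F x ^ 2 ∂μ ≤ v) (hl : 0 ≤ l) (hlb : l * (2 * b) ≤ 1) :
    ∫ x, Real.exp (l * (F x - ∫ y, F y ∂μ)) ∂μ ≤ Real.exp (l ^ 2 * v) := by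
  set m := ∫ y, F y ∂μ with hm
  have hI : Integrable F μ := integrable_of_abs_le hF hb
  have hmb : |m| ≤ b := abs_integral_le_of_abs_le hb
  have hG : ∀ x, |l * (F x - m)| ≤ 1 := fun x => by
    rw [abs_mul, abs_of_nonneg hl]
    refine (mul_le_mul_of_nonneg_left ?_ hl).trans hlb
    exact (abs_sub _ _).trans (by linarith [hb x])
  have hI2 : Integrable (fun x => F x ^ 2) μ :=
    integrable_of_abs_le (hF.pow_const 2) (b := b ^ 2) fun x => by
      rw [abs_pow]; exact pow_le_pow_left₀ (abs_nonneg _) (hb x) 2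
  have hpt : ∀ x, Real.exp (l * (F x - m)) ≤ 1 + l * (F x - m) + l ^ 2 * (F x - m) ^ 2 := by
    intro x
    have := (abs_le.1 (Real.abs_exp_sub_one_sub_id_le (hG x))).2
    nlinarith
  have hexp : Integrable (fun x => Real.exp (l * (F x - m))) μ :=
    integrable_of_abs_le (by fun_prop) (b := Real.exp 1) fun x => by
      rw [abs_of_pos (Real.exp_pos _)]
      exact Real.exp_le_exp.2 ((le_abs_self _).trans (hG x))
  have hsq : Integrable (fun x => (F x - m) ^ 2) μ := by
    have : (fun x => (F x - m) ^ 2) = fun x => F x ^ 2 - 2 * m * F x + m ^ 2 := by ext x; ring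
    rw [this]
    exact (hI2.sub (hI.const_mul _)).add (integrable_const _)
  have hlin : Integrable (fun x => 1 + l * (F x - m)) μ :=
    (integrable_const _).add ((hI.sub (integrable_const _)).const_mul _)
  have h1 : ∫ x, (1 + l * (F x - m) + l ^ 2 * (F x - m) ^ 2) ∂μ =
      1 + l ^ 2 * (∫ x, F x ^ 2 ∂μ - m ^ 2) := by
    have e : (fun x => 1 + l * (F x - m) + l ^ 2 * (F x - m) ^ 2) = fun x =>
        (1 - l * m + l ^ 2 * m ^ 2) + (l - 2 * l ^ 2 * m) * F x + l ^ 2 * F x ^ 2 := by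
      ext x; ring
    have i1 : Integrable (fun x => (l - 2 * l ^ 2 * m) * F x) μ := hI.const_mul _
    have i2 : Integrable (fun x => (1 - l * m + l ^ 2 * m ^ 2) + (l - 2 * l ^ 2 * m) * F x) μ :=
      (integrable_const _).add i1
    have i3 : Integrable (fun x => l ^ 2 * F x ^ 2) μ := hI2.const_mul _
    rw [e, integral_add i2 i3, integral_add (integrable_const _) i1, integral_const_mul,
      integral_const_mul, ← hm]
    simp
    ring
  calc ∫ x, Real.exp (l * (F x - m)) ∂μ
      ≤ ∫ x, (1 + l * (F x - m) + l ^ 2 * (F x - m) ^ 2) ∂μ :=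
        integral_mono hexp (hlin.add (hsq.const_mul _)) hpt
    _ = 1 + l ^ 2 * (∫ x, F x ^ 2 ∂μ - m ^ 2) := h1
    _ ≤ l ^ 2 * v + 1 := by nlinarith [sq_nonneg l, sq_nonneg m, mul_nonneg (sq_nonneg l) (sq_nonneg m)]
    _ ≤ Real.exp (l ^ 2 * v) := Real.add_one_le_exp _

/-- Chernoff's method. The parameter l stays free, to be matched to the size of the net later. -/
lemma measureReal_sum_ge_le (hX : ∀ i, Measurable (X i)) (hind : iIndepFun X P)
    (hlaw : ∀ i, P.map (X i) = μ) {F : E → ℝ} (hF : Measurable F) {b v l : ℝ}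
    (hb : ∀ x, |F x| ≤ b) (hv : ∫ x, F x ^ 2 ∂μ ≤ v) (hl : 0 ≤ l) (hlb : l * (2 * b) ≤ 1)
    (n : ℕ) (s : ℝ) :
    P.real {ω | s ≤ ∑ i ∈ Finset.range n, (F (X i ω) - ∫ y, F y ∂μ)} ≤
      Real.exp (n * (l ^ 2 * v) - l * s) := by
  set m := ∫ y, F y ∂μ with hm
  set G : E → ℝ := fun x => F x - m with hG
  have hGm : Measurable G := hF.sub_const m
  have hY : ∀ i, Measurable (G ∘ X i) := fun i => hGm.comp (hX i)
  have hindY : iIndepFun (fun i => G ∘ X i) P := hind.comp (fun _ => G) (fun _ => hGm)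
  have hGb : ∀ x, |G x| ≤ 2 * b := fun x => by
    have := abs_integral_le_of_abs_le (μ := μ) hb
    exact (abs_sub _ _).trans (by linarith [hb x])
  have hint : Integrable (fun ω => Real.exp (l * (∑ i ∈ Finset.range n, G ∘ X i) ω)) P := by
    refine hindY.integrable_exp_mul_sum hY fun i _ => ?_
    refine integrable_of_abs_le (by have := hY i; fun_prop) (b := Real.exp (l * (2 * b)))
      fun ω => ?_
    rw [abs_of_pos (Real.exp_pos _)]
    exact Real.exp_le_exp.2 (mul_le_mul_of_nonneg_left ((le_abs_self _).trans (hGb _)) hl)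
  have h1 := measure_ge_le_exp_mul_mgf s hl hint
  rw [hindY.mgf_sum hY] at h1
  have h2 : ∀ i, mgf (G ∘ X i) P l ≤ Real.exp (l ^ 2 * v) := fun i => by
    have e : mgf (G ∘ X i) P l = ∫ x, Real.exp (l * G x) ∂μ := by
      rw [mgf, ← hlaw i, integral_map (hX i).aemeasurable
        (by fun_prop : Measurable fun x => Real.exp (l * G x)).aestronglyMeasurable]
      rfl
    rw [e]
    exact integral_exp_centered_le hF hb hv hl hlb
  have h3 : ∏ i ∈ Finset.range n, mgf (G ∘ X i) P l ≤ Real.exp (n * (l ^ 2 * v)) := by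
    refine (Finset.prod_le_prod (fun i _ => mgf_nonneg) (fun i _ => h2 i)).trans_eq ?_
    rw [Finset.prod_const, Finset.card_range, ← Real.exp_nat_mul]
  have e : {ω | s ≤ ∑ i ∈ Finset.range n, (F (X i ω) - m)} =
      {ω | s ≤ (∑ i ∈ Finset.range n, G ∘ X i) ω} := by
    ext ω; simp [hG]
  rw [e]
  calc _ ≤ _ := h1
    _ ≤ Real.exp (-l * s) * Real.exp (n * (l ^ 2 * v)) := by gcongr
    _ = _ := by rw [← Real.exp_add]; congr 1; ring

lemma measureReal_abs_sum_ge_le (hX : ∀ i, Measurable (X i)) (hind : iIndepFun X P)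
    (hlaw : ∀ i, P.map (X i) = μ) {F : E → ℝ} (hF : Measurable F) {b v l : ℝ}
    (hb : ∀ x, |F x| ≤ b) (hv : ∫ x, F x ^ 2 ∂μ ≤ v) (hl : 0 ≤ l) (hlb : l * (2 * b) ≤ 1)
    (n : ℕ) (s : ℝ) :
    P.real {ω | s ≤ |∑ i ∈ Finset.range n, F (X i ω) - n * ∫ y, F y ∂μ|} ≤
      2 * Real.exp (n * (l ^ 2 * v) - l * s) := by
  have h1 := measureReal_sum_ge_le hX hind hlaw hF hb hv hl hlb n s
  have h2 := measureReal_sum_ge_le hX hind hlaw hF.neg (b := b) (v := v)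
    (fun x => by rw [Pi.neg_apply, abs_neg]; exact hb x) (by simpa using hv) hl hlb n s
  have hsub : {ω | s ≤ |∑ i ∈ Finset.range n, F (X i ω) - n * ∫ y, F y ∂μ|} ⊆
      {ω | s ≤ ∑ i ∈ Finset.range n, (F (X i ω) - ∫ y, F y ∂μ)} ∪
      {ω | s ≤ ∑ i ∈ Finset.range n, ((-F) (X i ω) - ∫ y, (-F) y ∂μ)} := by
    intro ω hω
    simp only [Set.mem_union, Set.mem_ofPred_eq, Pi.neg_apply, integral_neg,
      Finset.sum_sub_distrib, Finset.sum_const, Finset.card_range, nsmul_eq_mul,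
      Finset.sum_neg_distrib] at hω ⊢
    rcases le_abs.1 hω with h | h
    · exact Or.inl h
    · exact Or.inr (by linarith)
  calc _ ≤ _ := measureReal_mono hsub
    _ ≤ _ := measureReal_union_le _ _
    _ ≤ _ := by linarith

/-- A set that is covered by polynomially many balls of radius `1 / n`. -/
def PolyNet {Z : Type*} [PseudoMetricSpace Z] (S : Set Z) : Prop :=
  ∃ (C : ℝ) (k : ℕ), 0 < C ∧ ∀ n : ℕ, 1 ≤ n → ∃ T : Finset Z, (T : Set Z) ⊆ S ∧
    (T.card : ℝ) ≤ C * n ^ k ∧ ∀ z ∈ S, ∃ t ∈ T, dist z t ≤ 1 / n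

/-- Cut the coordinate box into cubes of side 1/(A n) and choose one point of S from each cube that
S meets. The net thus stays inside S, where the estimates are available. -/
lemma polyNet_of_coords {Z : Type*} [PseudoMetricSpace Z] {S : Set Z} {d : ℕ} (ι : Z → Fin d → ℝ)
    (A B : ℕ) (hA : 1 ≤ A) (hι : ∀ z ∈ S, ∀ z' ∈ S, ∀ ε > 0, (∀ j, |ι z j - ι z' j| ≤ ε) → dist z z' ≤ A * ε)
    (hB : ∀ z ∈ S, ∀ j, |ι z j| ≤ B) : PolyNet S := by
  classical
  refine ⟨(2 * (A * B) + 3 : ℝ) ^ d, d, by positivity, fun n hn => ?_⟩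
  set N : ℕ := A * n with hN
  have hNp : (0 : ℝ) < N := by
    have : 0 < N := Nat.mul_pos hA hn
    exact_mod_cast this
  set q : Z → Fin d → ℤ := fun z j => ⌊N * ι z j⌋ with hq
  set cells : Finset (Fin d → ℤ) :=
    Fintype.piFinset fun _ => Finset.Icc (-((N * B : ℕ) : ℤ) - 1) ((N * B : ℕ) + 1) with hcells
  have hqc : ∀ z ∈ S, q z ∈ cells := fun z hz => by
    rw [hcells, Fintype.mem_piFinset]
    intro j
    have h1 := abs_le.1 (hB z hz j)
    have hlo : -((N * B : ℕ) : ℝ) ≤ N * ι z j := by push_cast; nlinarith [h1.1]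
    have hhi : N * ι z j ≤ ((N * B : ℕ) : ℝ) := by push_cast; nlinarith [h1.2]
    rw [Finset.mem_Icc]
    constructor
    · have : -((N * B : ℕ) : ℤ) ≤ ⌊N * ι z j⌋ := Int.le_floor.2 (by push_cast at hlo ⊢; exact hlo)
      simp only [hq]; omega
    · have h2 : ((⌊N * ι z j⌋ : ℤ) : ℝ) ≤ ((N * B : ℕ) : ℝ) := (Int.floor_le _).trans hhi
      have h3 : ⌊N * ι z j⌋ ≤ ((N * B : ℕ) : ℤ) := by exact_mod_cast h2
      simp only [hq]; omega
  set good := cells.filter fun c => ∃ z ∈ S, q z = c with hgood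
  have hch : ∀ c : good, ∃ z ∈ S, q z = c.1 := fun c => (Finset.mem_filter.1 c.2).2
  choose rep hrepS hrepq using hch
  refine ⟨Finset.univ.image rep, ?_, ?_, fun z hz => ?_⟩
  · intro z hz
    simp only [Finset.coe_image, Finset.coe_univ, Set.image_univ, Set.mem_range] at hz
    obtain ⟨c, rfl⟩ := hz
    exact hrepS c
  · have h1 : (Finset.univ.image rep).card ≤ cells.card := by
      refine Finset.card_image_le.trans ?_
      rw [Finset.card_univ, Fintype.card_coe]
      exact Finset.card_filter_le _ _
    have h2 : cells.card = (2 * (N * B) + 3) ^ d := by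
      rw [hcells, Fintype.card_piFinset, Finset.prod_const, Int.card_Icc, Finset.card_univ,
        Fintype.card_fin]
      congr 1
      omega
    have h3 : ((Finset.univ.image rep).card : ℝ) ≤ ((2 * (N * B) + 3) ^ d : ℕ) := by
      rw [← h2]; exact_mod_cast h1
    refine h3.trans ?_
    push_cast
    rw [← mul_pow]
    have hn' : (1 : ℝ) ≤ n := by exact_mod_cast hn
    refine pow_le_pow_left₀ (by positivity) ?_ d
    rw [hN]; push_cast
    nlinarith
  · have hz' : q z ∈ good := Finset.mem_filter.2 ⟨hqc z hz, z, hz, rfl⟩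
    refine ⟨rep ⟨q z, hz'⟩, Finset.mem_image_of_mem _ (Finset.mem_univ _), ?_⟩
    have hqq := hrepq ⟨q z, hz'⟩
    have h1 := hι z hz _ (hrepS ⟨q z, hz'⟩) (1 / N) (by positivity) fun j => by
      have hj : ⌊N * ι (rep ⟨q z, hz'⟩) j⌋ = ⌊N * ι z j⌋ := congrFun hqq j
      have := Int.abs_sub_lt_one_of_floor_eq_floor hj
      rw [← mul_sub, abs_mul, abs_of_pos hNp] at this
      rw [abs_sub_comm, le_div_iff₀ hNp]
      linarith
    refine h1.trans_eq ?_
    rw [hN]; push_cast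
    have : (A : ℝ) ≠ 0 := by positivity
    field_simp

/-- Passing to a net point at distance 1/n changes each summand by at most Λ/n, hence the sum and n
times the mean by at most Λ each. This is the 2 Λ. -/
lemma measure_exists_lt_le {Z : Type*} [PseudoMetricSpace Z] {S : Set Z}
    (hX : ∀ i, Measurable (X i)) (hind : iIndepFun X P)
    (hlaw : ∀ i, P.map (X i) = μ) {F : Z → E → ℝ} {b v l Λ : ℝ}
    (hF : ∀ z ∈ S, Measurable (F z))
    (hb : ∀ z ∈ S, ∀ x, |F z x| ≤ b) (hv : ∀ z ∈ S, ∫ x, F z x ^ 2 ∂μ ≤ v)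
    (hΛ : ∀ z ∈ S, ∀ z' ∈ S, ∀ x, |F z x - F z' x| ≤ Λ * dist z z') (hΛ0 : 0 ≤ Λ)
    (hl : 0 ≤ l) (hlb : l * (2 * b) ≤ 1) {n : ℕ} (hn : 1 ≤ n) {T : Finset Z}
    (hT : (T : Set Z) ⊆ S) (hnet : ∀ z ∈ S, ∃ t ∈ T, dist z t ≤ 1 / n) (s : ℝ) :
    P {ω | ∃ z ∈ S, s + 2 * Λ < |∑ i ∈ Finset.range n, F z (X i ω) - n * ∫ y, F z y ∂μ|} ≤
      ENNReal.ofReal (T.card * (2 * Real.exp (n * (l ^ 2 * v) - l * s))) := by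
  have hn0 : (0 : ℝ) < n := by exact_mod_cast hn
  have hsub : {ω | ∃ z ∈ S, s + 2 * Λ < |∑ i ∈ Finset.range n, F z (X i ω) - n * ∫ y, F z y ∂μ|} ⊆
      ⋃ t ∈ T, {ω | s ≤ |∑ i ∈ Finset.range n, F t (X i ω) - n * ∫ y, F t y ∂μ|} := by
    rintro ω ⟨z, hz, hlt⟩
    obtain ⟨t, ht, hd⟩ := hnet z hz
    refine Set.mem_biUnion ht ?_
    have htS := hT ht
    have hpt : ∀ x, |F z x - F t x| ≤ Λ * (1 / n) := fun x =>
      (hΛ z hz t htS x).trans (by gcongr)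
    have h1 : |∑ i ∈ Finset.range n, F z (X i ω) - ∑ i ∈ Finset.range n, F t (X i ω)| ≤ Λ := by
      rw [← Finset.sum_sub_distrib]
      refine (Finset.abs_sum_le_sum_abs _ _).trans ?_
      refine (Finset.sum_le_sum fun i _ => hpt (X i ω)).trans_eq ?_
      rw [Finset.sum_const, Finset.card_range, nsmul_eq_mul]; field_simp
    have h2 : |n * ∫ y, F z y ∂μ - n * ∫ y, F t y ∂μ| ≤ Λ := by
      rw [← mul_sub, ← integral_sub (integrable_of_abs_le (hF z hz) (hb z hz))
        (integrable_of_abs_le (hF t htS) (hb t htS)), abs_mul, abs_of_pos hn0]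
      calc n * |∫ y, (F z y - F t y) ∂μ| ≤ n * (Λ * (1 / n)) := by
            gcongr; exact abs_integral_le_of_abs_le hpt
        _ = Λ := by field_simp
    have h3 : |∑ i ∈ Finset.range n, F z (X i ω) - n * ∫ y, F z y ∂μ| ≤
        |∑ i ∈ Finset.range n, F t (X i ω) - n * ∫ y, F t y ∂μ| + 2 * Λ := by
      have e : ∑ i ∈ Finset.range n, F z (X i ω) - n * ∫ y, F z y ∂μ =
          (∑ i ∈ Finset.range n, F t (X i ω) - n * ∫ y, F t y ∂μ) +
          ((∑ i ∈ Finset.range n, F z (X i ω) - ∑ i ∈ Finset.range n, F t (X i ω)) -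
            (n * ∫ y, F z y ∂μ - n * ∫ y, F t y ∂μ)) := by ring
      rw [e]
      refine (abs_add_le _ _).trans ?_
      have := abs_sub (∑ i ∈ Finset.range n, F z (X i ω) - ∑ i ∈ Finset.range n, F t (X i ω))
        (n * ∫ y, F z y ∂μ - n * ∫ y, F t y ∂μ)
      linarith
    change s ≤ _
    linarith
  have hreal : P.real (⋃ t ∈ T, {ω | s ≤ |∑ i ∈ Finset.range n, F t (X i ω) -
      n * ∫ y, F t y ∂μ|}) ≤ T.card * (2 * Real.exp (n * (l ^ 2 * v) - l * s)) := by
    refine (measureReal_biUnion_finset_le _ _).trans ?_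
    refine (Finset.sum_le_sum fun t ht => measureReal_abs_sum_ge_le hX hind hlaw (hF t (hT ht))
      (hb t (hT ht)) (hv t (hT ht)) hl hlb n s).trans_eq ?_
    rw [Finset.sum_const, nsmul_eq_mul]
  refine (measure_mono hsub).trans ?_
  rw [← ENNReal.ofReal_toReal (measure_ne_top P _)]
  exact ENNReal.ofReal_le_ofReal hreal

/-- Uniform deviation inequality, in asymptotic form. -/
theorem tendsto_measure_exists_lt {Z : Type*} [PseudoMetricSpace Z] {S : Set Z} (hS : PolyNet S)
    (hX : ∀ i, Measurable (X i)) (hind : iIndepFun X P)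
    (hlaw : ∀ i, P.map (X i) = μ) {F : ℕ → Z → E → ℝ} {b v Λ ρ : ℕ → ℝ} {A : ℝ} (hA : 0 ≤ A)
    (hF : ∀ᶠ n in atTop, ∀ z ∈ S, Measurable (F n z))
    (hb : ∀ᶠ n in atTop, ∀ z ∈ S, ∀ x, |F n z x| ≤ b n)
    (hv : ∀ᶠ n in atTop, ∀ z ∈ S, ∫ x, F n z x ^ 2 ∂μ ≤ v n)
    (hΛ : ∀ᶠ n in atTop, ∀ z ∈ S, ∀ z' ∈ S, ∀ x, |F n z x - F n z' x| ≤ Λ n * dist z z')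
    (hΛ0 : ∀ᶠ n in atTop, 0 ≤ Λ n)
    (hρ : ∀ᶠ n in atTop, 0 < ρ n) (hbρ : ∀ᶠ n : ℕ in atTop, 2 * b n * Real.log n ≤ ρ n)
    (hvρ : ∀ᶠ n : ℕ in atTop, n * v n * Real.log n ≤ A * ρ n ^ 2)
    (hΛρ : ∀ᶠ n in atTop, Λ n ≤ A * ρ n) :
    ∃ M₀ > 0, ∀ M ≥ M₀, Tendsto (fun n : ℕ => P {ω | ∃ z ∈ S,
      M * ρ n < |∑ i ∈ Finset.range n, F n z (X i ω) - n * ∫ y, F n z y ∂μ|}) atTop (𝓝 0) := by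
  obtain ⟨C, k, hC, hnet⟩ := hS
  -- With l = log n / ρ, discretization costs 2A, the variance term costs A, and k + 1 compensates
  -- for the n^k net points with a factor 1/n to spare.
  refine ⟨3 * A + k + 1, by positivity, fun M hM => ?_⟩
  have hbound : ∀ᶠ n : ℕ in atTop, P {ω | ∃ z ∈ S,
      M * ρ n < |∑ i ∈ Finset.range n, F n z (X i ω) - n * ∫ y, F n z y ∂μ|} ≤
      ENNReal.ofReal (2 * C * (1 / n)) := by
    filter_upwards [hF, hb, hv, hΛ, hΛ0, hρ, hbρ, hvρ, hΛρ, eventually_ge_atTop 1]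
      with n hF hb hv hΛ hΛ0 hρ hbρ hvρ hΛρ hn
    obtain ⟨T, hTS, hcard, hT⟩ := hnet n hn
    have hn0 : (0 : ℝ) < n := by exact_mod_cast hn
    have hlog : 0 ≤ Real.log n := Real.log_nonneg (by exact_mod_cast hn)
    set l := Real.log n / ρ n with hl
    have hl0 : 0 ≤ l := by positivity
    have hlρ : l * ρ n = Real.log n := by rw [hl]; field_simp
    have h1 := measure_exists_lt_le hX hind hlaw hF hb hv hΛ hΛ0 hl0 (by
      rw [hl, div_mul_eq_mul_div, div_le_one hρ]; linarith) hn hTS hT ((M - 2 * A) * ρ n)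
    refine (measure_mono ?_).trans (h1.trans (ENNReal.ofReal_le_ofReal ?_))
    · rintro ω ⟨z, hz, hlt⟩
      exact ⟨z, hz, lt_of_le_of_lt (by linarith) hlt⟩
    · have h2 : n * (l ^ 2 * v n) ≤ A * Real.log n := by
        have : n * (l ^ 2 * v n) = (n * v n * Real.log n) * (Real.log n / ρ n ^ 2) := by
          rw [hl]; field_simp
        rw [this]
        calc (n * v n * Real.log n) * (Real.log n / ρ n ^ 2)
            ≤ (A * ρ n ^ 2) * (Real.log n / ρ n ^ 2) := by gcongr
          _ = A * Real.log n := by field_simp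
      have h3 : l * ((M - 2 * A) * ρ n) = (M - 2 * A) * Real.log n := by
        rw [← hlρ]; ring
      have h4 : n * (l ^ 2 * v n) - l * ((M - 2 * A) * ρ n) ≤ -((k : ℝ) + 1) * Real.log n := by
        rw [h3]
        nlinarith
      have h5 : Real.exp (n * (l ^ 2 * v n) - l * ((M - 2 * A) * ρ n)) ≤ 1 / (n : ℝ) ^ (k + 1) := by
        refine (Real.exp_le_exp.2 h4).trans_eq ?_
        rw [neg_mul, Real.exp_neg, one_div]
        congr 1
        rw [← Nat.cast_succ, Real.exp_nat_mul, Real.exp_log hn0]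
      calc (T.card : ℝ) * (2 * Real.exp (n * (l ^ 2 * v n) - l * ((M - 2 * A) * ρ n)))
          ≤ (C * n ^ k) * (2 * (1 / (n : ℝ) ^ (k + 1))) := by gcongr
        _ = 2 * C * (1 / n) := by field_simp; ring
  refine tendsto_of_tendsto_of_tendsto_of_le_of_le' tendsto_const_nhds ?_
    (Eventually.of_forall fun _ => zero_le) hbound
  have : Tendsto (fun n : ℕ => 2 * C * (1 / (n : ℝ))) atTop (𝓝 (2 * C * 0)) :=
    tendsto_one_div_atTop_nhds_zero_nat.const_mul _
  rw [mul_zero] at this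
  simpa using ENNReal.tendsto_ofReal this

end Deviation

/-! ### Convolution with the kernel -/

lemma KernelAssumptions.tame {K : Plane → ℝ} (hK : KernelAssumptions K) : TameDeriv 4 K :=
  tameDeriv_of_iteratedFDeriv hK.differentiable hK.bounded

lemma hasCompactSupport_of_ball {φ : Plane → ℝ} (h : ∀ z, 1 < ‖z‖ → φ z = 0) :
    HasCompactSupport φ :=
  HasCompactSupport.intro (isCompact_closedBall (0 : Plane) 1) fun z hz => h z (by
    simpa using hz)

lemma KernelAssumptions.pd_eq_zero {K : Plane → ℝ} (hK : KernelAssumptions K) (l : List (Fin 2)) :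
    ∀ z : Plane, 1 < ‖z‖ → pd l K z = 0 := by
  induction l with
  | nil =>
    intro z hz
    have : z ∉ tsupport K := by rw [hK.support_eq]; simpa using hz
    exact image_eq_zero_of_notMem_tsupport this
  | cons i l ih =>
    intro z hz
    have he : pd l K =ᶠ[𝓝 z] fun _ => 0 := by
      have hopen : IsOpen {z : Plane | 1 < ‖z‖} := isOpen_lt continuous_const continuous_norm
      filter_upwards [hopen.mem_nhds hz] with w hw
      exact ih w hw
    rw [pd_cons, partialDeriv, he.fderiv_eq]
    simp

lemma KernelAssumptions.exists_bound {K : Plane → ℝ} (hK : KernelAssumptions K) :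
    ∃ B : ℝ, 0 < B ∧ (∀ l : List (Fin 2), 1 ≤ l.length → l.length ≤ 3 → ∀ z, |pd l K z| ≤ B) ∧
      ∀ l : List (Fin 2), l.length ≤ 3 → ∀ x y, |pd l K x - pd l K y| ≤ B * ‖x - y‖ := by
  obtain ⟨B, hB, h1⟩ := hK.tame.exists_bdd
  obtain ⟨B', hB', h2⟩ := hK.tame.lipschitz
  refine ⟨max B B', lt_max_of_lt_left hB, fun l hl hl' z => ?_, fun l hl x y => ?_⟩
  · exact (h1 l hl (by omega) z).trans (le_max_left _ _)
  · exact (h2 l (by omega) x y).trans (by gcongr; exact le_max_right _ _)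

/-- The average of `g` around `x` at scale `h` with weight `φ`. -/
def conv (φ g : Plane → ℝ) (h : ℝ) (x : Plane) : ℝ := ∫ z, φ z * g (x - h • z)

lemma integral_scaled (φ g : Plane → ℝ) {h : ℝ} (hh : 0 < h) (x : Plane) :
    ∫ ξ, φ (h⁻¹ • (x - ξ)) * g ξ = h ^ 2 * conv φ g h x := by
  have h1 : ∫ ξ, φ (h⁻¹ • (x - ξ)) * g ξ = ∫ u, φ (h⁻¹ • u) * g (x - u) := by
    rw [← integral_sub_left_eq_self (fun u => φ (h⁻¹ • u) * g (x - u)) volume x]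
    simp
  have h2 : (fun u => φ (h⁻¹ • u) * g (x - u)) =
      fun u => (fun z => φ z * g (x - h • z)) (h⁻¹ • u) := by
    ext u
    simp [smul_smul, hh.ne']
  rw [h1, h2, Measure.integral_comp_smul volume (fun z => φ z * g (x - h • z)) h⁻¹]
  simp only [finrank_euclideanSpace, Fintype.card_fin, inv_pow, inv_inv, smul_eq_mul, conv]
  rw [abs_of_pos (by positivity)]

/-- Integration by parts moves the derivative from the weight to g. The inner derivative -h of z ↦ x
- h z supplies the factor h, and the two signs cancel. -/
lemma conv_partialDeriv {φ g : Plane → ℝ} (hφ : ∀ z, 1 < ‖z‖ → φ z = 0) (i : Fin 2)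
    (hφd : Differentiable ℝ φ) (hφc : Continuous (partialDeriv i φ)) (hg : Differentiable ℝ g)
    (hgc : Continuous (partialDeriv i g)) (h : ℝ) (x : Plane) :
    conv (partialDeriv i φ) g h x = h * conv φ (partialDeriv i g) h x := by
  have hφ' : ∀ z, 1 < ‖z‖ → partialDeriv i φ z = 0 := fun z hz => by
    have he : φ =ᶠ[𝓝 z] fun _ => 0 := by
      have hopen : IsOpen {z : Plane | 1 < ‖z‖} := isOpen_lt continuous_const continuous_norm
      filter_upwards [hopen.mem_nhds hz] with w hw
      exact hφ w hw
    rw [partialDeriv, he.fderiv_eq]; simp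
  set G : Plane → ℝ := fun z => g (x - h • z) with hG
  have hGd : ∀ z, HasFDerivAt G ((fderiv ℝ g (x - h • z)).comp (-(h • ContinuousLinearMap.id ℝ Plane))) z := by
    intro z
    refine (hg (x - h • z)).hasFDerivAt.comp z ?_
    exact ((h • ContinuousLinearMap.id ℝ Plane).hasFDerivAt).const_sub x
  have hGi : ∀ z, fderiv ℝ G z (EuclideanSpace.single i 1) = -(h * partialDeriv i g (x - h • z)) := by
    intro z
    rw [(hGd z).fderiv]
    simp [partialDeriv]
  have hGc : Continuous G := by
    have := hg.continuous
    fun_prop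
  have c1 : Continuous fun z => partialDeriv i g (x - h • z) := by fun_prop
  have key := integral_mul_fderiv_eq_neg_fderiv_mul_of_integrable (μ := (volume : Measure Plane))
    (f := G) (g := φ) (v := EuclideanSpace.single i 1) ?_ ?_ ?_
    (fun z _ => (hGd z).differentiableAt) (fun z _ => hφd z)
  · rw [conv, conv, ← integral_const_mul]
    calc ∫ z, partialDeriv i φ z * g (x - h • z) =
        ∫ z, G z * fderiv ℝ φ z (EuclideanSpace.single i 1) := by
          congr 1; ext z; rw [mul_comm]; rfl
      _ = -∫ z, fderiv ℝ G z (EuclideanSpace.single i 1) * φ z := key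
      _ = _ := by
          rw [← integral_neg]
          congr 1; ext z; rw [hGi]; ring
  · simp_rw [hGi]
    exact Continuous.integrable_of_hasCompactSupport (by have := hφd.continuous; fun_prop)
      (hasCompactSupport_of_ball fun z hz => by rw [hφ z hz, mul_zero])
  · exact Continuous.integrable_of_hasCompactSupport (hGc.mul hφc)
      (hasCompactSupport_of_ball fun z hz => by
        have := hφ' z hz
        rw [partialDeriv] at this
        rw [this, mul_zero])
  · exact Continuous.integrable_of_hasCompactSupport (hGc.mul hφd.continuous)
      (hasCompactSupport_of_ball fun z hz => by rw [hφ z hz, mul_zero])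

lemma KernelAssumptions.continuous_pd {K : Plane → ℝ} (hK : KernelAssumptions K)
    {l : List (Fin 2)} (hl : l.length ≤ 3) : Continuous (pd l K) :=
  hK.tame.continuous (by omega)

/-- Derivatives are removed from the head of the list, so they reach f in reversed order.
`partialDeriv_comm` restores the order where it matters. -/
lemma KernelAssumptions.conv_pd {K f : Plane → ℝ} (hK : KernelAssumptions K) (hf : TameDeriv 4 f)
    (h : ℝ) (x : Plane) (l : List (Fin 2)) : ∀ (l' : List (Fin 2)), l.length + l'.length ≤ 3 →
    conv (pd l K) (pd l' f) h x = h ^ l.length * conv K (pd (l.reverse ++ l') f) h x := by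
  induction l with
  | nil => intro l' _; simp
  | cons i l ih =>
    intro l' hl
    rw [List.length_cons] at hl
    have h1 := conv_partialDeriv (φ := pd l K) (g := pd l' f) (hK.pd_eq_zero l) i
      (hK.tame.diff l (by omega)) (hK.continuous_pd (l := i :: l) (by rw [List.length_cons]; omega))
      (hf.diff l' (by omega)) (hf.continuous (l := i :: l') (by rw [List.length_cons]; omega)) h x
    rw [pd_cons, h1, ← pd_cons, ih (i :: l') (by rw [List.length_cons]; omega), List.length_cons,
      List.reverse_cons, List.append_assoc, List.singleton_append]
    ring

lemma abs_taylor_le {g : Plane → ℝ} {C : ℝ} (hg : Differentiable ℝ g)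
    (hg' : ∀ i, Differentiable ℝ (partialDeriv i g))
    (hC : ∀ i j, ∀ x, |partialDeriv j (partialDeriv i g) x| ≤ C) (x v : Plane) :
    |g (x + v) - g x - fderiv ℝ g x v| ≤ 4 * C * ‖v‖ ^ 2 := by
  have hC0 : 0 ≤ C := (abs_nonneg _).trans (hC 0 0 0)
  have hL : ∀ i y, |partialDeriv i g y - partialDeriv i g x| ≤ 2 * C * ‖y - x‖ := fun i y =>
    abs_sub_le_of_partialDeriv_le (hg' i) convex_univ (fun j z _ => hC i j z) trivial trivial
  have hbound : ∀ y ∈ Metric.closedBall x ‖v‖, ‖fderiv ℝ g y - fderiv ℝ g x‖ ≤ 4 * C * ‖v‖ := by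
    intro y hy
    rw [Metric.mem_closedBall, dist_eq_norm] at hy
    refine ContinuousLinearMap.opNorm_le_bound _ (by positivity) fun w => ?_
    rw [_root_.sub_apply, fderiv_apply_eq, fderiv_apply_eq, Real.norm_eq_abs]
    have e : w 0 * partialDeriv 0 g y + w 1 * partialDeriv 1 g y -
        (w 0 * partialDeriv 0 g x + w 1 * partialDeriv 1 g x) =
        w 0 * (partialDeriv 0 g y - partialDeriv 0 g x) +
        w 1 * (partialDeriv 1 g y - partialDeriv 1 g x) := by ring
    rw [e]
    refine (abs_add_le _ _).trans ?_
    rw [abs_mul, abs_mul]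
    have h2 : 2 * C * ‖y - x‖ ≤ 2 * C * ‖v‖ := by gcongr
    have h3 : |w 0| * |partialDeriv 0 g y - partialDeriv 0 g x| ≤ ‖w‖ * (2 * C * ‖v‖) :=
      mul_le_mul (abs_apply_le_norm w 0) ((hL 0 y).trans h2) (abs_nonneg _) (norm_nonneg _)
    have h4 : |w 1| * |partialDeriv 1 g y - partialDeriv 1 g x| ≤ ‖w‖ * (2 * C * ‖v‖) :=
      mul_le_mul (abs_apply_le_norm w 1) ((hL 1 y).trans h2) (abs_nonneg _) (norm_nonneg _)
    linarith
  have := (convex_closedBall x ‖v‖).norm_image_sub_le_of_norm_fderiv_le' (𝕜 := ℝ)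
    (fun y _ => hg y) hbound (Metric.mem_closedBall_self (norm_nonneg v))
    (show x + v ∈ Metric.closedBall x ‖v‖ by simp)
  rw [add_sub_cancel_left, Real.norm_eq_abs] at this
  refine this.trans_eq (by ring)

lemma KernelAssumptions.integrable_mul {K : Plane → ℝ} (hK : KernelAssumptions K) {u : Plane → ℝ}
    (hu : Continuous u) : Integrable fun z => K z * u z :=
  Continuous.integrable_of_hasCompactSupport
    ((hK.continuous_pd (l := []) (by simp)).mul hu)
    (hasCompactSupport_of_ball fun z hz => by
      have := hK.pd_eq_zero [] z hz
      rw [pd_nil] at this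
      rw [this, zero_mul])

/-- Averages against the kernel are bounded by bounds on the unit ball. -/
lemma KernelAssumptions.abs_integral_le {K : Plane → ℝ} (hK : KernelAssumptions K) {u : Plane → ℝ}
    (hu : Continuous u) {C : ℝ} (hC : ∀ z, ‖z‖ ≤ 1 → |u z| ≤ C) : |∫ z, K z * u z| ≤ C := by
  have hKi : Integrable K := by simpa using hK.integrable_mul (u := fun _ => 1) continuous_const
  calc |∫ z, K z * u z| ≤ ∫ z, |K z * u z| := abs_integral_le_integral_abs
    _ ≤ ∫ z, K z * C := by
      refine integral_mono (hK.integrable_mul hu).abs (hKi.mul_const C) fun z => ?_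
      simp only [abs_mul, abs_of_nonneg (hK.nonneg z)]
      rcases le_or_gt ‖z‖ 1 with h | h
      · exact mul_le_mul_of_nonneg_left (hC z h) (hK.nonneg z)
      · have := hK.pd_eq_zero [] z h
        rw [pd_nil] at this
        simp [this]
    _ = C := by rw [integral_mul_const, hK.integral_one, one_mul]

/-- Symmetry of the kernel kills the linear Taylor term, so the smoothing error is of second order
in h. -/
lemma KernelAssumptions.abs_conv_sub_le {K g : Plane → ℝ} (hK : KernelAssumptions K) {C : ℝ}
    (hg : Differentiable ℝ g) (hg' : ∀ i, Differentiable ℝ (partialDeriv i g))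
    (hC : ∀ i j, ∀ x, |partialDeriv j (partialDeriv i g) x| ≤ C) (h : ℝ) (x : Plane) :
    |conv K g h x - g x| ≤ 4 * C * h ^ 2 := by
  have hC0 : 0 ≤ C := (abs_nonneg _).trans (hC 0 0 0)
  have hodd : ∫ z, K z * fderiv ℝ g x (-(h • z)) = 0 := by
    have h1 := integral_neg_eq_self (fun z => K z * fderiv ℝ g x (-(h • z))) volume
    have h2 : (fun z => K (-z) * fderiv ℝ g x (-(h • -z))) =
        fun z => -(K z * fderiv ℝ g x (-(h • z))) := by
      ext z; rw [hK.symmetric]; simp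
    rw [h2, integral_neg] at h1
    linarith
  have hgc := hg.continuous
  have c1 : Continuous fun z => g (x - h • z) := by fun_prop
  have c2 : Continuous fun z : Plane => fderiv ℝ g x (-(h • z)) := by fun_prop
  have e : conv K g h x - g x =
      ∫ z, K z * (g (x - h • z) - g x - fderiv ℝ g x (-(h • z))) := by
    have h1 : ∫ z, K z * g x = g x := by rw [integral_mul_const, hK.integral_one, one_mul]
    have i1 := hK.integrable_mul c1
    have i2 := hK.integrable_mul (u := fun _ => g x) continuous_const
    have i3 := hK.integrable_mul c2
    have h3 : (fun z => K z * (g (x - h • z) - g x - fderiv ℝ g x (-(h • z)))) =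
        fun z => K z * g (x - h • z) - K z * g x - K z * fderiv ℝ g x (-(h • z)) := by
      ext z; ring
    have i4 : Integrable fun z => K z * g (x - h • z) - K z * g x := i1.sub i2
    rw [h3, integral_sub i4 i3, integral_sub i1 i2, hodd, h1, conv, sub_zero]
  rw [e]
  refine hK.abs_integral_le (by fun_prop) fun z hz => ?_
  have := abs_taylor_le hg hg' hC x (-(h • z))
  rw [← sub_eq_add_neg, norm_neg, norm_smul, mul_pow, Real.norm_eq_abs, sq_abs] at this
  refine this.trans ?_
  have hz2 : ‖z‖ ^ 2 ≤ 1 := by nlinarith [norm_nonneg z]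
  have : 0 ≤ 4 * C * h ^ 2 := by positivity
  nlinarith

/-! ### Derivatives of the kernel estimate -/

/-- The contribution of an observation `ξ` to a derivative of the kernel estimate at `y`. -/
def kernTerm (K : Plane → ℝ) (l : List (Fin 2)) (h : ℝ) (n : ℕ) (y ξ : Plane) : ℝ :=
  1 / (n * h ^ 2) * ((h⁻¹) ^ l.length * pd l K (h⁻¹ • (y - ξ)))

lemma partialDeriv_sum_comp {φ : Plane → ℝ} (hφ : Differentiable ℝ φ) (c d k : ℝ) (n : ℕ)
    (x : ℕ → Plane) (i : Fin 2) :
    partialDeriv i (fun y => ∑ j ∈ Finset.range n, c * (d * φ (k • (y - x j)))) =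
      fun y => ∑ j ∈ Finset.range n, c * (d * k * partialDeriv i φ (k • (y - x j))) := by
  ext y
  have h1 : ∀ j, HasFDerivAt (fun y => c * (d * φ (k • (y - x j))))
      (c • (d • ((fderiv ℝ φ (k • (y - x j))).comp (k • ContinuousLinearMap.id ℝ Plane)))) y := by
    intro j
    have h2 : HasFDerivAt (fun y => k • (y - x j)) (k • ContinuousLinearMap.id ℝ Plane) y :=
      ((hasFDerivAt_id y).sub_const (x j)).const_smul k
    exact ((((hφ _).hasFDerivAt).comp y h2).const_mul d).const_mul c
  have h3 := HasFDerivAt.fun_sum (u := Finset.range n) fun j _ => h1 j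
  rw [partialDeriv, h3.fderiv, _root_.sum_apply]
  refine Finset.sum_congr rfl fun j _ => ?_
  simp only [_root_.smul_apply, ContinuousLinearMap.comp_apply, ContinuousLinearMap.id_apply,
    smul_eq_mul, map_smul, partialDeriv]
  ring

lemma KernelAssumptions.pd_kde {K : Plane → ℝ} (hK : KernelAssumptions K) (h : ℝ) (n : ℕ)
    (x : ℕ → Plane) (l : List (Fin 2)) (hl : l.length ≤ 4) :
    pd l (kde K h n x) = fun y => ∑ i ∈ Finset.range n, kernTerm K l h n y (x i) := by
  induction l with
  | nil => ext y; simp [kde, kernTerm, Finset.mul_sum]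
  | cons i l ih =>
    rw [List.length_cons] at hl
    rw [pd_cons, ih (by omega)]
    unfold kernTerm
    rw [partialDeriv_sum_comp (hK.tame.diff l (by omega))]
    simp only [List.length_cons, pow_succ, pd_cons]

lemma KernelAssumptions.tame_kde {K : Plane → ℝ} (hK : KernelAssumptions K) (h : ℝ) (n : ℕ)
    (x : ℕ → Plane) : TameDeriv 3 (kde K h n x) := by
  refine ⟨fun l hl => ?_, fun l h1 hl => ?_⟩
  · rw [hK.pd_kde h n x l (by omega)]
    unfold kernTerm
    have := hK.tame.diff l (by omega)
    fun_prop
  · obtain ⟨B, hB, hb, -⟩ := hK.exists_bound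
    rw [hK.pd_kde h n x l (by omega)]
    refine ⟨∑ i ∈ Finset.range n, |1 / (n * h ^ 2)| * (|(h⁻¹) ^ l.length| * B), fun y => ?_⟩
    refine (Finset.abs_sum_le_sum_abs _ _).trans (Finset.sum_le_sum fun i _ => ?_)
    rw [kernTerm, abs_mul, abs_mul]
    gcongr
    exact hb l h1 (by omega) _

/-! ### Moments of the kernel terms -/

/-- The distribution with density `f`. -/
def densityMeasure (f : Plane → ℝ) : Measure Plane :=
  volume.withDensity fun x => ENNReal.ofReal (f x)

lemma DensityAssumptions.continuous {f : Plane → ℝ} (hf : DensityAssumptions f) : Continuous f :=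
  hf.smooth.continuous

lemma integral_densityMeasure {f : Plane → ℝ} (hf : DensityAssumptions f) (F : Plane → ℝ) :
    ∫ x, F x ∂(densityMeasure f) = ∫ x, F x * f x := by
  rw [densityMeasure, integral_withDensity_eq_integral_toReal_smul
    (by have := hf.continuous.measurable; fun_prop) (by simp)]
  congr 1; ext x
  rw [ENNReal.toReal_ofReal (hf.nonneg x), smul_eq_mul, mul_comm]

lemma IsSample.isProbabilityMeasure {Ω : Type*} [MeasurableSpace Ω] {P : Measure Ω}
    [IsProbabilityMeasure P] {f : Plane → ℝ} {X : ℕ → Ω → Plane} (hX : IsSample P f X) :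
    IsProbabilityMeasure (densityMeasure f) := by
  have := Measure.isProbabilityMeasure_map (μ := P) (hX.measurable 0).aemeasurable
  rwa [hX.law 0] at this

/-- The normalization cancels h² from the change of variables and one factor h for each derivative
moved to f, so no negative power of h survives in the mean. -/
lemma integral_kernTerm {K f : Plane → ℝ} (hK : KernelAssumptions K) (hf : DensityAssumptions f)
    {l : List (Fin 2)} (hl : l.length ≤ 3) {h : ℝ} (hh : 0 < h) {n : ℕ} (hn : 1 ≤ n) (y : Plane) :
    n * ∫ ξ, kernTerm K l h n y ξ ∂(densityMeasure f) = conv K (pd l.reverse f) h y := by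
  have hn0 : (0 : ℝ) < n := by exact_mod_cast hn
  rw [integral_densityMeasure hf]
  have e : (fun ξ => kernTerm K l h n y ξ * f ξ) =
      fun ξ => (1 / (n * h ^ 2) * (h⁻¹) ^ l.length) * (pd l K (h⁻¹ • (y - ξ)) * f ξ) := by
    ext ξ; rw [kernTerm]; ring
  have h2 := hK.conv_pd hf.tame h y l [] (by simpa using hl)
  rw [pd_nil, List.append_nil] at h2
  rw [e, integral_const_mul, integral_scaled _ _ hh, h2, inv_pow]
  field_simp

/-- The factor h² is the area scale of the rescaled support. The bound on f comes from compactness,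
as the assumptions bound only its derivatives; hence the restriction to a ball. -/
lemma exists_integral_scaled_le {f : Plane → ℝ} (hf : DensityAssumptions f) (R : ℝ) :
    ∃ C : ℝ, 0 < C ∧ ∀ (ψ : Plane → ℝ) (B : ℝ), Continuous ψ → (∀ z, 1 < ‖z‖ → ψ z = 0) →
      (∀ z, |ψ z| ≤ B) → ∀ y ∈ Metric.closedBall (0 : Plane) R, ∀ h : ℝ, 0 < h → h ≤ 1 →
      |∫ ξ, ψ (h⁻¹ • (y - ξ)) ∂(densityMeasure f)| ≤ C * B * h ^ 2 := by
  obtain ⟨Mf, hMf⟩ := (isCompact_closedBall (0 : Plane) (R + 1)).exists_bound_of_continuousOn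
    hf.continuous.continuousOn
  set v := (volume : Measure Plane).real (Metric.closedBall 0 1) with hv
  have hvn : 0 ≤ v := measureReal_nonneg
  refine ⟨(|Mf| + 1) * (v + 1), by positivity, fun ψ B hψ hψ0 hB y hy h hh hh1 => ?_⟩
  have hB0 : 0 ≤ B := (abs_nonneg _).trans (hB 0)
  rw [integral_densityMeasure hf, integral_scaled _ _ hh, abs_mul, abs_of_pos (by positivity),
    mul_comm]
  refine mul_le_mul_of_nonneg_right ?_ (by positivity)
  have hset : conv ψ f h y = ∫ z in Metric.closedBall (0 : Plane) 1, ψ z * f (y - h • z) := by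
    rw [conv, setIntegral_eq_integral_of_forall_compl_eq_zero]
    intro z hz
    rw [hψ0 z (by simpa using hz), zero_mul]
  rw [hset]
  have hb := norm_setIntegral_le_of_norm_le_const (μ := (volume : Measure Plane))
    (s := Metric.closedBall (0 : Plane) 1) (f := fun z => ψ z * f (y - h • z))
    (C := B * (|Mf| + 1)) (isCompact_closedBall _ _).measure_lt_top (fun z hz => ?_)
  · rw [Real.norm_eq_abs, ← hv] at hb
    refine hb.trans ?_
    have : 0 ≤ B * (|Mf| + 1) := by positivity
    nlinarith
  · rw [norm_mul]
    have h1 : ‖f (y - h • z)‖ ≤ |Mf| + 1 := by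
      refine (hMf _ ?_).trans (by linarith [le_abs_self Mf])
      rw [mem_closedBall_zero_iff] at hz hy ⊢
      have := norm_sub_le y (h • z)
      rw [norm_smul, Real.norm_eq_abs, abs_of_pos hh] at this
      nlinarith [norm_nonneg z]
    exact mul_le_mul (hB z) h1 (norm_nonneg _) hB0

section KernTerm

variable {K f : Plane → ℝ} {B : ℝ} {l : List (Fin 2)} {h : ℝ} {n : ℕ}

lemma abs_kernTerm_le (hB : ∀ z, |pd l K z| ≤ B) (hh : 0 < h) (hn : 1 ≤ n) (y ξ : Plane) :
    |kernTerm K l h n y ξ| ≤ B / (n * h ^ (2 + l.length)) := by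
  have hn0 : (0 : ℝ) < n := by exact_mod_cast hn
  rw [kernTerm, abs_mul, abs_mul, abs_of_pos (by positivity), abs_of_pos (by positivity)]
  calc 1 / (n * h ^ 2) * ((h⁻¹) ^ l.length * |pd l K (h⁻¹ • (y - ξ))|)
      ≤ 1 / (n * h ^ 2) * ((h⁻¹) ^ l.length * B) := by gcongr; exact hB _
    _ = _ := by rw [inv_pow]; field_simp; ring

lemma abs_kernTerm_sub_le (hB : ∀ z w, |pd l K z - pd l K w| ≤ B * ‖z - w‖) (hh : 0 < h)
    (hn : 1 ≤ n) (y y' ξ ξ' : Plane) :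
    |kernTerm K l h n y ξ - kernTerm K l h n y' ξ'| ≤
      B / (n * h ^ (3 + l.length)) * ‖(y - ξ) - (y' - ξ')‖ := by
  have hn0 : (0 : ℝ) < n := by exact_mod_cast hn
  rw [kernTerm, kernTerm, ← mul_sub, ← mul_sub, abs_mul, abs_mul, abs_of_pos (by positivity),
    abs_of_pos (by positivity)]
  have := hB (h⁻¹ • (y - ξ)) (h⁻¹ • (y' - ξ'))
  rw [← smul_sub, norm_smul, Real.norm_eq_abs, abs_of_pos (by positivity : 0 < h⁻¹)] at this
  calc 1 / (n * h ^ 2) * ((h⁻¹) ^ l.length *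
        |pd l K (h⁻¹ • (y - ξ)) - pd l K (h⁻¹ • (y' - ξ'))|)
      ≤ 1 / (n * h ^ 2) * ((h⁻¹) ^ l.length * (B * (h⁻¹ * ‖(y - ξ) - (y' - ξ')‖))) := by gcongr
    _ = _ := by rw [inv_pow]; field_simp; ring

lemma continuous_kernTerm (hK : KernelAssumptions K) (hl : l.length ≤ 3) :
    Continuous fun p : Plane × Plane => kernTerm K l h n p.1 p.2 := by
  have := hK.continuous_pd hl
  unfold kernTerm
  fun_prop

lemma kernTerm_eq_zero (hK : KernelAssumptions K) (hh : 0 < h) {y ξ : Plane} (hy : h < ‖y - ξ‖) :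
    kernTerm K l h n y ξ = 0 := by
  rw [kernTerm, hK.pd_eq_zero, mul_zero, mul_zero]
  rw [norm_smul, Real.norm_eq_abs, abs_of_pos (by positivity), inv_mul_eq_div, one_lt_div hh]
  exact hy

/-- The second moment serves the pointwise deviations, the first absolute moment the deviations of
line integrals. -/
lemma exists_integral_kernTerm_sq_le (hK : KernelAssumptions K) (hf : DensityAssumptions f)
    (R : ℝ) :
    ∃ C : ℝ, 0 < C ∧ ∀ l : List (Fin 2), 1 ≤ l.length → l.length ≤ 3 → ∀ (h : ℝ) (n : ℕ),
      0 < h → h ≤ 1 → 1 ≤ n → ∀ y ∈ Metric.closedBall (0 : Plane) R,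
      ∫ ξ, kernTerm K l h n y ξ ^ 2 ∂(densityMeasure f) ≤ C / (n ^ 2 * h ^ (2 + 2 * l.length)) ∧
      ∫ ξ, |kernTerm K l h n y ξ| ∂(densityMeasure f) ≤ C / (n * h ^ l.length) := by
  obtain ⟨C, hC, hint⟩ := exists_integral_scaled_le hf R
  obtain ⟨B, hB, hb, -⟩ := hK.exists_bound
  refine ⟨C * B ^ 2 + C * B, by positivity, fun l h1 hl h n hh hh1 hn y hy => ⟨?_, ?_⟩⟩
  · have hn0 : (0 : ℝ) < n := by exact_mod_cast hn
    have h2 := hint (fun z => pd l K z ^ 2) (B ^ 2) ((hK.continuous_pd hl).pow 2)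
      (fun z hz => by rw [hK.pd_eq_zero l z hz]; norm_num)
      (fun z => by rw [abs_pow]; exact pow_le_pow_left₀ (abs_nonneg _) (hb l h1 hl z) 2) y hy h hh hh1
    have e : (fun ξ => kernTerm K l h n y ξ ^ 2) = fun ξ =>
        (1 / (n * h ^ 2) * (h⁻¹) ^ l.length) ^ 2 * pd l K (h⁻¹ • (y - ξ)) ^ 2 := by
      ext ξ; rw [kernTerm]; ring
    rw [e, integral_const_mul]
    calc (1 / (n * h ^ 2) * (h⁻¹) ^ l.length) ^ 2 *
          ∫ ξ, pd l K (h⁻¹ • (y - ξ)) ^ 2 ∂(densityMeasure f)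
        ≤ (1 / (n * h ^ 2) * (h⁻¹) ^ l.length) ^ 2 * (C * B ^ 2 * h ^ 2) := by
          gcongr; exact (le_abs_self _).trans h2
      _ = C * B ^ 2 / (n ^ 2 * h ^ (2 + 2 * l.length)) := by
          rw [inv_pow]; field_simp
          ring
      _ ≤ _ := by gcongr; linarith [mul_pos hC hB]
  · have hn0 : (0 : ℝ) < n := by exact_mod_cast hn
    have h2 := hint (fun z => |pd l K z|) B ((hK.continuous_pd hl).abs)
      (fun z hz => by rw [hK.pd_eq_zero l z hz, abs_zero])
      (fun z => by rw [abs_abs]; exact hb l h1 hl z) y hy h hh hh1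
    have e : (fun ξ => |kernTerm K l h n y ξ|) = fun ξ =>
        (1 / (n * h ^ 2) * (h⁻¹) ^ l.length) * |pd l K (h⁻¹ • (y - ξ))| := by
      ext ξ
      rw [kernTerm, abs_mul, abs_mul, abs_of_pos (by positivity : 0 < 1 / (n * h ^ 2)),
        abs_of_pos (by positivity : 0 < (h⁻¹) ^ l.length)]; ring
    rw [e, integral_const_mul]
    calc (1 / (n * h ^ 2) * (h⁻¹) ^ l.length) *
          ∫ ξ, |pd l K (h⁻¹ • (y - ξ))| ∂(densityMeasure f)
        ≤ (1 / (n * h ^ 2) * (h⁻¹) ^ l.length) * (C * B * h ^ 2) := by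
          gcongr; exact (le_abs_self _).trans h2
      _ = C * B / (n * h ^ l.length) := by
          rw [inv_pow]; field_simp
      _ ≤ _ := by gcongr; linarith [mul_pos hC (pow_pos hB 2)]

end KernTerm

/-- The bias is of second order. -/
lemma exists_bias_le {K f : Plane → ℝ} (hK : KernelAssumptions K) (hf : DensityAssumptions f) :
    ∃ C : ℝ, 0 < C ∧ ∀ l : List (Fin 2), l.length ≤ 2 → ∀ (h : ℝ) (y : Plane),
      |conv K (pd l f) h y - pd l f y| ≤ C * h ^ 2 := by
  obtain ⟨C, hC, hb⟩ := hf.tame.exists_bdd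
  refine ⟨4 * C, by positivity, fun l hl h y => ?_⟩
  exact hK.abs_conv_sub_le (hf.tame.diff l (by omega))
    (fun i => hf.tame.diff (i :: l) (by rw [List.length_cons]; omega))
    (fun i j x => hb (j :: i :: l) (by simp) (by simp only [List.length_cons]; omega) x) h y

/-- Third derivatives of the estimate need only stay bounded. A second-order bias bound for them
would require five derivatives of f. -/
lemma exists_conv_le {K f : Plane → ℝ} (hK : KernelAssumptions K) (hf : DensityAssumptions f) :
    ∃ C : ℝ, 0 < C ∧ ∀ l : List (Fin 2), 1 ≤ l.length → l.length ≤ 3 → ∀ (h : ℝ) (y : Plane),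
      |conv K (pd l f) h y| ≤ C := by
  obtain ⟨C, hC, hb⟩ := hf.tame.exists_bdd
  refine ⟨C, hC, fun l h1 hl h y => ?_⟩
  have hc := hf.tame.continuous (l := l) (by omega)
  exact hK.abs_integral_le (by fun_prop) fun z _ => hb l h1 (by omega) _

lemma partialDeriv_comm {g : Plane → ℝ} (hg : ContDiff ℝ 2 g) (i j : Fin 2) :
    partialDeriv i (partialDeriv j g) = partialDeriv j (partialDeriv i g) := by
  ext x
  have hd : DifferentiableAt ℝ (fderiv ℝ g) x :=
    (hg.fderiv_right (m := 1) (by norm_num)).differentiable (by norm_num) x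
  have key : ∀ i j : Fin 2, partialDeriv i (partialDeriv j g) x =
      fderiv ℝ (fderiv ℝ g) x (EuclideanSpace.single i 1) (EuclideanSpace.single j 1) := by
    intro i j
    have h1 : HasFDerivAt (partialDeriv j g)
        ((ContinuousLinearMap.apply ℝ ℝ (EuclideanSpace.single j (1 : ℝ) : Plane)).comp
          (fderiv ℝ (fderiv ℝ g) x)) x :=
      (ContinuousLinearMap.apply ℝ ℝ (EuclideanSpace.single j (1 : ℝ) : Plane)).hasFDerivAt.comp x
        hd.hasFDerivAt
    rw [partialDeriv, h1.fderiv]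
    rfl
  rw [key, key]
  exact (hg.contDiffAt.isSymmSndFDerivAt (by simp)) _ _

/-! ### Rates -/

/-- The rate of convergence. -/
def rate (h : ℕ → ℝ) (n : ℕ) : ℝ := Real.log n / (n * h n ^ 7)

section Rates

variable {h : ℕ → ℝ}

lemma BandwidthAssumptions.eventually_basic (hh : BandwidthAssumptions h) :
    ∃ C : ℝ, 0 < C ∧ ∀ᶠ n : ℕ in atTop, 1 ≤ n ∧ h n ≤ 1 ∧ 1 ≤ Real.log n ∧ n * h n ^ 9 ≤ C := by
  obtain ⟨β, hβ, hlim⟩ := hh.not_too_large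
  refine ⟨β + 1, by positivity, ?_⟩
  filter_upwards [eventually_ge_atTop 1, hh.tendsto_zero.eventually (eventually_le_nhds zero_lt_one),
    (Real.tendsto_log_atTop.comp tendsto_natCast_atTop_atTop).eventually_ge_atTop 1,
    hlim.eventually (eventually_le_nhds (lt_add_one β))] with n h1 h2 h3 h4
  exact ⟨h1, h2, h3, h4⟩

lemma BandwidthAssumptions.eventually_le_mul (hh : BandwidthAssumptions h) (c : ℝ) :
    ∀ᶠ n : ℕ in atTop, c * Real.log n ^ 3 ≤ n * h n ^ 8 := by
  obtain ⟨_, _, hb⟩ := hh.eventually_basic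
  filter_upwards [hb, hh.not_too_small.eventually_ge_atTop c] with n ⟨_, _, h3, _⟩ h5
  rwa [le_div_iff₀ (by positivity)] at h5

/-- The facts on the bandwidth that enter the estimates, for constants `c` and `C`. -/
structure GoodBandwidth (c C : ℝ) (n : ℕ) (h : ℝ) : Prop where
  one_le : 1 ≤ n
  pos : 0 < h
  le_one : h ≤ 1
  one_le_log : 1 ≤ Real.log n
  upper : n * h ^ 9 ≤ C
  lower : c * Real.log n ^ 3 ≤ n * h ^ 8
  small : c * h ≤ 1

lemma BandwidthAssumptions.eventually_good (hh : BandwidthAssumptions h) :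
    ∃ C : ℝ, 0 < C ∧ ∀ c : ℝ, ∀ᶠ n : ℕ in atTop, GoodBandwidth c C n (h n) := by
  obtain ⟨C, hC, hb⟩ := hh.eventually_basic
  refine ⟨C, hC, fun c => ?_⟩
  have h0 : Tendsto (fun n => c * h n) atTop (𝓝 0) := by simpa using hh.tendsto_zero.const_mul c
  filter_upwards [hb, hh.eventually_le_mul c, h0.eventually (eventually_le_nhds zero_lt_one)]
    with n ⟨h1, h2, h3, h4⟩ h5 h6
  exact ⟨h1, hh.pos n, h2, h3, h4, h5, h6⟩

lemma GoodBandwidth.lower_pow {c C h : ℝ} {n : ℕ} (hg : GoodBandwidth c C n h) (hc : 0 ≤ c) {k : ℕ}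
    (hk : k ≤ 8) : c * Real.log n ≤ n * h ^ k := by
  have h1 : h ^ 8 ≤ h ^ k := pow_le_pow_of_le_one hg.pos.le hg.le_one hk
  have h2 : Real.log n ≤ Real.log n ^ 3 := le_self_pow₀ hg.one_le_log (by norm_num)
  calc c * Real.log n ≤ c * Real.log n ^ 3 := by gcongr
    _ ≤ n * h ^ 8 := hg.lower
    _ ≤ n * h ^ k := by gcongr

lemma GoodBandwidth.pos_mul {c C h : ℝ} {n : ℕ} (hg : GoodBandwidth c C n h) (k : ℕ) :
    0 < n * h ^ k :=
  mul_pos (by exact_mod_cast hg.one_le) (pow_pos hg.pos k)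

lemma GoodBandwidth.rate_pos {c C : ℝ} {n : ℕ} (hg : GoodBandwidth c C n (h n)) : 0 < rate h n :=
  div_pos (by linarith [hg.one_le_log]) (hg.pos_mul 7)

/-- Bias against rate: h² · n h⁷ = n h⁹ is bounded, while log n ≥ 1. -/
lemma GoodBandwidth.sq_le_rate {c C : ℝ} {n : ℕ} (hC : 0 ≤ C) (hg : GoodBandwidth c C n (h n)) :
    h n ^ 2 ≤ C * rate h n := by
  rw [rate, ← mul_div_assoc, le_div_iff₀ (hg.pos_mul 7)]
  have := hg.upper
  have h3 : C ≤ C * Real.log n := le_mul_of_one_le_right hC hg.one_le_log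
  calc h n ^ 2 * (n * h n ^ 7) = n * h n ^ 9 := by ring
    _ ≤ _ := this.trans h3

lemma GoodBandwidth.rate_le {c C : ℝ} {n : ℕ} (hc : 1 ≤ c) (hg : GoodBandwidth c C n (h n)) :
    rate h n ≤ h n := by
  rw [rate, div_le_iff₀ (hg.pos_mul 7)]
  have := hg.lower_pow (by linarith) (le_refl 8)
  have h0 := hg.one_le_log
  calc Real.log n ≤ c * Real.log n := le_mul_of_one_le_left (by linarith) hc
    _ ≤ n * h n ^ 8 := this
    _ = h n * (n * h n ^ 7) := by ring

lemma BandwidthAssumptions.tendsto_rate (hh : BandwidthAssumptions h) :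
    Tendsto (rate h) atTop (𝓝 0) := by
  obtain ⟨C, hC, hg⟩ := hh.eventually_good
  refine tendsto_of_tendsto_of_tendsto_of_le_of_le' tendsto_const_nhds hh.tendsto_zero ?_ ?_
  · filter_upwards [hg 1] with n hn using hn.rate_pos.le
  · filter_upwards [hg 1] with n hn using hn.rate_le le_rfl

variable {n : ℕ} {B C : ℝ}

lemma GoodBandwidth.two_mul_le_rate (hg : GoodBandwidth (2 * B) C n (h n)) :
    2 * (B / (n * h n ^ 3)) * Real.log n ≤ rate h n := by
  have h1 := hg.pos_mul 3
  have hl : 0 ≤ Real.log n := by linarith [hg.one_le_log]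
  have hp := hg.pos
  have e : 2 * (B / (n * h n ^ 3)) * Real.log n =
      (2 * B * h n) * h n ^ 3 * (Real.log n / (n * h n ^ 7)) := by
    have : (n : ℝ) ≠ 0 := by have := hg.one_le; positivity
    field_simp
  have h2 := hg.small
  have h3 : h n ^ 3 ≤ 1 := pow_le_one₀ hp.le hg.le_one
  rw [e, rate]
  refine mul_le_of_le_one_left (div_nonneg hl (hg.pos_mul 7).le) ?_
  have : 0 ≤ h n ^ 3 := by positivity
  nlinarith

/-- log n / (n h⁵) is n h⁹ · log n / (n² h¹⁴), and n h⁹ is bounded. Exponent 5 is the one that line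
integrals of second derivatives attain. -/
lemma GoodBandwidth.variance_le_rate {D : ℝ} (hD : 0 ≤ D) (hC : 0 ≤ C) {c : ℝ} {k : ℕ} (hk : k ≤ 5)
    (hg : GoodBandwidth c C n (h n)) :
    n * (D / (n ^ 2 * h n ^ k)) * Real.log n ≤ (D * C) * rate h n ^ 2 := by
  have hp := hg.pos
  have hl := hg.one_le_log
  have hn : (0 : ℝ) < n := by have := hg.one_le; positivity
  have h1 : h n ^ 5 ≤ h n ^ k := pow_le_pow_of_le_one hp.le hg.le_one hk
  calc n * (D / (n ^ 2 * h n ^ k)) * Real.log n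
      ≤ n * (D / (n ^ 2 * h n ^ 5)) * Real.log n := by gcongr
    _ = D * (n * h n ^ 9) * 1 * (Real.log n / (n ^ 2 * h n ^ 14)) := by field_simp
    _ ≤ D * C * Real.log n * (Real.log n / (n ^ 2 * h n ^ 14)) := by
        gcongr; exact hg.upper
    _ = (D * C) * rate h n ^ 2 := by rw [rate]; field_simp

lemma GoodBandwidth.lipschitz_le_rate {D c : ℝ} (hD : 0 ≤ D) {k : ℕ} (hk : k ≤ 7)
    (hg : GoodBandwidth c C n (h n)) : D / (n * h n ^ k) ≤ D * rate h n := by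
  have hp := hg.pos
  have hl := hg.one_le_log
  have hn : (0 : ℝ) < n := by have := hg.one_le; positivity
  have h1 : h n ^ 7 ≤ h n ^ k := pow_le_pow_of_le_one hp.le hg.le_one hk
  calc D / (n * h n ^ k) = D * (1 / (n * h n ^ k)) := by ring
    _ ≤ D * (Real.log n / (n * h n ^ 7)) := by gcongr

lemma GoodBandwidth.two_mul_le_sqrt_rate (hg : GoodBandwidth (4 * B ^ 2) C n (h n)) :
    2 * (B / (n * h n ^ 4)) * Real.log n ≤ √(rate h n) := by
  have hp := hg.pos
  have hl := hg.one_le_log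
  have hn : (0 : ℝ) < n := by have := hg.one_le; positivity
  apply Real.le_sqrt_of_sq_le
  have h1 := hg.lower_pow (by positivity) (show 1 ≤ 8 by norm_num)
  calc (2 * (B / (n * h n ^ 4)) * Real.log n) ^ 2
      = (4 * B ^ 2 * Real.log n) * (Real.log n / (n ^ 2 * h n ^ 8)) := by field_simp; ring
    _ ≤ (n * h n ^ 1) * (Real.log n / (n ^ 2 * h n ^ 8)) := by gcongr
    _ = rate h n := by rw [rate]; field_simp

/-- Exponent 6 belongs to second derivatives at a point: log n / (n h⁶) is h times the rate, so the
deviations match its square root. -/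
lemma GoodBandwidth.variance_le_sqrt_rate {D c : ℝ} (hD : 0 ≤ D)
    (hg : GoodBandwidth c C n (h n)) :
    n * (D / (n ^ 2 * h n ^ 6)) * Real.log n ≤ D * √(rate h n) ^ 2 := by
  have hp := hg.pos
  have hl := hg.one_le_log
  have hn : (0 : ℝ) < n := by have := hg.one_le; positivity
  rw [Real.sq_sqrt hg.rate_pos.le]
  calc n * (D / (n ^ 2 * h n ^ 6)) * Real.log n
      = D * h n * (Real.log n / (n * h n ^ 7)) := by field_simp
    _ ≤ D * 1 * (Real.log n / (n * h n ^ 7)) := by gcongr; exact hg.le_one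
    _ = _ := by rw [rate, mul_one]

lemma GoodBandwidth.lipschitz_le_sqrt_rate {D c : ℝ} (hc : 1 ≤ c) (hD : 0 ≤ D)
    (hg : GoodBandwidth c C n (h n)) : D / (n * h n ^ 5) ≤ D * √(rate h n) := by
  have hp := hg.pos
  have hl := hg.one_le_log
  have hn : (0 : ℝ) < n := by have := hg.one_le; positivity
  rw [div_eq_mul_one_div]
  gcongr
  apply Real.le_sqrt_of_sq_le
  have h1 : 1 ≤ n * h n ^ 3 := by
    have := hg.lower_pow (by linarith) (show 3 ≤ 8 by norm_num)
    nlinarith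
  have e : (1 / (n * h n ^ 5)) ^ 2 = 1 * (1 / (n ^ 2 * h n ^ 10)) := by field_simp
  calc (1 / (n * h n ^ 5)) ^ 2 = 1 * (1 / (n ^ 2 * h n ^ 10)) := e
    _ ≤ (n * h n ^ 3) * (Real.log n / (n ^ 2 * h n ^ 10)) := by gcongr
    _ = rate h n := by rw [rate]; field_simp

lemma GoodBandwidth.two_mul_le_one (hB : 0 ≤ B) (hg : GoodBandwidth (2 * B) C n (h n)) :
    2 * (B / (n * h n ^ 5)) * Real.log n ≤ 1 := by
  have h1 := hg.lower_pow (by positivity) (show 5 ≤ 8 by norm_num)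
  have e : 2 * (B / (n * h n ^ 5)) * Real.log n = 2 * B * Real.log n / (n * h n ^ 5) := by ring
  rw [e, div_le_one (hg.pos_mul 5)]
  exact h1

/-- Exponent 8 belongs to third derivatives, which stay bounded because n h⁸ dominates log n. -/
lemma GoodBandwidth.variance_le_one {D c : ℝ} (hc : 1 ≤ c) (hD : 0 ≤ D)
    (hg : GoodBandwidth c C n (h n)) :
    n * (D / (n ^ 2 * h n ^ 8)) * Real.log n ≤ D * 1 ^ 2 := by
  have hp := hg.pos
  have hl := hg.one_le_log
  have hn : (0 : ℝ) < n := by have := hg.one_le; positivity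
  have h1 := hg.lower_pow (by positivity) (le_refl 8)
  have e : n * (D / (n ^ 2 * h n ^ 8)) * Real.log n = D * (Real.log n / (n * h n ^ 8)) := by
    field_simp
  rw [e, one_pow]
  gcongr
  rw [div_le_one (hg.pos_mul 8)]
  nlinarith

lemma GoodBandwidth.lipschitz_le_one {D c : ℝ} (hc : 1 ≤ c) (hD : 0 ≤ D)
    (hg : GoodBandwidth c C n (h n)) : D / (n * h n ^ 6) ≤ D * 1 := by
  have hl := hg.one_le_log
  have h1 := hg.lower_pow (by positivity) (show 6 ≤ 8 by norm_num)
  rw [div_eq_mul_one_div]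
  gcongr
  rw [div_le_one (hg.pos_mul 6)]
  nlinarith

end Rates

/-! ### Uniform deviations of the derivatives of the estimate -/

lemma polyNet_closedBall (R : ℝ) : PolyNet (Metric.closedBall (0 : Plane) R) := by
  refine polyNet_of_coords (d := 2) (fun z j => z j) 2 ⌈R⌉₊ (by norm_num) ?_ ?_
  · intro z _ z' _ ε _ hj
    rw [dist_eq_norm]
    have := norm_le_abs_add_abs (z - z')
    have h0 := hj 0
    have h1 := hj 1
    simp only [PiLp.sub_apply] at this
    push_cast
    linarith
  · intro z hz j
    rw [mem_closedBall_zero_iff] at hz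
    exact (abs_apply_le_norm z j).trans (hz.trans (Nat.le_ceil R))

section Deviations

variable {Ω : Type*} [MeasurableSpace Ω] {P : Measure Ω} [IsProbabilityMeasure P]
  {f K : Plane → ℝ} {h : ℕ → ℝ} {X : ℕ → Ω → Plane}

/-- The scale ρ is left open because derivatives of orders one, two and three are compared with the
rate, its square root and 1. -/
lemma exists_tendsto_pd_fHat (hf : DensityAssumptions f) (hK : KernelAssumptions K)
    (hX : IsSample P f X) (hh : BandwidthAssumptions h) (R : ℝ) {l : List (Fin 2)}
    (h1 : 1 ≤ l.length) (hl : l.length ≤ 3) {ρ : ℕ → ℝ} (hρ : ∀ᶠ n in atTop, 0 < ρ n)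
    (hb : ∀ B : ℝ, 0 < B → ∀ᶠ n : ℕ in atTop,
      2 * (B / (n * h n ^ (2 + l.length))) * Real.log n ≤ ρ n)
    (hv : ∀ B : ℝ, 0 < B → ∃ A : ℝ, 0 ≤ A ∧ ∀ᶠ n : ℕ in atTop,
      n * (B / (n ^ 2 * h n ^ (2 + 2 * l.length))) * Real.log n ≤ A * ρ n ^ 2)
    (hΛ : ∀ B : ℝ, 0 < B → ∃ A : ℝ, 0 ≤ A ∧ ∀ᶠ n : ℕ in atTop,
      B / (n * h n ^ (3 + l.length)) ≤ A * ρ n) :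
    ∃ M₀ > 0, ∀ M ≥ M₀, Tendsto (fun n : ℕ => P {ω | ∃ y ∈ Metric.closedBall (0 : Plane) R,
      M * ρ n < |pd l (fHat K h X n ω) y - conv K (pd l.reverse f) (h n) y|}) atTop (𝓝 0) := by
  obtain ⟨B, hB, hbB, hlip⟩ := hK.exists_bound
  obtain ⟨D, hD, hmom⟩ := exists_integral_kernTerm_sq_le hK hf R
  obtain ⟨A₁, hA₁, hv⟩ := hv D hD
  obtain ⟨A₂, hA₂, hΛ⟩ := hΛ B hB
  obtain ⟨C, hC, hgood⟩ := hh.eventually_good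
  have := hX.isProbabilityMeasure
  obtain ⟨M₀, hM₀, key⟩ := tendsto_measure_exists_lt (P := P) (X := X) (μ := densityMeasure f)
    (polyNet_closedBall R) hX.measurable hX.indep hX.law
    (F := fun n y ξ => kernTerm K l (h n) n y ξ) (b := fun n => B / (n * h n ^ (2 + l.length)))
    (v := fun n => D / (n ^ 2 * h n ^ (2 + 2 * l.length)))
    (Λ := fun n => B / (n * h n ^ (3 + l.length))) (ρ := ρ) (A := A₁ + A₂) (by positivity)
    (Eventually.of_forall fun n y _ => by
      have := continuous_kernTerm hK hl (h := h n) (n := n)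
      have : Continuous fun ξ => kernTerm K l (h n) n y ξ := by fun_prop
      exact this.measurable)
    ((hgood 1).mono fun n hn y _ ξ => abs_kernTerm_le (hbB l h1 hl) hn.pos hn.one_le y ξ)
    ((hgood 1).mono fun n hn y hy => (hmom l h1 hl _ _ hn.pos hn.le_one hn.one_le y hy).1)
    ((hgood 1).mono fun n hn y _ y' _ ξ => by
      have := abs_kernTerm_sub_le (hlip l hl) hn.pos hn.one_le y y' ξ ξ
      rwa [sub_sub_sub_cancel_right, ← dist_eq_norm] at this)
    ((hgood 1).mono fun n hn => (div_pos hB (hn.pos_mul _)).le) hρ (hb B hB)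
    (by filter_upwards [hv, hρ] with n h1 h2
        have : 0 ≤ A₂ * ρ n ^ 2 := by positivity
        linarith)
    (by filter_upwards [hΛ, hρ] with n h1 h2
        have : 0 ≤ A₁ * ρ n := by positivity
        linarith)
  refine ⟨M₀, hM₀, fun M hM => (key M hM).congr' ?_⟩
  filter_upwards [hgood 1] with n hn
  congr 1; ext ω
  simp only [Set.mem_ofPred_eq]
  refine exists_congr fun y => and_congr_right fun _ => ?_
  rw [integral_kernTerm hK hf hl hn.pos hn.one_le, fHat, hK.pd_kde _ _ _ _ (by omega)]

end Deviations

/-! ### Deviations of integrals along trajectories -/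

/-- Once g is nonzero at some time, its support lies in the window of length 2 d centred there. -/
lemma abs_intervalIntegral_le_of_localized {g : ℝ → ℝ} {s b d : ℝ} (hd : 0 ≤ d)
    (hb : ∀ t ∈ Set.uIoc 0 s, |g t| ≤ b) (hb0 : 0 ≤ b)
    (hloc : ∀ t ∈ Set.uIoc 0 s, ∀ t' ∈ Set.uIoc 0 s, g t ≠ 0 → g t' ≠ 0 → |t - t'| ≤ d) :
    |∫ t in (0 : ℝ)..s, g t| ≤ b * (2 * d) := by
  rw [intervalIntegral.abs_integral_eq_abs_integral_uIoc]
  by_cases h : ∃ t₀ ∈ Set.uIoc 0 s, g t₀ ≠ 0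
  · obtain ⟨t₀, ht₀, hg₀⟩ := h
    rw [setIntegral_eq_of_subset_of_forall_sdiff_eq_zero (s := Set.uIoc 0 s ∩ Set.Icc (t₀ - d) (t₀ + d))
      measurableSet_uIoc Set.inter_subset_left]
    · have hvol : volume (Set.Icc (t₀ - d) (t₀ + d)) ≠ ⊤ := by simp
      refine (norm_setIntegral_le_of_norm_le_const (f := g)
        (measure_lt_top_mono Set.inter_subset_right hvol.lt_top) (C := b)
        fun t ht => hb t ht.1).trans ?_
      gcongr
      refine (measureReal_mono Set.inter_subset_right hvol).trans_eq ?_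
      rw [Real.volume_real_Icc_of_le (by linarith)]
      ring
    · rintro t ⟨ht, htn⟩
      by_contra hgt
      refine htn ⟨ht, ?_⟩
      have := abs_le.1 (hloc t ht t₀ ht₀ hgt hg₀)
      exact ⟨by linarith [this.1], by linarith [this.2]⟩
  · push Not at h
    rw [setIntegral_eq_zero_of_forall_eq_zero h, abs_zero]
    positivity

/-- The contribution of an observation `ξ` to the weighted integral of a derivative of the kernel
estimate along the trajectory from `z.1` up to the time `z.2`. -/
def lineTerm (f K w : Plane → ℝ) (l : List (Fin 2)) (h : ℝ) (n : ℕ) (z : Plane × ℝ) (ξ : Plane) :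
    ℝ :=
  ∫ t in (0 : ℝ)..z.2, w (curve f z.1 t) * kernTerm K l h n (curve f z.1 t) ξ

section Line

variable {Ω : Type*} [MeasurableSpace Ω] {P : Measure Ω} [IsProbabilityMeasure P]
  {f K : Plane → ℝ} {H L : Set Plane} {a : ℝ} {w : Plane → ℝ} {l : List (Fin 2)} {h : ℝ} {n : ℕ}
  {B : ℝ}

lemma continuous_lineIntegrand (hf : DensityAssumptions f) (hK : KernelAssumptions K)
    (hl : l.length ≤ 3) (hw : Continuous w) (y : Plane) :
    Continuous fun p : ℝ × Plane => w (curve f y p.1) * kernTerm K l h n (curve f y p.1) p.2 := by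
  have h1 := continuous_kernTerm hK hl (h := h) (n := n)
  have h2 := hf.tame3.curve_continuous y
  have h3 : Continuous fun p : ℝ × Plane => kernTerm K l h n (curve f y p.1) p.2 :=
    h1.comp (f := fun p : ℝ × Plane => (curve f y p.1, p.2)) (by fun_prop)
  fun_prop

lemma continuous_lineTerm (hf : DensityAssumptions f) (hK : KernelAssumptions K)
    (hl : l.length ≤ 3) (hw : Continuous w) (z : Plane × ℝ) :
    Continuous (lineTerm f K w l h n z) := by
  refine intervalIntegral.continuous_parametric_intervalIntegral_of_continuous' ?_ _ _
  exact (continuous_lineIntegrand hf hK hl hw z.1).comp continuous_swap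

lemma abs_lineIntegrand_le (hB : ∀ z, |pd l K z| ≤ B) (hh : 0 < h) (hn : 1 ≤ n)
    (hw : ∀ x, |w x| ≤ 1) (x ξ : Plane) :
    |w x * kernTerm K l h n x ξ| ≤ B / (n * h ^ (2 + l.length)) := by
  rw [abs_mul]
  have := abs_kernTerm_le hB hh hn x ξ
  nlinarith [hw x, abs_nonneg (w x), abs_nonneg (kernTerm K l h n x ξ)]

/-- By the mean speed condition, two times at which the trajectory is within h of ξ differ by at
most 2 h / γ. Integration therefore gains a factor h over the pointwise bound on `kernTerm`. -/
lemma abs_lineTerm_le (hL : FilamentAssumptions f H L a) (hf : DensityAssumptions f)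
    (hK : KernelAssumptions K)
    {γ : ℝ} (hγ : 0 < γ) (hspeed : ∀ x₀ ∈ L, ∀ s u : ℝ, -a ≤ s → s < u → u ≤ a →
      γ ≤ ‖(u - s)⁻¹ • ∫ t in s..u, V f (curve f x₀ t)‖)
    (hB : ∀ z, |pd l K z| ≤ B) (hh : 0 < h) (hn : 1 ≤ n) (hw : ∀ x, |w x| ≤ 1)
    {z : Plane × ℝ} (hz : z ∈ L ×ˢ Set.Icc (-a) a) (ξ : Plane) :
    |lineTerm f K w l h n z ξ| ≤ (4 * B / γ) / (n * h ^ (1 + l.length)) := by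
  obtain ⟨hy, hs⟩ := hz
  have hB0 : 0 ≤ B := (abs_nonneg _).trans (hB 0)
  have hn0 : (0 : ℝ) < n := by exact_mod_cast hn
  have hdist : ∀ s u : ℝ, -a ≤ s → s < u → u ≤ a →
      γ * (u - s) ≤ ‖curve f z.1 u - curve f z.1 s‖ := by
    intro s u h1 h2 h3
    have hder : ∀ t ∈ Set.uIcc s u, HasDerivAt (curve f z.1) (V f (curve f z.1 t)) t :=
      fun t _ => (hf.tame3.curve_spec z.1).2 t
    have hcont : Continuous fun t => V f (curve f z.1 t) :=
      hf.tame3.V_continuous.comp (hf.tame3.curve_continuous z.1)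
    have := hspeed z.1 hy s u h1 h2 h3
    rw [intervalIntegral.integral_eq_sub_of_hasDerivAt hder (hcont.intervalIntegrable _ _),
      norm_smul, norm_inv, Real.norm_eq_abs, abs_of_pos (by linarith), inv_mul_eq_div,
      le_div_iff₀ (by linarith)] at this
    exact this
  have hIoc : ∀ t ∈ Set.uIoc 0 z.2, t ∈ Set.Icc (-a) a := by
    intro t ht
    rw [Set.mem_uIoc] at ht
    have := hL.a_pos
    rcases ht with ht | ht
    · exact ⟨by linarith [ht.1], by linarith [ht.2, hs.2]⟩
    · exact ⟨by linarith [ht.1, hs.1], by linarith [ht.2]⟩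
  have hnear : ∀ t, w (curve f z.1 t) * kernTerm K l h n (curve f z.1 t) ξ ≠ 0 →
      ‖curve f z.1 t - ξ‖ ≤ h := by
    intro t ht
    by_contra hn
    push Not at hn
    exact ht (by rw [kernTerm_eq_zero hK hh hn, mul_zero])
  have key := abs_intervalIntegral_le_of_localized
    (g := fun t => w (curve f z.1 t) * kernTerm K l h n (curve f z.1 t) ξ) (s := z.2)
    (b := B / (n * h ^ (2 + l.length))) (d := 2 * h / γ) (by positivity)
    (fun t _ => abs_lineIntegrand_le hB hh hn hw _ ξ) (by positivity) ?_
  · refine key.trans_eq ?_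
    field_simp
    ring
  · have hlt : ∀ t ∈ Set.uIoc 0 z.2, ∀ t' ∈ Set.uIoc 0 z.2, t < t' →
        w (curve f z.1 t) * kernTerm K l h n (curve f z.1 t) ξ ≠ 0 →
        w (curve f z.1 t') * kernTerm K l h n (curve f z.1 t') ξ ≠ 0 → t' - t ≤ 2 * h / γ := by
      intro t ht t' ht' htt h1 h2
      have h3 := hdist t t' (hIoc t ht).1 htt (hIoc t' ht').2
      have h4 := norm_sub_le (curve f z.1 t' - ξ) (curve f z.1 t - ξ)
      rw [sub_sub_sub_cancel_right] at h4
      rw [le_div_iff₀ hγ]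
      linarith [hnear t h1, hnear t' h2]
    intro t ht t' ht' h1 h2
    rcases lt_trichotomy t t' with h3 | h3 | h3
    · rw [abs_sub_comm, abs_of_pos (by linarith)]
      exact hlt t ht t' ht' h3 h1 h2
    · rw [h3, sub_self, abs_zero]; positivity
    · rw [abs_of_pos (by linarith)]
      exact hlt t' ht' t ht h3 h2 h1

lemma abs_lineTerm_sub_le (hL : FilamentAssumptions f H L a) (hf : DensityAssumptions f)
    (hK : KernelAssumptions K) (hl : l.length ≤ 3)
    {E : ℝ} (hE : 0 ≤ E) (hflow : ∀ x y t, |t| ≤ a → ‖curve f x t - curve f y t‖ ≤ E * ‖x - y‖)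
    (hB : ∀ z, |pd l K z| ≤ B) (hlip : ∀ z w, |pd l K z - pd l K w| ≤ B * ‖z - w‖)
    (hh : 0 < h) (hh1 : h ≤ 1) (hn : 1 ≤ n) (hwc : Continuous w) (hw : ∀ x, |w x| ≤ 1)
    {κ : ℝ} (hκ : 0 ≤ κ) (hwl : ∀ x y, |w x - w y| ≤ κ * ‖x - y‖)
    {z z' : Plane × ℝ} (hz : z ∈ L ×ˢ Set.Icc (-a) a) (ξ : Plane) :
    |lineTerm f K w l h n z ξ - lineTerm f K w l h n z' ξ| ≤
      ((a * E * (κ + 1) + 1) * B) / (n * h ^ (3 + l.length)) * dist z z' := by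
  have hB0 : 0 ≤ B := (abs_nonneg _).trans (hB 0)
  have hn0 : (0 : ℝ) < n := by exact_mod_cast hn
  have ha := hL.a_pos
  set u : Plane → ℝ → ℝ := fun y t => w (curve f y t) * kernTerm K l h n (curve f y t) ξ with hu
  have huc : ∀ y, Continuous (u y) := fun y =>
    (continuous_lineIntegrand hf hK hl hwc y).comp (f := fun t : ℝ => (t, ξ)) (by fun_prop)
  have hi : ∀ y c d, IntervalIntegrable (u y) volume c d := fun y c d =>
    (huc y).intervalIntegrable c d
  set b := B / (n * h ^ (3 + l.length)) with hb
  have hb0 : 0 ≤ b := by positivity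
  have hbb : ∀ y t, |u y t| ≤ b := fun y t => by
    refine (abs_lineIntegrand_le hB hh hn hw _ ξ).trans ?_
    rw [hb]
    have : h ^ (3 + l.length) ≤ h ^ (2 + l.length) :=
      pow_le_pow_of_le_one hh.le hh1 (by omega)
    gcongr
  have hk : ∀ x, |kernTerm K l h n x ξ| ≤ b := fun x => by
    refine (abs_kernTerm_le hB hh hn _ ξ).trans ?_
    rw [hb]
    have : h ^ (3 + l.length) ≤ h ^ (2 + l.length) :=
      pow_le_pow_of_le_one hh.le hh1 (by omega)
    gcongr
  have hdiff : ∀ t, |t| ≤ a → |u z.1 t - u z'.1 t| ≤ b * (κ + 1) * E * dist z z' := by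
    intro t ht
    have h1 := abs_kernTerm_sub_le hlip hh hn (curve f z.1 t) (curve f z'.1 t) ξ ξ
    rw [sub_sub_sub_cancel_right, ← hb] at h1
    have h2 := hflow z.1 z'.1 t ht
    have h3 : ‖z.1 - z'.1‖ ≤ dist z z' := by
      rw [← dist_eq_norm]; exact le_max_left _ _
    have e : u z.1 t - u z'.1 t =
        (w (curve f z.1 t) - w (curve f z'.1 t)) * kernTerm K l h n (curve f z.1 t) ξ +
        w (curve f z'.1 t) *
          (kernTerm K l h n (curve f z.1 t) ξ - kernTerm K l h n (curve f z'.1 t) ξ) := by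
      simp only [hu]; ring
    rw [e]
    refine (abs_add_le _ _).trans ?_
    rw [abs_mul, abs_mul]
    calc _ ≤ (κ * ‖curve f z.1 t - curve f z'.1 t‖) * b +
          1 * (b * ‖curve f z.1 t - curve f z'.1 t‖) := by
          gcongr
          exacts [hwl _ _, hk _, hw _]
      _ = b * (κ + 1) * ‖curve f z.1 t - curve f z'.1 t‖ := by ring
      _ ≤ b * (κ + 1) * (E * dist z z') := by
          gcongr
          exact h2.trans (by gcongr)
      _ = _ := by ring
  have e : lineTerm f K w l h n z ξ - lineTerm f K w l h n z' ξ =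
      (∫ t in (0 : ℝ)..z.2, (u z.1 t - u z'.1 t)) + ∫ t in z'.2..z.2, u z'.1 t := by
    rw [intervalIntegral.integral_sub (hi _ _ _) (hi _ _ _),
      ← intervalIntegral.integral_add_adjacent_intervals (hi z'.1 0 z'.2) (hi z'.1 z'.2 z.2)]
    simp only [lineTerm, hu]
    ring
  rw [e]
  have hza : |z.2| ≤ a := abs_le.2 hz.2
  have g1 : |∫ t in (0 : ℝ)..z.2, (u z.1 t - u z'.1 t)| ≤
      b * (κ + 1) * E * dist z z' * |z.2 - 0| := by
    rw [← Real.norm_eq_abs]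
    refine intervalIntegral.norm_integral_le_of_norm_le_const fun t ht => ?_
    refine hdiff t ?_
    rw [Set.mem_uIoc] at ht
    have := hz.2
    rcases ht with ht | ht
    · exact abs_le.2 ⟨by linarith [ht.1], by linarith [ht.2, this.2]⟩
    · exact abs_le.2 ⟨by linarith [ht.1, this.1], by linarith [ht.2]⟩
  have g2 : |∫ t in z'.2..z.2, u z'.1 t| ≤ b * |z.2 - z'.2| := by
    rw [← Real.norm_eq_abs]
    exact intervalIntegral.norm_integral_le_of_norm_le_const fun t _ => hbb _ t
  have h4 : |z.2 - z'.2| ≤ dist z z' := by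
    rw [← Real.dist_eq]; exact le_max_right _ _
  rw [sub_zero] at g1
  calc _ ≤ _ := abs_add_le _ _
    _ ≤ b * (κ + 1) * E * dist z z' * a + b * dist z z' := by
        refine add_le_add (g1.trans ?_) (g2.trans ?_) <;> gcongr
    _ = _ := by rw [hb]; ring

variable {μ : Measure Plane} [IsProbabilityMeasure μ]

lemma integrable_lineIntegrand (hf : DensityAssumptions f)
    (hK : KernelAssumptions K) (hl : l.length ≤ 3) (hB : ∀ z, |pd l K z| ≤ B) (hh : 0 < h)
    (hn : 1 ≤ n) (hwc : Continuous w) (hw : ∀ x, |w x| ≤ 1) (y : Plane) (s : ℝ) :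
    Integrable (Function.uncurry fun t ξ => w (curve f y t) * kernTerm K l h n (curve f y t) ξ)
      ((volume.restrict (Set.uIoc 0 s)).prod μ) := by
  have : IsFiniteMeasure ((volume : Measure ℝ).restrict (Set.uIoc 0 s)) :=
    ⟨by simp [Set.uIoc]⟩
  refine Integrable.of_bound (C := B / (n * h ^ (2 + l.length)))
    (continuous_lineIntegrand hf hK hl hwc y).aestronglyMeasurable
    (Eventually.of_forall fun p => abs_lineIntegrand_le hB hh hn hw _ _)

/-- Fubini reduces the first moment to the pointwise one. No speed condition enters here; the gain
of a factor h comes from the supremum bound alone. -/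
lemma integral_abs_lineTerm_le (hf : DensityAssumptions f)
    (hK : KernelAssumptions K) (hl : l.length ≤ 3) (hB : ∀ z, |pd l K z| ≤ B) (hh : 0 < h)
    (hn : 1 ≤ n) (hwc : Continuous w) (hw : ∀ x, |w x| ≤ 1) {z : Plane × ℝ}
    {D : ℝ} (hD : ∀ t ∈ Set.uIoc 0 z.2, ∫ ξ, |kernTerm K l h n (curve f z.1 t) ξ| ∂μ ≤ D) :
    ∫ ξ, |lineTerm f K w l h n z ξ| ∂μ ≤ D * |z.2| := by
  have hint := integrable_lineIntegrand (μ := μ) hf hK hl hB hh hn hwc hw z.1 z.2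
  have hc := continuous_lineTerm hf hK hl hwc z (h := h) (n := n)
  have h1 : ∀ ξ, |lineTerm f K w l h n z ξ| ≤
      ∫ t in Set.uIoc 0 z.2, |w (curve f z.1 t) * kernTerm K l h n (curve f z.1 t) ξ| := fun ξ => by
    rw [lineTerm, intervalIntegral.abs_integral_eq_abs_integral_uIoc]
    exact abs_integral_le_integral_abs
  have h2 : ∫ ξ, |lineTerm f K w l h n z ξ| ∂μ ≤ ∫ ξ, (∫ t in Set.uIoc 0 z.2,
      |w (curve f z.1 t) * kernTerm K l h n (curve f z.1 t) ξ|) ∂μ := by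
    refine integral_mono_of_nonneg (Eventually.of_forall fun ξ => abs_nonneg _) ?_
      (Eventually.of_forall h1)
    exact hint.abs.integral_prod_right
  refine h2.trans ?_
  rw [← integral_integral_swap (f := fun t ξ =>
    |w (curve f z.1 t) * kernTerm K l h n (curve f z.1 t) ξ|) hint.abs]
  have hvol : volume (Set.uIoc 0 z.2) ≠ ⊤ := by simp [Set.uIoc]
  have h3 := norm_setIntegral_le_of_norm_le_const (μ := (volume : Measure ℝ)) (C := D)
    (s := Set.uIoc 0 z.2) (f := fun t => ∫ ξ, |w (curve f z.1 t) *
      kernTerm K l h n (curve f z.1 t) ξ| ∂μ) hvol.lt_top (fun t ht => ?_)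
  · refine (le_abs_self _).trans (h3.trans_eq ?_)
    congr 1
    rcases le_total 0 z.2 with h0 | h0
    · rw [Set.uIoc_of_le h0, Real.volume_real_Ioc_of_le h0, abs_of_nonneg h0, sub_zero]
    · rw [Set.uIoc_of_ge h0, Real.volume_real_Ioc_of_le h0, abs_of_nonpos h0, zero_sub]
  · rw [Real.norm_eq_abs, abs_of_nonneg (integral_nonneg fun ξ => abs_nonneg _)]
    refine le_trans (integral_mono_of_nonneg (Eventually.of_forall fun ξ => abs_nonneg _) ?_
      (Eventually.of_forall fun ξ => ?_)) (hD t ht)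
    · refine (integrable_of_abs_le (b := B / (n * h ^ (2 + l.length))) ?_
        (fun ξ => abs_kernTerm_le hB hh hn _ ξ)).abs
      have h4 := continuous_kernTerm hK hl (h := h) (n := n)
      have h5 : Continuous fun ξ => kernTerm K l h n (curve f z.1 t) ξ := by fun_prop
      exact h5.measurable
    · simp only [abs_mul]
      exact mul_le_of_le_one_left (abs_nonneg _) (hw _)

end Line

/-! ### The estimate is close to the density with high probability -/

section Rare

variable {Ω : Type*} [MeasurableSpace Ω] {P : Measure Ω}

/-- The events involve uncountably many points and arbitrary choices of hitting times, so
probabilities are transferred by inclusion, without measurability. -/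
lemma tendsto_measure_of_eventually_subset {s t : ℕ → Set Ω} (h : ∀ᶠ n in atTop, s n ⊆ t n)
    (ht : Tendsto (fun n => P (t n)) atTop (𝓝 0)) : Tendsto (fun n => P (s n)) atTop (𝓝 0) :=
  tendsto_of_tendsto_of_tendsto_of_le_of_le' tendsto_const_nhds ht
    (Eventually.of_forall fun _ => zero_le) (h.mono fun _ hn => measure_mono hn)

lemma tendsto_measure_union {s t : ℕ → Set Ω} (hs : Tendsto (fun n => P (s n)) atTop (𝓝 0))
    (ht : Tendsto (fun n => P (t n)) atTop (𝓝 0)) :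
    Tendsto (fun n => P (s n ∪ t n)) atTop (𝓝 0) := by
  have := hs.add ht
  rw [add_zero] at this
  exact tendsto_of_tendsto_of_tendsto_of_le_of_le tendsto_const_nhds this
    (fun _ => zero_le) (fun _ => measure_union_le _ _)

/-- The events `A M n` become improbable as `n` grows, for all large thresholds `M`. -/
def Rare (P : Measure Ω) (A : ℝ → ℕ → Set Ω) : Prop :=
  ∃ M₀ > 0, ∀ M ≥ M₀, Tendsto (fun n => P (A M n)) atTop (𝓝 0)

lemma Rare.union {A A' : ℝ → ℕ → Set Ω} (h : Rare P A) (h' : Rare P A') :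
    Rare P fun M n => A M n ∪ A' M n := by
  obtain ⟨M₀, hM₀, h⟩ := h
  obtain ⟨M₁, hM₁, h'⟩ := h'
  exact ⟨max M₀ M₁, lt_max_of_lt_left hM₀, fun M hM =>
    tendsto_measure_union (h M (le_of_max_le_left hM)) (h' M (le_of_max_le_right hM))⟩

/-- Negligible shifts do not matter. -/
lemma Rare.of_abs_sub_le {Z : Type*} {S : Set Z} {ρ : ℕ → ℝ} {D : ℝ} (hD : 0 ≤ D)
    {u v : ℕ → Ω → Z → ℝ} (h : Rare P fun M n => {ω | ∃ z ∈ S, M * ρ n < |u n ω z|})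
    (hb : ∀ᶠ n in atTop, ∀ ω, ∀ z ∈ S, |v n ω z - u n ω z| ≤ D * ρ n) :
    Rare P fun M n => {ω | ∃ z ∈ S, M * ρ n < |v n ω z|} := by
  obtain ⟨M₀, hM₀, h⟩ := h
  refine ⟨M₀ + D, by positivity, fun M hM => ?_⟩
  refine tendsto_measure_of_eventually_subset ?_ (h (M - D) (by linarith))
  filter_upwards [hb] with n hn
  rintro ω ⟨z, hz, hlt⟩
  refine ⟨z, hz, ?_⟩
  have h1 := hn ω z hz
  have h2 := abs_sub_abs_le_abs_sub (v n ω z) (u n ω z)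
  linarith

end Rare

/-! ### Lipschitz weights for the linearized eigenvector field -/

section Weights

lemma abs_div_max_sub_le {p p' D D' c : ℝ} (hc : 0 < c) (hp : |p'| ≤ D') :
    |p / max D c - p' / max D' c| ≤ (|p - p'| + |D - D'|) / c := by
  set m := max D c with hm
  set m' := max D' c with hm'
  have h1 : c ≤ m := le_max_right _ _
  have h2 : c ≤ m' := le_max_right _ _
  have h3 : |p'| ≤ m' := hp.trans (le_max_left _ _)
  have h4 : |m - m'| ≤ |D - D'| := abs_max_sub_max_le_abs _ _ _
  have hmp : 0 < m := hc.trans_le h1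
  have hmp' : 0 < m' := hc.trans_le h2
  have e : p / m - p' / m' = ((p - p') - p' / m' * (m - m')) / m := by field_simp; ring
  have h5 : |p' / m'| ≤ 1 := by rw [abs_div, abs_of_pos hmp', div_le_one hmp']; exact h3
  rw [e, abs_div, abs_of_pos hmp]
  gcongr
  refine (abs_sub _ _).trans (add_le_add le_rfl ?_)
  rw [abs_mul]
  calc _ ≤ 1 * |D - D'| := by gcongr
    _ = _ := one_mul _

lemma abs_div_max_le_one {p D c : ℝ} (hc : 0 < c) (hp : |p| ≤ D) : |p / max D c| ≤ 1 := by
  have h1 : 0 < max D c := lt_max_of_lt_right hc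
  rw [abs_div, abs_of_pos h1, div_le_one h1]
  exact hp.trans (le_max_left _ _)

/-- The weights for which deviations along trajectories are needed. -/
structure IsWeight (κ : ℝ) (w : Plane → ℝ) : Prop where
  nonneg : 0 ≤ κ
  continuous : Continuous w
  abs_le : ∀ x, |w x| ≤ 1
  lipschitz : ∀ x y, |w x - w y| ≤ κ * ‖x - y‖

lemma isWeight_one : IsWeight 0 fun _ => 1 :=
  ⟨le_rfl, continuous_const, by simp, by simp⟩

/-- Cosine and sine are quotients by the gap. Truncating the denominator at a lower bound of the gap
on the starting set changes nothing there and makes the weights Lipschitz on the whole plane. -/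
lemma FilamentAssumptions.exists_weights {f : Plane → ℝ} {H L : Set Plane} {a : ℝ}
    (hf : DensityAssumptions f) (hL : FilamentAssumptions f H L a) :
    ∃ (κ : ℝ) (wc ws : Plane → ℝ), IsWeight κ wc ∧ IsWeight κ ws ∧
      ∀ x ∈ startSet f L a, wc x = cosPart (d20 f x) (d11 f x) (d02 f x) ∧
        ws x = sinPart (d20 f x) (d11 f x) (d02 f x) := by
  obtain ⟨c, hc, hgap⟩ := hL.exists_gap_le hf
  obtain ⟨C, hC, hlip⟩ := hf.tame3.dist2_le
  have hu : Continuous (d20 f) := hf.tame.continuous (l := [0, 0]) (by simp)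
  have hv : Continuous (d11 f) := hf.tame.continuous (l := [0, 1]) (by simp)
  have hw : Continuous (d02 f) := hf.tame.continuous (l := [1, 1]) (by simp)
  have hg : Continuous fun x => gap (d20 f x) (d11 f x) (d02 f x) := by
    unfold gap; fun_prop
  have hm : ∀ x, max (gap (d20 f x) (d11 f x) (d02 f x)) c ≠ 0 := fun x =>
    (lt_max_of_lt_right hc).ne'
  refine ⟨4 * C / c, fun x => (d02 f x - d20 f x) / max (gap (d20 f x) (d11 f x) (d02 f x)) c,
    fun x => (2 * d11 f x) / max (gap (d20 f x) (d11 f x) (d02 f x)) c,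
    ⟨by positivity, ?_, fun x => abs_div_max_le_one hc (abs_sub_le_gap _ _ _), fun x y => ?_⟩,
    ⟨by positivity, ?_, fun x => abs_div_max_le_one hc (abs_two_mul_le_gap _ _ _), fun x y => ?_⟩, fun x hx => ?_⟩
  · exact (hw.sub hu).div (hg.max continuous_const) hm
  · refine (abs_div_max_sub_le hc (abs_sub_le_gap _ _ _)).trans ?_
    rw [div_mul_eq_mul_div]
    gcongr
    have h1 := abs_gap_sub_le (d20 f x) (d11 f x) (d02 f x) (d20 f y) (d11 f y) (d02 f y)
    have h2 := hlip x y
    rw [dist2] at h2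
    have h3 : |d02 f x - d20 f x - (d02 f y - d20 f y)| ≤
        |d20 f x - d20 f y| + |d02 f x - d02 f y| := by
      rw [show d02 f x - d20 f x - (d02 f y - d20 f y) =
        (d02 f x - d02 f y) - (d20 f x - d20 f y) by ring, add_comm]
      exact abs_sub _ _
    linarith [abs_nonneg (d20 f x - d20 f y), abs_nonneg (d11 f x - d11 f y),
      abs_nonneg (d02 f x - d02 f y)]
  · exact (continuous_const.mul hv).div (hg.max continuous_const) hm
  · refine (abs_div_max_sub_le hc (abs_two_mul_le_gap (d20 f y) _ (d02 f y))).trans ?_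
    rw [div_mul_eq_mul_div]
    gcongr
    have h1 := abs_gap_sub_le (d20 f x) (d11 f x) (d02 f x) (d20 f y) (d11 f y) (d02 f y)
    have h2 := hlip x y
    rw [dist2] at h2
    rw [← mul_sub, abs_mul, abs_two]
    linarith [abs_nonneg (d20 f x - d20 f y), abs_nonneg (d11 f x - d11 f y),
      abs_nonneg (d02 f x - d02 f y)]
  · have h1 : max (gap (d20 f x) (d11 f x) (d02 f x)) c = gap (d20 f x) (d11 f x) (d02 f x) :=
      max_eq_left (hgap x hx)
    simp only [h1, cosPart, sinPart, and_self]

end Weights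

/-! ### Second derivative errors integrated along trajectories -/

section Line

variable {Ω : Type*} [MeasurableSpace Ω] {P : Measure Ω} [IsProbabilityMeasure P]
  {f K : Plane → ℝ} {H L : Set Plane} {a : ℝ} {h : ℕ → ℝ} {X : ℕ → Ω → Plane}

lemma polyNet_prod_Icc {S : Set Plane} (hS : Bornology.IsBounded S) (a : ℝ) :
    PolyNet (S ×ˢ Set.Icc (-a) a) := by
  obtain ⟨R, hR⟩ := hS.subset_closedBall 0
  refine polyNet_of_coords (d := 3) (fun z => ![z.1 0, z.1 1, z.2]) 2 (⌈R⌉₊ + ⌈a⌉₊)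
    (by norm_num) ?_ ?_
  · intro z _ z' _ ε hε hj
    have h0 := hj 0
    have h1 := hj 1
    have h2 := hj 2
    simp at h0 h1 h2
    have := norm_le_abs_add_abs (z.1 - z'.1)
    simp only [PiLp.sub_apply] at this
    rw [Prod.dist_eq, dist_eq_norm, Real.dist_eq]
    push_cast
    exact max_le (by linarith) (by linarith)
  · rintro ⟨y, s⟩ ⟨hy, hs⟩ j
    have h1 : ‖y‖ ≤ ⌈R⌉₊ := (mem_closedBall_zero_iff.1 (hR hy)).trans (Nat.le_ceil R)
    have h2 : |s| ≤ ⌈a⌉₊ := (abs_le.2 hs).trans (Nat.le_ceil a)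
    have h3 : (0 : ℝ) ≤ ⌈R⌉₊ := by positivity
    have h4 : (0 : ℝ) ≤ ⌈a⌉₊ := by positivity
    push_cast
    fin_cases j
    · have := abs_apply_le_norm y 0
      simp only [Fin.zero_eta, Matrix.cons_val_zero]
      linarith
    · have := abs_apply_le_norm y 1
      simp only [Fin.mk_one, Matrix.cons_val_one, Matrix.cons_val_zero]
      linarith
    · simp only [Fin.reduceFinMk, Matrix.cons_val]
      linarith

/-- By Fubini the mean is the line integral of the smoothed derivative, so the pointwise bias is
simply integrated. -/
lemma abs_mul_integral_lineTerm_sub_le (hf : DensityAssumptions f) (hK : KernelAssumptions K)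
    [IsProbabilityMeasure (densityMeasure f)] {κ : ℝ} {w : Plane → ℝ} (hw : IsWeight κ w)
    (i j : Fin 2) {D : ℝ} (hD : ∀ l : List (Fin 2), l.length ≤ 2 → ∀ (h : ℝ) (y : Plane),
      |conv K (pd l f) h y - pd l f y| ≤ D * h ^ 2) {h : ℝ} (hh : 0 < h) {n : ℕ} (hn : 1 ≤ n)
    (z : Plane × ℝ) :
    |n * ∫ ξ, lineTerm f K w [i, j] h n z ξ ∂(densityMeasure f) -
      ∫ t in (0 : ℝ)..z.2, w (curve f z.1 t) * pd [i, j] f (curve f z.1 t)| ≤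
      D * h ^ 2 * |z.2| := by
  obtain ⟨B, hB, hbB, -⟩ := hK.exists_bound
  have hint := integrable_lineIntegrand (μ := densityMeasure f) hf hK (l := [i, j]) (by simp)
    (hbB [i, j] (by simp) (by simp)) hh hn hw.continuous hw.abs_le z.1 z.2
  have hsym : pd [i, j].reverse f = pd [i, j] f := by
    simp only [List.reverse_cons, List.reverse_nil, List.nil_append, List.cons_append, pd_cons,
      pd_nil]
    exact partialDeriv_comm (hf.smooth.of_le (by norm_num)) j i
  have hswap : n * ∫ ξ, lineTerm f K w [i, j] h n z ξ ∂(densityMeasure f) =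
      ∫ t in (0 : ℝ)..z.2, w (curve f z.1 t) * conv K (pd [i, j] f) h (curve f z.1 t) := by
    unfold lineTerm
    rw [← intervalIntegral_integral_swap hint, ← intervalIntegral.integral_const_mul]
    refine intervalIntegral.integral_congr fun t _ => ?_
    rw [integral_const_mul, mul_left_comm, integral_kernTerm hK hf (by simp) hh hn, hsym]
  have hi1 : IntervalIntegrable
      (fun t => w (curve f z.1 t) * conv K (pd [i, j] f) h (curve f z.1 t)) volume 0 z.2 := by
    rw [intervalIntegrable_iff]
    have h1 := hint.integral_prod_left.const_mul (n : ℝ)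
    refine h1.congr (Eventually.of_forall fun t => ?_)
    simp only [Function.uncurry]
    rw [integral_const_mul, mul_left_comm, integral_kernTerm hK hf (by simp) hh hn, hsym]
  have hcurve := hf.tame3.curve_continuous z.1
  have hpd : Continuous (pd [i, j] f) := hf.tame.continuous (by simp)
  have hwc := hw.continuous
  have hi2 : IntervalIntegrable
      (fun t => w (curve f z.1 t) * pd [i, j] f (curve f z.1 t)) volume 0 z.2 :=
    Continuous.intervalIntegrable (by fun_prop) _ _
  rw [hswap, ← intervalIntegral.integral_sub hi1 hi2, ← Real.norm_eq_abs]
  refine (intervalIntegral.norm_integral_le_of_norm_le_const (C := D * h ^ 2)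
    fun t _ => ?_).trans_eq (by rw [sub_zero])
  rw [← mul_sub, Real.norm_eq_abs, abs_mul]
  exact (mul_le_of_le_one_left (abs_nonneg _) (hw.abs_le _)).trans (hD _ (by simp) _ _)

lemma sum_lineTerm (hf : DensityAssumptions f) (hK : KernelAssumptions K) {κ : ℝ} {w : Plane → ℝ}
    (hw : IsWeight κ w) {l : List (Fin 2)} (hl : l.length ≤ 3) (h : ℝ) (n : ℕ) (x : ℕ → Plane)
    (z : Plane × ℝ) :
    ∑ i ∈ Finset.range n, lineTerm f K w l h n z (x i) =
      ∫ t in (0 : ℝ)..z.2, w (curve f z.1 t) * pd l (kde K h n x) (curve f z.1 t) := by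
  unfold lineTerm
  rw [← intervalIntegral.integral_finsetSum]
  · refine intervalIntegral.integral_congr fun t _ => ?_
    rw [hK.pd_kde _ _ _ _ (by omega), Finset.mul_sum]
  · intro i _
    refine Continuous.intervalIntegrable ?_ _ _
    exact (continuous_lineIntegrand hf hK hl hw.continuous z.1).comp
      (f := fun t : ℝ => (t, x i)) (by fun_prop)

/-- Pointwise, second derivative errors are controlled only at the square root of the rate.
Averaging along the trajectory gains a factor h in the variance, and this is what reaches the rate
itself. -/
lemma rare_line (hf : DensityAssumptions f) (hL : FilamentAssumptions f H L a)
    (hK : KernelAssumptions K) (hX : IsSample P f X) (hh : BandwidthAssumptions h) {κ : ℝ}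
    {w : Plane → ℝ} (hw : IsWeight κ w) (i j : Fin 2) :
    Rare P fun M n => {ω | ∃ z ∈ L ×ˢ Set.Icc (-a) a, M * rate h n <
      |∫ t in (0 : ℝ)..z.2, w (curve f z.1 t) *
        (pd [i, j] (fHat K h X n ω) (curve f z.1 t) - pd [i, j] f (curve f z.1 t))|} := by
  obtain ⟨B, hB, hbB, hlip⟩ := hK.exists_bound
  obtain ⟨R, hR⟩ := (hL.isCompact_startSet hf).isBounded.subset_closedBall 0
  obtain ⟨D, hD, hmom⟩ := exists_integral_kernTerm_sq_le hK hf R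
  obtain ⟨D', hD', hbias⟩ := exists_bias_le hK hf
  obtain ⟨C, hC, hgood⟩ := hh.eventually_good
  obtain ⟨γ, hγ, hspeed⟩ := hL.mean_speed
  obtain ⟨k, hk, hflow⟩ := hf.tame3.norm_curve_sub_curve_le
  have ha := hL.a_pos
  have hprob := hX.isProbabilityMeasure
  have hbB' := hbB [i, j] (by simp) (by simp)
  have hlip' := hlip [i, j] (by simp)
  set E := Real.exp (k * a) with hE
  have hflow' : ∀ x y t, |t| ≤ a → ‖curve f x t - curve f y t‖ ≤ E * ‖x - y‖ := by
    intro x y t ht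
    refine (hflow x y t).trans ?_
    rw [mul_comm, hE]
    gcongr
  set b₀ := 4 * B / γ with hb₀
  set Λ₀ := (a * E * (κ + 1) + 1) * B with hΛ₀
  have hb₀p : 0 < b₀ := by positivity
  have hκ := hw.nonneg
  have hΛ₀p : 0 < Λ₀ := by positivity
  set v₀ := b₀ * (D * a) with hv₀
  have hv₀p : 0 < v₀ := by positivity
  have habs : ∀ᶠ n : ℕ in atTop, ∀ z ∈ L ×ˢ Set.Icc (-a) a, ∀ ξ,
      |lineTerm f K w [i, j] (h n) n z ξ| ≤ b₀ / (n * h n ^ 3) := by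
    filter_upwards [hgood 1] with n hn z hz ξ
    exact abs_lineTerm_le hL hf hK hγ hspeed hbB' hn.pos hn.one_le hw.abs_le hz ξ
  have key : Rare P fun M n => {ω | ∃ z ∈ L ×ˢ Set.Icc (-a) a, M * rate h n <
      |∑ m ∈ Finset.range n, lineTerm f K w [i, j] (h n) n z (X m ω) -
        n * ∫ ξ, lineTerm f K w [i, j] (h n) n z ξ ∂(densityMeasure f)|} := by
    refine tendsto_measure_exists_lt (P := P) (X := X) (μ := densityMeasure f) (polyNet_prod_Icc hL.compact_filament.isBounded a)
      hX.measurable hX.indep hX.law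
      (F := fun n z ξ => lineTerm f K w [i, j] (h n) n z ξ) (b := fun n => b₀ / (n * h n ^ 3))
      (v := fun n => v₀ / (n ^ 2 * h n ^ 5)) (Λ := fun n => Λ₀ / (n * h n ^ 5)) (ρ := rate h)
      (A := v₀ * C + Λ₀) (by positivity)
      (Eventually.of_forall fun n z _ =>
        (continuous_lineTerm hf hK (by simp) hw.continuous z).measurable) habs ?_ ?_
      ((hgood 1).mono fun n hn => (div_pos hΛ₀p (hn.pos_mul _)).le)
      ((hgood 1).mono fun n hn => hn.rate_pos) ((hgood _).mono fun n hn => hn.two_mul_le_rate) ?_ ?_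
    · filter_upwards [habs, hgood 1] with n habs hn z hz
      have hn0 : (0 : ℝ) < n := by have := hn.one_le; positivity
      have hp := hn.pos
      have h1 : ∫ ξ, |lineTerm f K w [i, j] (h n) n z ξ| ∂(densityMeasure f) ≤
          D / (n * h n ^ 2) * |z.2| := by
        refine integral_abs_lineTerm_le hf hK (by simp) hbB' hn.pos hn.one_le hw.continuous
          hw.abs_le fun t ht => ?_
        refine (hmom [i, j] (by simp) (by simp) _ _ hn.pos hn.le_one hn.one_le _ (hR ?_)).2
        refine curve_mem_startSet hz.1 ?_
        have := hz.2
        rw [Set.mem_uIoc] at ht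
        rcases ht with ht | ht
        · exact abs_le.2 ⟨by linarith [ht.1], by linarith [ht.2, this.2]⟩
        · exact abs_le.2 ⟨by linarith [ht.1, this.1], by linarith [ht.2]⟩
      have hcont := continuous_lineTerm hf hK (l := [i, j]) (by simp) hw.continuous z
        (h := h n) (n := n)
      have hint := integrable_of_abs_le (μ := densityMeasure f) hcont.measurable (habs z hz)
      -- Supremum 1/(n h³) times first moment 1/(n h²), up to constants, gives 1/(n² h⁵).
      calc ∫ ξ, lineTerm f K w [i, j] (h n) n z ξ ^ 2 ∂(densityMeasure f)
          ≤ ∫ ξ, b₀ / (n * h n ^ 3) * |lineTerm f K w [i, j] (h n) n z ξ| ∂(densityMeasure f) := by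
            refine integral_mono_of_nonneg (Eventually.of_forall fun ξ => sq_nonneg _)
              (hint.abs.const_mul _) (Eventually.of_forall fun ξ => ?_)
            simp only
            rw [← sq_abs, sq]
            exact mul_le_mul_of_nonneg_right (habs z hz ξ) (abs_nonneg _)
        _ ≤ b₀ / (n * h n ^ 3) * (D / (n * h n ^ 2) * a) := by
            rw [integral_const_mul]
            have : |z.2| ≤ a := abs_le.2 hz.2
            gcongr
            exact h1.trans (by gcongr)
        _ = v₀ / (n ^ 2 * h n ^ 5) := by rw [hv₀]; field_simp
    · filter_upwards [hgood 1] with n hn z hz z' _ ξ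
      exact abs_lineTerm_sub_le hL hf hK (by simp) (by positivity) hflow' hbB' hlip' hn.pos
        hn.le_one hn.one_le hw.continuous hw.abs_le hκ hw.lipschitz hz ξ
    · filter_upwards [hgood 1] with n hn
      refine (hn.variance_le_rate hv₀p.le hC.le le_rfl).trans ?_
      gcongr
      linarith
    · filter_upwards [hgood 1] with n hn
      refine (hn.lipschitz_le_rate hΛ₀p.le (by norm_num)).trans ?_
      have := hn.rate_pos
      gcongr
      linarith [mul_pos hv₀p hC]
  refine key.of_abs_sub_le (D := D' * C * a) (by positivity) ?_
  filter_upwards [hgood 1] with n hn ω z hz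
  have hza : |z.2| ≤ a := abs_le.2 hz.2
  have h1 := abs_mul_integral_lineTerm_sub_le hf hK hw i j hbias hn.pos hn.one_le z
  have hcurve := hf.tame3.curve_continuous z.1
  have hwc := hw.continuous
  have hpd : Continuous (pd [i, j] f) := hf.tame.continuous (by simp)
  have hpd' : Continuous (pd [i, j] (fHat K h X n ω)) :=
    (hK.tame_kde _ _ _).continuous (by simp)
  have e : ∫ t in (0 : ℝ)..z.2, w (curve f z.1 t) *
      (pd [i, j] (fHat K h X n ω) (curve f z.1 t) - pd [i, j] f (curve f z.1 t)) =
      ∑ m ∈ Finset.range n, lineTerm f K w [i, j] (h n) n z (X m ω) -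
        ∫ t in (0 : ℝ)..z.2, w (curve f z.1 t) * pd [i, j] f (curve f z.1 t) := by
    rw [sum_lineTerm hf hK hw (by simp), ← intervalIntegral.integral_sub]
    · simp only [mul_sub, fHat]
    · exact Continuous.intervalIntegrable (by unfold fHat at hpd'; fun_prop) _ _
    · exact Continuous.intervalIntegrable (by fun_prop) _ _
  rw [e, sub_sub_sub_cancel_left]
  refine h1.trans ?_
  calc D' * h n ^ 2 * |z.2| ≤ D' * (C * rate h n) * a := by
        have := hn.rate_pos
        gcongr
        exact hn.sq_le_rate hC.le
    _ = _ := by ring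

end Line

/-! ### Closeness of the estimate as an event of large probability -/

section CloseEvent

variable {f g : Plane → ℝ} {H L : Set Plane} {a : ℝ}

lemma norm_integral_linErr_le (hf : DensityAssumptions f) (hg : TameDeriv 3 g) {wc ws : Plane → ℝ}
    (hwc : Continuous wc) (hws : Continuous ws)
    (hw : ∀ x ∈ startSet f L a, wc x = cosPart (d20 f x) (d11 f x) (d02 f x) ∧
      ws x = sinPart (d20 f x) (d11 f x) (d02 f x)) {y : Plane} (hy : y ∈ L) {s : ℝ}
    (hs : |s| ≤ a) {ρ : ℝ}
    (hJ : ∀ w l, (w, l) ∈ ([(fun _ => 1, [0, 0]), (fun _ => 1, [0, 1]), (fun _ => 1, [1, 1]),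
      (wc, [0, 0]), (wc, [1, 1]), (ws, [0, 1])] : List ((Plane → ℝ) × List (Fin 2))) →
      |∫ t in (0 : ℝ)..s, w (curve f y t) * (pd l g (curve f y t) - pd l f (curve f y t))| ≤ ρ) :
    ‖∫ t in (0 : ℝ)..s, linErr f g (curve f y t)‖ ≤ 36 * ρ := by
  -- `linErr` is linear in the three second derivative errors, with coefficients that are constants,
  -- cosines and sines. Collecting terms leaves six scalar integrals times fixed vectors of norm at
  -- most 6, hence the factor 36.
  set W : Fin 6 → Plane → ℝ := ![fun _ => 1, fun _ => 1, fun _ => 1, wc, wc, ws] with hW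
  set I : Fin 6 → List (Fin 2) := ![[0, 0], [0, 1], [1, 1], [0, 0], [1, 1], [0, 1]] with hI
  set v : Fin 6 → Plane := ![!₂[2, -1], !₂[2, 4], !₂[-2, 1], !₂[2, 1], !₂[-2, -1], !₂[-4, -2]]
    with hv
  have hWc : ∀ k, Continuous (W k) := by
    intro k; fin_cases k <;> simp [hW] <;> fun_prop
  have hIl : ∀ k, (I k).length = 2 := by intro k; fin_cases k <;> rfl
  have hvn : ∀ k, ‖v k‖ ≤ 6 := by
    intro k
    refine (norm_le_abs_add_abs _).trans ?_
    fin_cases k <;> simp [hv] <;> norm_num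
  set u : Fin 6 → ℝ → ℝ := fun k t => W k (curve f y t) *
    (pd (I k) g (curve f y t) - pd (I k) f (curve f y t)) with hu
  have huc : ∀ k, Continuous (u k) := by
    intro k
    have h1 := hf.tame3.curve_continuous y
    have h2 := hWc k
    have h3 : Continuous (pd (I k) g) := hg.continuous (by rw [hIl]; norm_num)
    have h4 : Continuous (pd (I k) f) := hf.tame3.continuous (by rw [hIl]; norm_num)
    simp only [hu]
    fun_prop
  have hub : ∀ k, |∫ t in (0 : ℝ)..s, u k t| ≤ ρ := by
    intro k
    refine hJ (W k) (I k) ?_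
    fin_cases k <;> simp [hW, hI]
  have hmem : ∀ t ∈ Set.uIcc 0 s, curve f y t ∈ startSet f L a := by
    intro t ht
    refine curve_mem_startSet hy ?_
    have := abs_le.1 hs
    rw [Set.mem_uIcc] at ht
    rcases ht with ht | ht
    · exact abs_le.2 ⟨by linarith [ht.1, ht.2], by linarith [ht.2, this.2]⟩
    · exact abs_le.2 ⟨by linarith [ht.1, this.1], by linarith [ht.1, ht.2]⟩
  have e : ∫ t in (0 : ℝ)..s, linErr f g (curve f y t) = ∑ k, (∫ t in (0 : ℝ)..s, u k t) • v k := by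
    have h1 : ∫ t in (0 : ℝ)..s, linErr f g (curve f y t) =
        ∫ t in (0 : ℝ)..s, ∑ k, u k t • v k := by
      refine intervalIntegral.integral_congr fun t ht => ?_
      obtain ⟨hc, hs⟩ := hw _ (hmem t ht)
      simp only [linErr]
      ext i
      fin_cases i <;>
        simp [Fin.sum_univ_succ, hu, hW, hI, hv, gapDeriv, hc, hs, d20_eq, d11_eq, d02_eq] <;> ring
    have h2 : ∀ k ∈ (Finset.univ : Finset (Fin 6)),
        IntervalIntegrable (fun t => u k t • v k) volume 0 s :=
      fun k _ => ((huc k).smul continuous_const).intervalIntegrable _ _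
    rw [h1, intervalIntegral.integral_finsetSum h2]
    refine Finset.sum_congr rfl fun k _ => ?_
    rw [intervalIntegral.integral_smul_const]
  rw [e]
  refine (norm_sum_le _ _).trans ?_
  calc ∑ k, ‖(∫ t in (0 : ℝ)..s, u k t) • v k‖ ≤ ∑ _k : Fin 6, ρ * 6 := by
        refine Finset.sum_le_sum fun k _ => ?_
        rw [norm_smul]
        exact mul_le_mul (hub k) (hvn k) (norm_nonneg _) ((abs_nonneg _).trans (hub k))
    _ = 36 * ρ := by simp; ring

variable {Ω : Type*} [MeasurableSpace Ω] {P : Measure Ω} [IsProbabilityMeasure P]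
  {K : Plane → ℝ} {h : ℕ → ℝ} {X : ℕ → Ω → Plane}

lemma rare_pd_one (hf : DensityAssumptions f) (hK : KernelAssumptions K)
    (hX : IsSample P f X) (hh : BandwidthAssumptions h) (R : ℝ) (i : Fin 2) :
    Rare P fun M n => {ω | ∃ y ∈ Metric.closedBall (0 : Plane) R,
      M * rate h n < |pd [i] (fHat K h X n ω) y - pd [i] f y|} := by
  obtain ⟨C, hC, hgood⟩ := hh.eventually_good
  obtain ⟨D, hD, hbias⟩ := exists_bias_le hK hf
  refine Rare.of_abs_sub_le (D := D * C) (by positivity) (exists_tendsto_pd_fHat hf hK hX hh R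
    (l := [i]) (by simp) (by simp) ((hgood 1).mono fun n hn => hn.rate_pos)
    (fun B _ => (hgood _).mono fun n hn => hn.two_mul_le_rate)
    (fun B hB => ⟨B * C, by positivity, (hgood 1).mono fun n hn =>
      hn.variance_le_rate hB.le hC.le (by simp)⟩)
    (fun B hB => ⟨B, hB.le, (hgood 1).mono fun n hn => hn.lipschitz_le_rate hB.le (by simp)⟩)) ?_
  filter_upwards [hgood 1] with n hn ω y _
  rw [sub_sub_sub_cancel_left]
  refine (hbias [i] (by simp) _ _).trans ?_
  rw [mul_assoc]
  gcongr
  exact hn.sq_le_rate hC.le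

lemma rare_pd_two (hf : DensityAssumptions f) (hK : KernelAssumptions K)
    (hX : IsSample P f X) (hh : BandwidthAssumptions h) (R : ℝ) (i j : Fin 2) :
    Rare P fun M n => {ω | ∃ y ∈ Metric.closedBall (0 : Plane) R,
      M * √(rate h n) < |pd [i, j] (fHat K h X n ω) y - pd [i, j] f y|} := by
  obtain ⟨C, hC, hgood⟩ := hh.eventually_good
  obtain ⟨D, hD, hbias⟩ := exists_bias_le hK hf
  have hsym : pd [i, j].reverse f = pd [i, j] f := by
    simp only [List.reverse_cons, List.reverse_nil, List.nil_append, List.cons_append, pd_cons,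
      pd_nil]
    exact partialDeriv_comm (hf.smooth.of_le (by norm_num)) j i
  refine Rare.of_abs_sub_le (D := D * C) (by positivity) (exists_tendsto_pd_fHat hf hK hX hh R
    (l := [i, j]) (by simp) (by simp)
    ((hgood 1).mono fun n hn => Real.sqrt_pos.2 hn.rate_pos)
    (fun B _ => (hgood _).mono fun n hn => hn.two_mul_le_sqrt_rate)
    (fun B hB => ⟨B, by positivity, (hgood 1).mono fun n hn => hn.variance_le_sqrt_rate hB.le⟩)
    (fun B hB => ⟨B, hB.le, (hgood 1).mono fun n hn => hn.lipschitz_le_sqrt_rate le_rfl hB.le⟩)) ?_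
  filter_upwards [hgood 1] with n hn ω y _
  rw [sub_sub_sub_cancel_left, hsym]
  refine (hbias [i, j] (by simp) _ _).trans ?_
  rw [mul_assoc]
  gcongr
  refine (hn.sq_le_rate hC.le).trans ?_
  gcongr
  refine Real.le_sqrt_of_sq_le ?_
  have := hn.rate_le le_rfl
  nlinarith [hn.rate_pos, hn.le_one]

lemma rare_pd_three (hf : DensityAssumptions f) (hK : KernelAssumptions K)
    (hX : IsSample P f X) (hh : BandwidthAssumptions h) (R : ℝ) (i j k : Fin 2) :
    Rare P fun M n => {ω | ∃ y ∈ Metric.closedBall (0 : Plane) R,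
      M * 1 < |pd [i, j, k] (fHat K h X n ω) y|} := by
  obtain ⟨C, hC, hgood⟩ := hh.eventually_good
  obtain ⟨D, hD, hconv⟩ := exists_conv_le hK hf
  refine Rare.of_abs_sub_le (ρ := fun _ => 1) hD.le (exists_tendsto_pd_fHat hf hK hX hh R
    (l := [i, j, k]) (by simp) (by simp) (Eventually.of_forall fun _ => one_pos)
    (fun B hB => (hgood _).mono fun n hn => hn.two_mul_le_one hB.le)
    (fun B hB => ⟨B, by positivity, (hgood 1).mono fun n hn => hn.variance_le_one le_rfl hB.le⟩)
    (fun B hB => ⟨B, hB.le, (hgood 1).mono fun n hn => hn.lipschitz_le_one le_rfl hB.le⟩)) ?_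
  refine Eventually.of_forall fun n ω y _ => ?_
  rw [sub_sub_cancel, mul_one]
  exact hconv _ (by simp) (by simp) _ _

/-- With probability tending to one, the estimate is close to the density. -/
lemma rare_not_close (hf : DensityAssumptions f) (hL : FilamentAssumptions f H L a)
    (hK : KernelAssumptions K) (hX : IsSample P f X) (hh : BandwidthAssumptions h) (R : ℝ) :
    Rare P fun M n => {ω | ¬ Close f (fHat K h X n ω) L a R M (rate h n)} := by
  obtain ⟨κ, wc, ws, hwc, hws, hw⟩ := hL.exists_weights hf
  obtain ⟨C, hC, hgood⟩ := hh.eventually_good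
  have key := ((rare_pd_one hf hK hX hh R 0).union (rare_pd_one hf hK hX hh R 1)).union
    (((rare_pd_two hf hK hX hh R 0 0).union ((rare_pd_two hf hK hX hh R 0 1).union
      (rare_pd_two hf hK hX hh R 1 1))).union
    (((rare_pd_three hf hK hX hh R 0 0 0).union ((rare_pd_three hf hK hX hh R 0 0 1).union
      (rare_pd_three hf hK hX hh R 0 1 1))).union
    (((rare_pd_three hf hK hX hh R 1 0 0).union ((rare_pd_three hf hK hX hh R 1 0 1).union
      (rare_pd_three hf hK hX hh R 1 1 1))).union
    (((rare_line hf hL hK hX hh isWeight_one 0 0).union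
      ((rare_line hf hL hK hX hh isWeight_one 0 1).union
        (rare_line hf hL hK hX hh isWeight_one 1 1))).union
    ((rare_line hf hL hK hX hh hwc 0 0).union
      ((rare_line hf hL hK hX hh hwc 1 1).union (rare_line hf hL hK hX hh hws 0 1)))))))
  obtain ⟨M₀, hM₀, key⟩ := key
  -- The threshold M/36 is dictated by the line integrals. The sums of two first and three second
  -- derivative errors need less.
  refine ⟨36 * M₀, by positivity, fun M hM => ?_⟩
  refine tendsto_measure_of_eventually_subset ?_ (key (M / 36) (by linarith))
  filter_upwards [hgood 1] with n hn ω
  contrapose!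
  intro hω
  simp only [Set.mem_union, Set.mem_ofPred_eq, not_or, not_exists, not_and, not_lt] at hω ⊢
  obtain ⟨⟨h1, h2⟩, ⟨h3, h4, h5⟩, ⟨h6, h7, h8⟩, ⟨h9, h10, h11⟩, ⟨h12, h13, h14⟩, h15, h16, h17⟩ := hω
  have hr := hn.rate_pos
  have hs : 0 ≤ √(rate h n) := Real.sqrt_nonneg _
  have hM' : 0 < M := by linarith
  have hle : ∀ {x : ℝ}, x ≤ M / 36 * 1 → x ≤ M := fun hx => by linarith
  rw [not_not]
  refine ⟨hK.tame_kde _ _ _, fun x hx => ?_, fun x hx => ?_, fun x hx i => ?_, fun y hy s hs => ?_⟩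
  · have := h1 x hx
    have := h2 x hx
    have := mul_pos hM' hr
    simp only [pd_cons, pd_nil] at *
    rw [dist1]
    linarith
  · have := h3 x hx
    have := h4 x hx
    have := h5 x hx
    have := mul_nonneg hM'.le hs
    rw [dist2]
    simp only [d20_eq, d11_eq, d02_eq]
    linarith
  · fin_cases i
    · exact ⟨hle (h6 x hx), hle (h7 x hx), hle (h8 x hx)⟩
    · exact ⟨hle (h9 x hx), hle (h10 x hx), hle (h11 x hx)⟩
  · have hz : (y, s) ∈ L ×ˢ Set.Icc (-a) a := ⟨hy, abs_le.1 hs⟩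
    refine (norm_integral_linErr_le hf (hK.tame_kde _ _ _) hwc.continuous hws.continuous hw hy hs
      (ρ := M / 36 * rate h n) fun w l hwl => ?_).trans_eq (by ring)
    simp only [List.mem_cons, Prod.mk.injEq, List.not_mem_nil, or_false] at hwl
    rcases hwl with ⟨rfl, rfl⟩ | ⟨rfl, rfl⟩ | ⟨rfl, rfl⟩ | ⟨rfl, rfl⟩ | ⟨rfl, rfl⟩ | ⟨rfl, rfl⟩
    · exact h12 _ hz
    · exact h13 _ hz
    · exact h14 _ hz
    · exact h15 _ hz
    · exact h16 _ hz
    · exact h17 _ hz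

end CloseEvent

/-! ### Anti-concentration of sums -/

section AntiConcentration

/-- For a centered variable the linear term can be subtracted before integrating. What remains has
squared modulus 1 - 2 x sin x + x², and x sin x ≥ 5 x² / 6 on this range. -/
lemma norm_cexp_sub_le {x : ℝ} (hx : |x| ≤ 1) :
    ‖Complex.exp (x * Complex.I) - x * Complex.I‖ ≤ 1 - x ^ 2 / 4 := by
  have hx2 : x ^ 2 ≤ 1 := by rw [← sq_abs]; nlinarith [abs_nonneg x]
  have h1 : x ^ 2 * (5 / 6) ≤ x * Real.sin x := by
    rcases le_total 0 x with h | h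
    · nlinarith [Real.sin_ge_sub_cube h, mul_le_mul_of_nonneg_left (Real.sin_ge_sub_cube h) h,
        sq_nonneg (x ^ 2)]
    · have h0 : 0 ≤ -x := by linarith
      have h2 := mul_le_mul_of_nonneg_left (Real.sin_ge_sub_cube h0) h0
      rw [Real.sin_neg] at h2
      nlinarith [sq_nonneg (x ^ 2)]
  have h3 := Real.sin_sq_add_cos_sq x
  refine abs_le_of_sq_le_sq' ?_ (by linarith) |>.2
  rw [Complex.sq_norm, Complex.normSq_apply]
  simp only [Complex.sub_re, Complex.sub_im, Complex.exp_ofReal_mul_I_re,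
    Complex.exp_ofReal_mul_I_im, Complex.mul_re, Complex.mul_im, Complex.ofReal_re,
    Complex.ofReal_im, Complex.I_re, Complex.I_im]
  nlinarith [sq_nonneg (x ^ 2)]

variable {E : Type*} [MeasurableSpace E] {μ : Measure E} [IsProbabilityMeasure μ]

lemma norm_integral_cexp_le {G : E → ℝ} (hG : Measurable G) {b v t : ℝ} (hb : ∀ x, |G x| ≤ b)
    (h0 : ∫ x, G x ∂μ = 0) (hv : v ≤ ∫ x, G x ^ 2 ∂μ) (ht : |t| * b ≤ 1) :
    ‖∫ x, Complex.exp ((t * G x : ℝ) * Complex.I) ∂μ‖ ≤ Real.exp (-(t ^ 2 * v / 4)) := by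
  have hGi := integrable_of_abs_le (μ := μ) hG hb
  have hG2 : Integrable (fun x => G x ^ 2) μ :=
    integrable_of_abs_le (b := b ^ 2) (hG.pow_const 2) fun x => by
      rw [abs_pow]; exact pow_le_pow_left₀ (abs_nonneg _) (hb x) 2
  have hm : Measurable fun x => Complex.exp ((t * G x : ℝ) * Complex.I) := by fun_prop
  have hi : Integrable (fun x => Complex.exp ((t * G x : ℝ) * Complex.I)) μ :=
    Integrable.of_bound hm.aestronglyMeasurable 1
      (Eventually.of_forall fun x => (Complex.norm_exp_ofReal_mul_I _).le)
  have hi' : Integrable (fun x => ((t * G x : ℝ) : ℂ) * Complex.I) μ :=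
    ((hGi.const_mul t).ofReal).mul_const _
  have hz : ∫ x, ((t * G x : ℝ) : ℂ) * Complex.I ∂μ = 0 := by
    rw [integral_mul_const, integral_complex_ofReal, integral_const_mul, h0]; simp
  have e : ∫ x, Complex.exp ((t * G x : ℝ) * Complex.I) ∂μ =
      ∫ x, (Complex.exp ((t * G x : ℝ) * Complex.I) - (t * G x : ℝ) * Complex.I) ∂μ := by
    rw [integral_sub hi hi', hz, sub_zero]
  rw [e]
  refine (norm_integral_le_integral_norm _).trans ?_
  calc ∫ x, ‖Complex.exp ((t * G x : ℝ) * Complex.I) - (t * G x : ℝ) * Complex.I‖ ∂μ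
      ≤ ∫ x, (1 - t ^ 2 / 4 * G x ^ 2) ∂μ := by
        refine integral_mono (hi.sub hi').norm ((integrable_const 1).sub (hG2.const_mul _))
          fun x => ?_
        have hx : |t * G x| ≤ 1 := by
          rw [abs_mul]
          exact (mul_le_mul_of_nonneg_left (hb x) (abs_nonneg t)).trans ht
        refine (norm_cexp_sub_le hx).trans_eq ?_
        ring
    _ = 1 - t ^ 2 / 4 * ∫ x, G x ^ 2 ∂μ := by
        rw [integral_sub (integrable_const 1) (hG2.const_mul _), integral_const_mul]; simp
    _ ≤ 1 - t ^ 2 / 4 * v := by gcongr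
    _ ≤ _ := by
        have := Real.add_one_le_exp (-(t ^ 2 * v / 4))
        linarith

variable {Ω : Type*} [MeasurableSpace Ω] {P : Measure Ω} {X : ℕ → Ω → E}

lemma norm_integral_cexp_sum_le (hX : ∀ i, Measurable (X i)) (hind : iIndepFun X P)
    (hlaw : ∀ i, P.map (X i) = μ) {G : E → ℝ} (hG : Measurable G) {b v t : ℝ}
    (hb : ∀ x, |G x| ≤ b) (h0 : ∫ x, G x ∂μ = 0) (hv : v ≤ ∫ x, G x ^ 2 ∂μ) (ht : |t| * b ≤ 1)
    (n : ℕ) :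
    ‖∫ ω, Complex.exp ((t * ∑ i ∈ Finset.range n, G (X i ω) : ℝ) * Complex.I) ∂P‖ ≤
      Real.exp (-(n * t ^ 2 * v / 4)) := by
  have hm : Measurable fun x => Complex.exp ((t * G x : ℝ) * Complex.I) := by fun_prop
  have e : ∀ ω, Complex.exp ((t * ∑ i ∈ Finset.range n, G (X i ω) : ℝ) * Complex.I) =
      ∏ i : Fin n, Complex.exp ((t * G (X i ω) : ℝ) * Complex.I) := by
    intro ω
    rw [← Complex.exp_sum, ← Fin.sum_univ_eq_sum_range (fun i => G (X i ω)), Finset.mul_sum,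
      Complex.ofReal_sum, Finset.sum_mul]
  have hindn : iIndepFun (fun i : Fin n => X i) P := hind.precomp Fin.val_injective
  have hprod := hindn.integral_fun_prod_comp (𝕜 := ℂ)
    (f := fun _ x => Complex.exp ((t * G x : ℝ) * Complex.I))
    (fun i => (hX i).aemeasurable) (fun i => hm.aestronglyMeasurable)
  simp_rw [e]
  rw [hprod, norm_prod]
  have h1 : ∀ i : Fin n, ‖∫ ω, Complex.exp ((t * G (X i ω) : ℝ) * Complex.I) ∂P‖ ≤
      Real.exp (-(t ^ 2 * v / 4)) := by
    intro i
    have h2 := integral_map (μ := P) (hX i).aemeasurable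
      (f := fun x => Complex.exp ((t * G x : ℝ) * Complex.I)) hm.aestronglyMeasurable
    rw [hlaw i] at h2
    rw [← h2]
    exact norm_integral_cexp_le hG hb h0 hv ht
  refine (Finset.prod_le_prod (fun i _ => norm_nonneg _) fun i _ => h1 i).trans_eq ?_
  rw [Finset.prod_const, Finset.card_univ, Fintype.card_fin, ← Real.exp_nat_mul]
  congr 1; ring

variable [IsProbabilityMeasure P]

/-- The bound for the characteristic function at `z / ρ`. -/
def charBound (n : ℕ) (b v ρ z : ℝ) : ℝ :=
  if |z| * b ≤ ρ then Real.exp (-(n * (z / ρ) ^ 2 * v / 4)) else 1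

lemma measurable_charBound (n : ℕ) (b v ρ : ℝ) : Measurable (charBound n b v ρ) := by
  unfold charBound
  refine Measurable.ite (measurableSet_le (by fun_prop) (by fun_prop)) (by fun_prop) (by fun_prop)

lemma charBound_nonneg (n : ℕ) (b v ρ z : ℝ) : 0 ≤ charBound n b v ρ z := by
  unfold charBound; split_ifs <;> positivity

lemma charBound_le_one (n : ℕ) {v : ℝ} (hv : 0 ≤ v) (b ρ z : ℝ) : charBound n b v ρ z ≤ 1 := by
  unfold charBound; split_ifs
  · rw [Real.exp_le_one_iff]
    have : 0 ≤ n * (z / ρ) ^ 2 * v / 4 := by positivity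
    linarith
  · exact le_rfl

/-- Gaussian smoothing: exp(-s²/2) is the characteristic function of the standard normal law, so by
Fubini the mean of exp(-(S/ρ)²/2) averages the characteristic function of S at z/ρ over a normal z.
Markov's inequality then bounds the probability that |S| ≤ ρ. -/
lemma measureReal_abs_sum_le_le (hX : ∀ i, Measurable (X i)) (hind : iIndepFun X P)
    (hlaw : ∀ i, P.map (X i) = μ) {G : E → ℝ} (hG : Measurable G) {b v ρ : ℝ}
    (hb : ∀ x, |G x| ≤ b) (h0 : ∫ x, G x ∂μ = 0) (hv0 : 0 ≤ v) (hv : v ≤ ∫ x, G x ^ 2 ∂μ)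
    (hρ : 0 < ρ) (n : ℕ) :
    P.real {ω | |∑ i ∈ Finset.range n, G (X i ω)| ≤ ρ} ≤
      Real.exp (1 / 2) * ∫ z, charBound n b v ρ z ∂(gaussianReal 0 1) := by
  set S : Ω → ℝ := fun ω => ∑ i ∈ Finset.range n, G (X i ω) with hS
  have hSm : Measurable S := by
    simp only [hS]
    exact Finset.measurable_fun_sum _ fun i _ => hG.comp (hX i)
  set γ := gaussianReal 0 1 with hγ
  have hgauss : ∀ ω, ((Real.exp (-(S ω / ρ) ^ 2 / 2) : ℝ) : ℂ) =
      ∫ z, Complex.exp ((z / ρ * S ω : ℝ) * Complex.I) ∂γ := by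
    intro ω
    have h1 := charFun_gaussianReal (μ := 0) (v := 1) (S ω / ρ)
    rw [charFun_apply_real] at h1
    have e : ∀ z : ℝ, Complex.exp ((z / ρ * S ω : ℝ) * Complex.I) =
        Complex.exp (((S ω / ρ : ℝ) : ℂ) * z * Complex.I) := by
      intro z; congr 1; push_cast; ring
    simp_rw [e]
    rw [h1]
    push_cast
    congr 1
    ring
  have hint : Integrable (Function.uncurry fun (ω : Ω) (z : ℝ) =>
      Complex.exp ((z / ρ * S ω : ℝ) * Complex.I)) (P.prod γ) := by
    have hm : Measurable (Function.uncurry fun (ω : Ω) (z : ℝ) =>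
        Complex.exp ((z / ρ * S ω : ℝ) * Complex.I)) := by
      unfold Function.uncurry; fun_prop
    exact Integrable.of_bound hm.aestronglyMeasurable 1
      (Eventually.of_forall fun x => (Complex.norm_exp_ofReal_mul_I _).le)
  have hcb : Integrable (charBound n b v ρ) γ :=
    integrable_of_abs_le (measurable_charBound n b v ρ) (b := 1) fun z => by
      rw [abs_of_nonneg (charBound_nonneg _ _ _ _ _)]; exact charBound_le_one n hv0 b ρ z
  have hexp : ∫ ω, Real.exp (-(S ω / ρ) ^ 2 / 2) ∂P ≤ ∫ z, charBound n b v ρ z ∂γ := by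
    have h1 : ((∫ ω, Real.exp (-(S ω / ρ) ^ 2 / 2) ∂P : ℝ) : ℂ) =
        ∫ z, ∫ ω, Complex.exp ((z / ρ * S ω : ℝ) * Complex.I) ∂P ∂γ := by
      rw [← integral_complex_ofReal, ← integral_integral_swap hint]
      exact integral_congr_ae (Eventually.of_forall hgauss)
    have h2 : ∫ ω, Real.exp (-(S ω / ρ) ^ 2 / 2) ∂P ≤
        ‖∫ z, ∫ ω, Complex.exp ((z / ρ * S ω : ℝ) * Complex.I) ∂P ∂γ‖ := by
      rw [← h1, Complex.norm_real]; exact le_abs_self _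
    refine h2.trans ((norm_integral_le_integral_norm _).trans ?_)
    refine integral_mono_of_nonneg (Eventually.of_forall fun z => norm_nonneg _) hcb
      (Eventually.of_forall fun z => ?_)
    simp only
    unfold charBound
    split_ifs with hz
    · refine norm_integral_cexp_sum_le hX hind hlaw hG hb h0 hv ?_ n
      rw [abs_div, abs_of_pos hρ, div_mul_eq_mul_div, div_le_one hρ]
      exact hz
    · refine (norm_integral_le_integral_norm _).trans ?_
      simp only [Complex.norm_exp_ofReal_mul_I, integral_const, probReal_univ, smul_eq_mul, mul_one,
        le_refl]
  have hmark := mul_meas_ge_le_integral_of_nonneg (μ := P)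
    (f := fun ω => Real.exp (-(S ω / ρ) ^ 2 / 2)) (Eventually.of_forall fun ω => (Real.exp_pos _).le)
    (by
      refine integrable_of_abs_le (b := 1) (by fun_prop) fun ω => ?_
      rw [abs_of_pos (Real.exp_pos _), Real.exp_le_one_iff]
      nlinarith [sq_nonneg (S ω / ρ)]) (Real.exp (-(1 / 2)))
  have hsub : P.real {ω | |S ω| ≤ ρ} ≤
      P.real {ω | Real.exp (-(1 / 2)) ≤ Real.exp (-(S ω / ρ) ^ 2 / 2)} := by
    refine measureReal_mono fun ω hω => ?_
    have hω' : |S ω| ≤ ρ := hω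
    change Real.exp (-(1 / 2)) ≤ Real.exp (-(S ω / ρ) ^ 2 / 2)
    rw [Real.exp_le_exp]
    have h1 : |S ω / ρ| ≤ 1 := by rw [abs_div, abs_of_pos hρ, div_le_one hρ]; exact hω'
    have h2 : (S ω / ρ) ^ 2 ≤ 1 := by rw [← sq_abs]; nlinarith [abs_nonneg (S ω / ρ)]
    linarith
  have hee : Real.exp (1 / 2) * Real.exp (-(1 / 2)) = 1 := by rw [← Real.exp_add]; simp
  calc P.real {ω | |S ω| ≤ ρ}
      ≤ Real.exp (1 / 2) * (Real.exp (-(1 / 2)) *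
          P.real {ω | Real.exp (-(1 / 2)) ≤ Real.exp (-(S ω / ρ) ^ 2 / 2)}) := by
        rw [← mul_assoc, hee, one_mul]; exact hsub
    _ ≤ _ := by gcongr; exact hmark.trans hexp

/-- Sums of independent, identically distributed, centered and bounded terms are unlikely to be
small compared to their standard deviation. -/
theorem tendsto_measure_abs_sum_le (hX : ∀ i, Measurable (X i)) (hind : iIndepFun X P)
    (hlaw : ∀ i, P.map (X i) = μ) {F : ℕ → E → ℝ} {b v ρ : ℕ → ℝ}
    (hF : ∀ᶠ n in atTop, Measurable (F n)) (hb : ∀ᶠ n in atTop, ∀ x, |F n x| ≤ b n)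
    (hv0 : ∀ᶠ n in atTop, 0 ≤ v n)
    (hv : ∀ᶠ n in atTop, v n ≤ ∫ x, F n x ^ 2 ∂μ - (∫ x, F n x ∂μ) ^ 2)
    (hρ : ∀ᶠ n in atTop, 0 < ρ n) (hbρ : Tendsto (fun n => b n / ρ n) atTop (𝓝 0))
    (hvρ : Tendsto (fun n : ℕ => n * v n / ρ n ^ 2) atTop atTop) :
    Tendsto (fun n : ℕ => P {ω |
      |∑ i ∈ Finset.range n, F n (X i ω) - n * ∫ y, F n y ∂μ| ≤ ρ n}) atTop (𝓝 0) := by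
  have hlim : Tendsto (fun n : ℕ => ∫ z, charBound n (2 * b n) (v n) (ρ n) z ∂(gaussianReal 0 1))
      atTop (𝓝 0) := by
    suffices h0 : Tendsto (fun n : ℕ => ∫ z, charBound n (2 * b n) (v n) (ρ n) z ∂(gaussianReal 0 1))
        atTop (𝓝 (∫ _z : ℝ, (0 : ℝ) ∂(gaussianReal 0 1))) by rwa [integral_zero] at h0
    refine tendsto_integral_filter_of_dominated_convergence (μ := gaussianReal 0 1) (fun _ => 1)
      (Eventually.of_forall fun n => (measurable_charBound _ _ _ _).aestronglyMeasurable) ?_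
      (integrable_const 1) ?_
    · filter_upwards [hv0] with n hn
      refine Eventually.of_forall fun z => ?_
      rw [Real.norm_eq_abs, abs_of_nonneg (charBound_nonneg _ _ _ _ _)]
      exact charBound_le_one n hn _ _ z
    -- At z = 0 the bound does not decay; everywhere else it tends to zero, since eventually |z| · 2
    -- b ≤ ρ and n v / ρ² tends to infinity.
    · have hne : ∀ᵐ z ∂(gaussianReal 0 1), z ≠ 0 := by
        have := nullSingletonClass_gaussianReal (μ := 0) (v := 1) one_ne_zero
        exact Measure.ae_ne _ 0
      filter_upwards [hne] with z hz
      have h1 : Tendsto (fun n : ℕ => Real.exp (-(z ^ 2 / 4 * (n * v n / ρ n ^ 2)))) atTop (𝓝 0) :=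
        Real.tendsto_exp_neg_atTop_nhds_zero.comp (hvρ.const_mul_atTop (by positivity))
      refine h1.congr' ?_
      have h2 : Tendsto (fun n => |z| * 2 * (b n / ρ n)) atTop (𝓝 0) := by
        simpa using hbρ.const_mul (|z| * 2)
      filter_upwards [h2.eventually (eventually_le_nhds zero_lt_one), hρ] with n hn hρn
      rw [charBound, if_pos]
      · congr 1; rw [div_pow]; ring
      · rw [← mul_div_assoc, div_le_one hρn] at hn
        linarith
  have hlim' := (hlim.const_mul (Real.exp (1 / 2)))
  rw [mul_zero] at hlim'
  have hlim'' := ENNReal.tendsto_ofReal hlim'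
  rw [ENNReal.ofReal_zero] at hlim''
  refine tendsto_of_tendsto_of_tendsto_of_le_of_le' tendsto_const_nhds hlim''
    (Eventually.of_forall fun _ => zero_le) ?_
  filter_upwards [hF, hb, hv0, hv, hρ] with n hF hb hv0 hv hρ
  have hFi := integrable_of_abs_le (μ := μ) hF hb
  have hF2 : Integrable (fun x => F n x ^ 2) μ :=
    integrable_of_abs_le (b := b n ^ 2) (hF.pow_const 2) fun x => by
      rw [abs_pow]; exact pow_le_pow_left₀ (abs_nonneg _) (hb x) 2
  set m := ∫ y, F n y ∂μ with hm
  have hmb : |m| ≤ b n := abs_integral_le_of_abs_le hb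
  have key := measureReal_abs_sum_le_le hX hind hlaw (G := fun x => F n x - m) (b := 2 * b n)
    (hF.sub_const m) (fun x => (abs_sub _ _).trans (by linarith [hb x])) (by
      rw [integral_sub hFi (integrable_const m)]; simp [hm]) hv0 (hv.trans_eq (by
      have e : (fun x => (F n x - m) ^ 2) = fun x => F n x ^ 2 - 2 * m * F n x + m ^ 2 := by
        ext x; ring
      have i1 : Integrable (fun x => F n x ^ 2 - 2 * m * F n x) μ := hF2.sub (hFi.const_mul _)
      rw [e, integral_add i1 (integrable_const _),
        integral_sub hF2 (hFi.const_mul _), integral_const_mul, ← hm]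
      simp only [integral_const, probReal_univ, one_smul]
      ring)) hρ n
  have e2 : ∀ ω, ∑ i ∈ Finset.range n, (F n (X i ω) - m) =
      ∑ i ∈ Finset.range n, F n (X i ω) - n * m := by
    intro ω; rw [Finset.sum_sub_distrib]; simp
  simp only [e2] at key
  rw [← ofReal_measureReal]
  exact ENNReal.ofReal_le_ofReal key

end AntiConcentration

/-! ### The linearized error is not too small -/

section SecondOrder

variable {K f : Plane → ℝ}

lemma integral_partialDeriv_mul {φ g : Plane → ℝ} (hφ : ∀ z, 1 < ‖z‖ → φ z = 0) (i : Fin 2)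
    (hφd : Differentiable ℝ φ) (hφc : Continuous (partialDeriv i φ)) (hg : Differentiable ℝ g)
    (hgc : Continuous (partialDeriv i g)) :
    ∫ z, partialDeriv i φ z * g z = -∫ z, φ z * partialDeriv i g z := by
  -- At scale -1 and centre 0, `conv` is the plain pairing of φ with g.
  have := conv_partialDeriv hφ i hφd hφc hg hgc (-1) 0
  simpa [conv] using this

lemma hasFDerivAt_apply (k : Fin 2) (z : Plane) :
    HasFDerivAt (fun z : Plane => z k) (EuclideanSpace.proj k : Plane →L[ℝ] ℝ) z :=
  (EuclideanSpace.proj k : Plane →L[ℝ] ℝ).hasFDerivAt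

lemma partialDeriv_apply (i k : Fin 2) :
    partialDeriv i (fun z : Plane => z k) = fun _ => if k = i then 1 else 0 := by
  ext z
  rw [partialDeriv, (hasFDerivAt_apply k z).fderiv]
  simp

lemma partialDeriv_apply_mul_apply (i k l : Fin 2) :
    partialDeriv i (fun z : Plane => z k * z l) =
      fun z => (if k = i then z l else 0) + if l = i then z k else 0 := by
  ext z
  rw [partialDeriv, ((hasFDerivAt_apply k z).fun_mul (hasFDerivAt_apply l z)).fderiv]
  simp
  ring

lemma KernelAssumptions.integral_pd_one_mul (hK : KernelAssumptions K) (i k : Fin 2) :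
    ∫ z, partialDeriv i K z * z k = -(if k = i then 1 else 0) := by
  have h1 := integral_partialDeriv_mul (φ := K) (g := fun z => z k)
    (fun z hz => hK.pd_eq_zero [] z hz) i (hK.tame.diff [] (by simp))
    (hK.continuous_pd (l := [i]) (by simp)) (fun z => (hasFDerivAt_apply k z).differentiableAt)
    (by rw [partialDeriv_apply]; exact continuous_const)
  rw [h1, partialDeriv_apply]
  split_ifs
  · simp [hK.integral_one]
  · simp

lemma KernelAssumptions.integrable_pd_mul (hK : KernelAssumptions K) {l : List (Fin 2)}
    (hl : l.length ≤ 3) {u : Plane → ℝ} (hu : Continuous u) : Integrable fun z => pd l K z * u z :=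
  Continuous.integrable_of_hasCompactSupport ((hK.continuous_pd hl).mul hu)
    (hasCompactSupport_of_ball fun z hz => by rw [hK.pd_eq_zero l z hz, zero_mul])

/-- Two integrations by parts turn the moment into a second derivative of a quadratic monomial times
∫ K = 1. -/
lemma KernelAssumptions.integral_pd_two_mul (hK : KernelAssumptions K) (i j k l : Fin 2) :
    ∫ z, pd [i, j] K z * (z k * z l) =
      (if k = i ∧ l = j then 1 else 0) + if l = i ∧ k = j then 1 else 0 := by
  have hc : Continuous (partialDeriv i fun z : Plane => z k * z l) := by
    rw [partialDeriv_apply_mul_apply]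
    split_ifs <;> fun_prop
  have h1 := integral_partialDeriv_mul (φ := pd [j] K) (g := fun z => z k * z l)
    (hK.pd_eq_zero [j]) i (hK.tame.diff [j] (by simp))
    (hK.continuous_pd (l := [i, j]) (by simp))
    (fun z => ((hasFDerivAt_apply k z).fun_mul (hasFDerivAt_apply l z)).differentiableAt) hc
  have h2 : ∀ m : Fin 2, ∫ z, pd [j] K z * z m = -(if m = j then 1 else 0) :=
    fun m => hK.integral_pd_one_mul j m
  have i1 : ∀ (p : Prop) [Decidable p] (m : Fin 2),
      Integrable fun z : Plane => pd [j] K z * if p then z m else 0 := fun p _ m =>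
    hK.integrable_pd_mul (by simp) (by split_ifs <;> fun_prop)
  have h3 : ∀ (p : Prop) [Decidable p] (m : Fin 2),
      ∫ z : Plane, pd [j] K z * (if p then z m else 0) = -(if p ∧ m = j then 1 else 0) := by
    intro p _ m
    by_cases hp : p
    · simp only [hp, if_true, true_and]; exact h2 m
    · simp [hp]
  rw [pd_cons, h1, partialDeriv_apply_mul_apply]
  simp only [mul_add]
  rw [integral_add (i1 _ _) (i1 _ _), h3, h3]
  ring

/-- The linear combination of the second derivatives with coefficients `c`. -/
def secondComb (c : Fin 3 → ℝ) (g : Plane → ℝ) (z : Plane) : ℝ :=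
  c 0 * pd [0, 0] g z + c 1 * pd [0, 1] g z + c 2 * pd [1, 1] g z

lemma KernelAssumptions.continuous_secondComb (hK : KernelAssumptions K) (c : Fin 3 → ℝ) :
    Continuous (secondComb c K) := by
  have h1 := hK.continuous_pd (l := [0, 0]) (by simp)
  have h2 := hK.continuous_pd (l := [0, 1]) (by simp)
  have h3 := hK.continuous_pd (l := [1, 1]) (by simp)
  unfold secondComb
  fun_prop

lemma KernelAssumptions.secondComb_eq_zero (hK : KernelAssumptions K) (c : Fin 3 → ℝ) (z : Plane)
    (hz : 1 < ‖z‖) : secondComb c K z = 0 := by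
  simp only [secondComb, hK.pd_eq_zero _ z hz, mul_zero, add_zero]

lemma KernelAssumptions.integral_secondComb_mul (hK : KernelAssumptions K) (c : Fin 3 → ℝ)
    (k l : Fin 2) : ∫ z, secondComb c K z * (z k * z l) =
      c 0 * (∫ z, pd [0, 0] K z * (z k * z l)) + c 1 * (∫ z, pd [0, 1] K z * (z k * z l)) +
        c 2 * ∫ z, pd [1, 1] K z * (z k * z l) := by
  have hu : Continuous fun z : Plane => z k * z l := by fun_prop
  have i0 := (hK.integrable_pd_mul (l := [0, 0]) (by simp) hu).const_mul (c 0)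
  have i1 := (hK.integrable_pd_mul (l := [0, 1]) (by simp) hu).const_mul (c 1)
  have i2 := (hK.integrable_pd_mul (l := [1, 1]) (by simp) hu).const_mul (c 2)
  have i01 : Integrable fun z => c 0 * (pd [0, 0] K z * (z k * z l)) +
      c 1 * (pd [0, 1] K z * (z k * z l)) := i0.add i1
  rw [← integral_const_mul, ← integral_const_mul, ← integral_const_mul, ← integral_add i0 i1,
    ← integral_add i01 i2]
  congr 1; ext z
  rw [secondComb]; ring

/-- The second derivatives of a kernel are linearly independent. -/
lemma KernelAssumptions.exists_secondComb_ne_zero (hK : KernelAssumptions K) {c : Fin 3 → ℝ}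
    (hc : c ≠ 0) : ∃ z, secondComb c K z ≠ 0 := by
  by_contra! h
  -- Pairing with the three quadratic monomials isolates 2 c₀, c₁ and 2 c₂.
  have key : ∀ k l : Fin 2, c 0 * (∫ z, pd [0, 0] K z * (z k * z l)) +
      c 1 * (∫ z, pd [0, 1] K z * (z k * z l)) + c 2 * ∫ z, pd [1, 1] K z * (z k * z l) = 0 := by
    intro k l
    rw [← hK.integral_secondComb_mul c k l]
    simp [h]
  simp only [hK.integral_pd_two_mul] at key
  refine hc (funext fun i => ?_)
  have h00 := key 0 0
  have h01 := key 0 1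
  have h11 := key 1 1
  norm_num at h00 h01 h11
  fin_cases i
  · exact h00
  · exact h01
  · exact h11

lemma KernelAssumptions.integral_secondComb_sq_pos (hK : KernelAssumptions K) {c : Fin 3 → ℝ}
    (hc : c ≠ 0) : 0 < ∫ z, secondComb c K z ^ 2 := by
  obtain ⟨z, hz⟩ := hK.exists_secondComb_ne_zero hc
  exact ((hK.continuous_secondComb c).pow 2).integral_pos_of_hasCompactSupport_nonneg_nonzero
    (hasCompactSupport_of_ball fun z hz => by
      rw [Pi.pow_apply, hK.secondComb_eq_zero c z hz]; norm_num)
    (fun z => sq_nonneg _) (pow_ne_zero 2 hz)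

/-- The contribution of an observation to the linear combination of second derivatives. -/
def combTerm (K : Plane → ℝ) (c : Fin 3 → ℝ) (h : ℝ) (n : ℕ) (y ξ : Plane) : ℝ :=
  1 / (n * h ^ 4) * secondComb c K (h⁻¹ • (y - ξ))

lemma combTerm_eq (c : Fin 3 → ℝ) {h : ℝ} (hh : 0 < h) {n : ℕ} (y ξ : Plane) :
    combTerm K c h n y ξ = c 0 * kernTerm K [0, 0] h n y ξ + c 1 * kernTerm K [0, 1] h n y ξ +
      c 2 * kernTerm K [1, 1] h n y ξ := by
  have e : 1 / ((n : ℝ) * h ^ 4) = 1 / (n * h ^ 2) * (h⁻¹) ^ 2 := by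
    rw [inv_pow]; field_simp
  simp only [combTerm, secondComb, kernTerm, List.length_cons, List.length_nil, e]
  ring

/-- Continuity of f at y bounds the second moment below by f(y)/2 times the L² mass of the
combination, over n² h⁶. The squared mean is smaller by a factor of order h², and half of that lower
bound absorbs it for small h. -/
lemma exists_variance_combTerm_ge (hK : KernelAssumptions K) (hf : DensityAssumptions f)
    {c : Fin 3 → ℝ} (hc : c ≠ 0) {y : Plane} (hy : 0 < f y) {B : ℝ}
    (hB : ∀ z, |secondComb c K z| ≤ B) :
    ∃ v > 0, ∃ δ > 0, ∀ (h : ℝ) (n : ℕ), 0 < h → h ≤ δ → 1 ≤ n → v / (n ^ 2 * h ^ 6) ≤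
      ∫ ξ, combTerm K c h n y ξ ^ 2 ∂(densityMeasure f) -
        (∫ ξ, combTerm K c h n y ξ ∂(densityMeasure f)) ^ 2 := by
  have hψ := hK.continuous_secondComb c
  have hψ0 := hK.secondComb_eq_zero c
  obtain ⟨C, hC, hint⟩ := exists_integral_scaled_le hf ‖y‖
  set I := ∫ z, secondComb c K z ^ 2 with hI
  have hIp : 0 < I := hK.integral_secondComb_sq_pos hc
  have hB0 : 0 ≤ B := (abs_nonneg _).trans (hB 0)
  obtain ⟨δ₁, hδ₁, hnear⟩ := Metric.eventually_nhds_iff_ball.1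
    (hf.continuous.continuousAt.eventually (lt_mem_nhds (half_lt_self hy)))
  set v := f y / 2 * I / 2 with hv
  have hvp : 0 < v := by positivity
  have hsmall : Tendsto (fun h : ℝ => (C * B * h) ^ 2) (𝓝 0) (𝓝 0) := by
    have : Continuous fun h : ℝ => (C * B * h) ^ 2 := by fun_prop
    simpa using this.tendsto 0
  obtain ⟨δ₂, hδ₂, hs⟩ := Metric.eventually_nhds_iff_ball.1
    (hsmall.eventually (eventually_le_nhds hvp))
  refine ⟨v, hvp, min (min (δ₁ / 2) (δ₂ / 2)) 1, by positivity, fun h n hh hhδ hn => ?_⟩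
  have hn0 : (0 : ℝ) < n := by exact_mod_cast hn
  have hh1 : h ≤ 1 := hhδ.trans (min_le_right _ _)
  have hhδ₁ : h < δ₁ := by
    have := hhδ.trans ((min_le_left _ _).trans (min_le_left _ _)); linarith
  have hhδ₂ : h < δ₂ := by
    have := hhδ.trans ((min_le_left _ _).trans (min_le_right _ _)); linarith
  have h1 : ∫ ξ, combTerm K c h n y ξ ^ 2 ∂(densityMeasure f) =
      1 / (n ^ 2 * h ^ 6) * ∫ z, secondComb c K z ^ 2 * f (y - h • z) := by
    have e : (fun ξ => combTerm K c h n y ξ ^ 2 * f ξ) = fun ξ =>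
        (1 / (n * h ^ 4)) ^ 2 * (secondComb c K (h⁻¹ • (y - ξ)) ^ 2 * f ξ) := by
      ext ξ; rw [combTerm]; ring
    rw [integral_densityMeasure hf, e, integral_const_mul,
      integral_scaled (fun z => secondComb c K z ^ 2) _ hh, conv, ← mul_assoc]
    congr 1
    field_simp
  have h2 : f y / 2 * I ≤ ∫ z, secondComb c K z ^ 2 * f (y - h • z) := by
    have hcs : ∀ u : Plane → ℝ, Continuous u → Integrable fun z => secondComb c K z ^ 2 * u z :=
      fun u hu => Continuous.integrable_of_hasCompactSupport ((hψ.pow 2).mul hu)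
        (hasCompactSupport_of_ball fun z hz => by rw [hψ0 z hz]; ring)
    have hfc := hf.continuous
    rw [hI, mul_comm, ← integral_mul_const]
    refine integral_mono (hcs _ continuous_const) (hcs _ (by fun_prop)) fun z => ?_
    rcases le_or_gt ‖z‖ 1 with hz | hz
    · refine mul_le_mul_of_nonneg_left (hnear _ ?_).le (sq_nonneg _)
      rw [Metric.mem_ball, dist_eq_norm, sub_sub_cancel_left, norm_neg, norm_smul,
        Real.norm_eq_abs, abs_of_pos hh]
      nlinarith
    · simp only [hψ0 z hz]
      norm_num
  have h3 : (∫ ξ, combTerm K c h n y ξ ∂(densityMeasure f)) ^ 2 ≤ v / (n ^ 2 * h ^ 6) := by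
    have h4 := hint (secondComb c K) B hψ hψ0 hB y (by simp) h hh hh1
    have h5 := hs h (by rw [Metric.mem_ball, Real.dist_eq, sub_zero, abs_of_pos hh]; exact hhδ₂)
    unfold combTerm
    rw [integral_const_mul, mul_pow, ← sq_abs (∫ ξ, _ ∂_)]
    calc _ ≤ (1 / (n * h ^ 4)) ^ 2 * (C * B * h ^ 2) ^ 2 := by gcongr
      _ = (C * B * h) ^ 2 / (n ^ 2 * h ^ 6) := by field_simp
      _ ≤ _ := by gcongr
  rw [h1]
  have h6 : 1 / (n ^ 2 * h ^ 6) * (f y / 2 * I) ≤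
      1 / (n ^ 2 * h ^ 6) * ∫ z, secondComb c K z ^ 2 * f (y - h • z) := by gcongr
  have h7 : 1 / (n ^ 2 * h ^ 6) * (f y / 2 * I) = v / (n ^ 2 * h ^ 6) + v / (n ^ 2 * h ^ 6) := by
    rw [hv]; ring
  linarith

variable {Ω : Type*} [MeasurableSpace Ω] {P : Measure Ω} [IsProbabilityMeasure P]
  {h : ℕ → ℝ} {X : ℕ → Ω → Plane}

/-- A linear combination of the errors of the second derivatives at a point exceeds the rate in
probability. -/
theorem tendsto_measure_secondComb_le (hf : DensityAssumptions f) (hK : KernelAssumptions K)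
    (hX : IsSample P f X) (hh : BandwidthAssumptions h) {c : Fin 3 → ℝ} (hc : c ≠ 0) {y : Plane}
    (hy : 0 < f y) {M : ℝ} (hM : 0 < M) :
    Tendsto (fun n => P {ω | |secondComb c (fHat K h X n ω) y - secondComb c f y| ≤ M * rate h n})
      atTop (𝓝 0) := by
  obtain ⟨B₀, hB₀, hbB, -⟩ := hK.exists_bound
  obtain ⟨D, hD, hbias⟩ := exists_bias_le hK hf
  obtain ⟨C, hC, hgood⟩ := hh.eventually_good
  have hprob := hX.isProbabilityMeasure
  set s := |c 0| + |c 1| + |c 2| with hs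
  have hs0 : 0 ≤ s := by positivity
  have hcomb : ∀ a₀ a₁ a₂ E : ℝ, |a₀| ≤ E → |a₁| ≤ E → |a₂| ≤ E →
      |c 0 * a₀ + c 1 * a₁ + c 2 * a₂| ≤ s * E := by
    intro a₀ a₁ a₂ E h0 h1 h2
    refine (abs_add_three _ _ _).trans ?_
    rw [abs_mul, abs_mul, abs_mul, hs, add_mul, add_mul]
    gcongr
  set B := s * B₀ with hBdef
  have hB : ∀ z, |secondComb c K z| ≤ B := fun z =>
    hcomb _ _ _ _ (hbB _ (by simp) (by simp) z) (hbB _ (by simp) (by simp) z)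
      (hbB _ (by simp) (by simp) z)
  have hB0 : 0 ≤ B := by positivity
  obtain ⟨v, hv, δ, hδ, hvar⟩ := exists_variance_combTerm_ge hK hf hc hy hB
  -- The extra constant pays for the bias, which is at most s D h² ≤ s D C times the rate.
  set M' := M + s * D * C with hM'
  have hM'p : 0 < M' := by positivity
  have key := tendsto_measure_abs_sum_le (P := P) (X := X) (μ := densityMeasure f) hX.measurable
    hX.indep hX.law
    (F := fun n ξ => combTerm K c (h n) n y ξ) (b := fun n => B / (n * h n ^ 4))
    (v := fun n => v / (n ^ 2 * h n ^ 6)) (ρ := fun n => M' * rate h n)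
    (Eventually.of_forall fun n => by
      have := hK.continuous_secondComb c
      unfold combTerm
      have : Continuous fun ξ => 1 / (n * h n ^ 4) * secondComb c K ((h n)⁻¹ • (y - ξ)) := by
        fun_prop
      exact this.measurable)
    (by
      filter_upwards [hgood 1] with n hn ξ
      rw [combTerm, abs_mul, abs_of_pos (one_div_pos.2 (hn.pos_mul 4)), div_eq_mul_one_div B,
        mul_comm]
      have := hn.pos_mul 4
      gcongr
      exact hB _)
    (by
      filter_upwards [hgood 1] with n hn
      have := hn.pos
      positivity)
    (by
      filter_upwards [hgood 1, hh.tendsto_zero.eventually (eventually_le_nhds hδ)] with n hn hnδ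
      exact hvar _ _ hn.pos hnδ hn.one_le)
    ((hgood 1).mono fun n hn => mul_pos hM'p hn.rate_pos)
    (by
      have h1 : Tendsto (fun n => B / M' * h n) atTop (𝓝 0) := by
        simpa using hh.tendsto_zero.const_mul (B / M')
      refine squeeze_zero' ?_ ?_ h1
      · filter_upwards [hgood 1] with n hn
        have := hn.rate_pos
        have := hn.pos
        positivity
      · filter_upwards [hgood 1] with n hn
        have hp := hn.pos
        have hl := hn.one_le_log
        have hn0 : (0 : ℝ) < n := by have := hn.one_le; positivity
        have e : B / (n * h n ^ 4) / (M' * rate h n) = B / M' * (h n ^ 3 / Real.log n) := by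
          rw [rate]; field_simp
        rw [e]
        gcongr
        rw [div_le_iff₀ (by linarith)]
        calc h n ^ 3 ≤ h n := pow_le_of_le_one hp.le hn.le_one (by norm_num)
          _ ≤ h n * Real.log n := le_mul_of_one_le_right hp.le hl)
    (by
      -- n v / ρ² is a multiple of n h⁸ / (log n)², so the lower bandwidth condition makes the
      -- pointwise fluctuation dominate the rate.
      refine tendsto_atTop_mono' _ ?_ (hh.not_too_small.const_mul_atTop
        (show 0 < v / M' ^ 2 by positivity))
      filter_upwards [hgood 1] with n hn
      have hp := hn.pos
      have hl := hn.one_le_log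
      have hn0 : (0 : ℝ) < n := by have := hn.one_le; positivity
      have e : n * (v / (n ^ 2 * h n ^ 6)) / (M' * rate h n) ^ 2 =
          v / M' ^ 2 * (n * h n ^ 8 / Real.log n ^ 2) := by
        rw [rate]; field_simp
      rw [e]
      gcongr
      norm_num)
  refine tendsto_measure_of_eventually_subset ?_ key
  filter_upwards [hgood 1] with n hn ω hω
  simp only [Set.mem_ofPred_eq] at hω ⊢
  have hsym : pd [0, 1].reverse f = pd [0, 1] f := by
    simp only [List.reverse_cons, List.reverse_nil, List.nil_append, List.cons_append, pd_cons,
      pd_nil]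
    exact partialDeriv_comm (hf.smooth.of_le (by norm_num)) 1 0
  have hsum : ∑ i ∈ Finset.range n, combTerm K c (h n) n y (X i ω) =
      secondComb c (fHat K h X n ω) y := by
    simp only [combTerm_eq c hn.pos, Finset.sum_add_distrib, ← Finset.mul_sum, secondComb, fHat]
    rw [hK.pd_kde _ _ _ [0, 0] (by simp), hK.pd_kde _ _ _ [0, 1] (by simp),
      hK.pd_kde _ _ _ [1, 1] (by simp)]
  have hkint : ∀ l : List (Fin 2), 1 ≤ l.length → l.length ≤ 3 →
      Integrable (fun ξ => kernTerm K l (h n) n y ξ) (densityMeasure f) := by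
    intro l h1 hl
    have h2 := continuous_kernTerm hK hl (h := h n) (n := n)
    have h3 : Continuous fun ξ => kernTerm K l (h n) n y ξ := by fun_prop
    exact integrable_of_abs_le h3.measurable fun ξ =>
      abs_kernTerm_le (hbB l h1 hl) hn.pos hn.one_le y ξ
  have hmean : n * ∫ ξ, combTerm K c (h n) n y ξ ∂(densityMeasure f) =
      c 0 * conv K (pd [0, 0] f) (h n) y + c 1 * conv K (pd [0, 1] f) (h n) y +
        c 2 * conv K (pd [1, 1] f) (h n) y := by
    have i0 := (hkint [0, 0] (by simp) (by simp)).const_mul (c 0)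
    have i1 := (hkint [0, 1] (by simp) (by simp)).const_mul (c 1)
    have i2 := (hkint [1, 1] (by simp) (by simp)).const_mul (c 2)
    have i01 : Integrable (fun ξ => c 0 * kernTerm K [0, 0] (h n) n y ξ +
      c 1 * kernTerm K [0, 1] (h n) n y ξ) (densityMeasure f) := i0.add i1
    have k0 := integral_kernTerm hK hf (l := [0, 0]) (by simp) hn.pos hn.one_le y
    have k1 := integral_kernTerm hK hf (l := [0, 1]) (by simp) hn.pos hn.one_le y
    have k2 := integral_kernTerm hK hf (l := [1, 1]) (by simp) hn.pos hn.one_le y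
    rw [hsym] at k1
    rw [show pd [0, 0].reverse f = pd [0, 0] f from rfl] at k0
    rw [show pd [1, 1].reverse f = pd [1, 1] f from rfl] at k2
    simp only [combTerm_eq c hn.pos]
    rw [integral_add i01 i2, integral_add i0 i1, integral_const_mul, integral_const_mul,
      integral_const_mul, ← k0, ← k1, ← k2]
    ring
  have hb : |n * ∫ ξ, combTerm K c (h n) n y ξ ∂(densityMeasure f) - secondComb c f y| ≤
      s * (D * h n ^ 2) := by
    have e : n * ∫ ξ, combTerm K c (h n) n y ξ ∂(densityMeasure f) - secondComb c f y =
        c 0 * (conv K (pd [0, 0] f) (h n) y - pd [0, 0] f y) +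
        c 1 * (conv K (pd [0, 1] f) (h n) y - pd [0, 1] f y) +
        c 2 * (conv K (pd [1, 1] f) (h n) y - pd [1, 1] f y) := by
      rw [hmean, secondComb]; ring
    rw [e]
    exact hcomb _ _ _ _ (hbias _ (by simp) _ _) (hbias _ (by simp) _ _) (hbias _ (by simp) _ _)
  have hb' : s * (D * h n ^ 2) ≤ s * D * C * rate h n := by
    have := hn.sq_le_rate hC.le
    calc s * (D * h n ^ 2) ≤ s * (D * (C * rate h n)) := by gcongr
      _ = _ := by ring
  rw [hsum]
  have e : secondComb c (fHat K h X n ω) y -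
      n * ∫ ξ, combTerm K c (h n) n y ξ ∂(densityMeasure f) =
      (secondComb c (fHat K h X n ω) y - secondComb c f y) -
      (n * ∫ ξ, combTerm K c (h n) n y ξ ∂(densityMeasure f) - secondComb c f y) := by ring
  rw [e]
  refine (abs_sub _ _).trans ?_
  rw [hM', add_mul]
  linarith

lemma inner_linErr (f g : Plane → ℝ) (x W : Plane) : inner ℝ W (linErr f g x) =
    secondComb (linCoef (d20 f x) (d11 f x) (d02 f x) W) g x -
      secondComb (linCoef (d20 f x) (d11 f x) (d02 f x) W) f x := by
  rw [linErr, inner_linG, secondComb, secondComb, d20_eq, d11_eq, d02_eq, d20_eq, d11_eq, d02_eq]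
  ring

end SecondOrder

/-! ### Orthogonal decomposition of the error -/

lemma norm_sq_eq_plane (x : Plane) : ‖x‖ ^ 2 = x 0 ^ 2 + x 1 ^ 2 := by
  rw [EuclideanSpace.norm_sq_eq]; simp

/-- The expansion of a vector in an orthogonal basis of the plane. -/
lemma norm_le_of_orthogonal {v w : Plane} (hv : v ≠ 0) (hw : w ≠ 0) (h : inner ℝ v w = 0)
    (e : Plane) : ‖e‖ ≤ |inner ℝ e v| / ‖v‖ + |inner ℝ e w| / ‖w‖ := by
  have hv' : 0 < ‖v‖ := norm_pos_iff.2 hv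
  have hw' : 0 < ‖w‖ := norm_pos_iff.2 hw
  have key : ‖e‖ ^ 2 * (‖v‖ ^ 2 * ‖w‖ ^ 2) =
      inner ℝ e v ^ 2 * ‖w‖ ^ 2 + inner ℝ e w ^ 2 * ‖v‖ ^ 2 := by
    have hgram : ‖e‖ ^ 2 * (‖v‖ ^ 2 * ‖w‖ ^ 2 - inner ℝ v w ^ 2) = inner ℝ e v ^ 2 * ‖w‖ ^ 2 +
        inner ℝ e w ^ 2 * ‖v‖ ^ 2 - 2 * (inner ℝ e v * inner ℝ e w * inner ℝ v w) := by
      simp only [norm_sq_eq_plane, inner_eq]; ring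
    rw [h] at hgram
    linarith
  refine abs_le_of_sq_le_sq' ?_ (by positivity) |>.2
  have e1 : ‖e‖ ^ 2 = (|inner ℝ e v| / ‖v‖) ^ 2 + (|inner ℝ e w| / ‖w‖) ^ 2 := by
    rw [div_pow, div_pow, sq_abs, sq_abs]
    field_simp
    linarith
  rw [e1]
  have : 0 ≤ |inner ℝ e v| / ‖v‖ * (|inner ℝ e w| / ‖w‖) := by positivity
  nlinarith

/-- By symmetry of the Hessian, the two eigenvalue equations combine to (λ₂ - λ₁)⟨V, W⟩ = 0. The
case V = 0 needs no separate treatment. -/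
lemma IsFirstEigenvector.inner_V_eq_zero {g : Plane → ℝ} {x W : Plane}
    (h : IsFirstEigenvector g x W) (hne : lam2 g x ≠ lam1 g x) : inner ℝ (V g x) W = 0 := by
  have h1 := h.apply_eq_smul
  have h2 := congrArg (fun z : Plane => z 0) h1
  have h3 := congrArg (fun z : Plane => z 1) h1
  simp [hessian, Matrix.toLpLin_apply, dotProduct, Fin.sum_univ_two] at h2 h3
  have h4 := eigenG_eigen_zero (d20 g x) (d11 g x) (d02 g x)
  have h5 := eigenG_eigen_one (d20 g x) (d11 g x) (d02 g x)
  have e0 : lam2 g x = (d20 g x + d02 g x - gap (d20 g x) (d11 g x) (d02 g x)) / 2 := lam2_eq g x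
  rw [← e0] at h4 h5
  rw [inner_eq, V]
  set v0 := eigenG (d20 g x) (d11 g x) (d02 g x) 0
  set v1 := eigenG (d20 g x) (d11 g x) (d02 g x) 1
  have key : (lam2 g x - lam1 g x) * (v0 * W 0 + v1 * W 1) = 0 := by
    linear_combination -W 0 * h4 - W 1 * h5 + v0 * h2 + v1 * h3
  exact (mul_eq_zero.1 key).resolve_left (sub_ne_zero.2 hne)

/-! ### Transfer of the perturbation bounds to the estimate -/

section Main

variable {Ω : Type*} [MeasurableSpace Ω] {P : Measure Ω} [IsProbabilityMeasure P]
  {f K : Plane → ℝ} {H L : Set Plane} {a : ℝ} {h : ℕ → ℝ} {X : ℕ → Ω → Plane}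
  {θhat : ℕ → Ω → Plane → ℝ}

/-- With probability tending to one, the error is bounded uniformly, and it determines the
linearized error up to the rate. -/
lemma exists_tendsto_error_bounds (hf : DensityAssumptions f) (hL : FilamentAssumptions f H L a)
    (hK : KernelAssumptions K) (hh : BandwidthAssumptions h) (hX : IsSample P f X)
    (hθ : ∀ n ω, ∀ x₀ ∈ startSet f L a,
      IsArgminChoice (ridgeTimes (fHat K h X n ω) x₀) (θhat n ω x₀)) :
    ∃ C > 0, Tendsto (fun n => P {ω | ¬ ∀ x₀ ∈ startSet f L a,
      (∀ W, inner ℝ (V f (filamentPoint f x₀)) W = 0 →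
        |inner ℝ (filamentError f K h X θhat n ω x₀) W| ≤ C * rate h n * ‖W‖) ∧
      |inner ℝ (gradient f (filamentPoint f x₀))
        (linErr f (fHat K h X n ω) (filamentPoint f x₀))| ≤
        C * (‖filamentError f K h X θhat n ω x₀‖ + rate h n)}) atTop (𝓝 0) := by
  obtain ⟨R, hR, hsub, hpert⟩ := hL.exists_perturbation_bound hf
  obtain ⟨M, hM, hrare⟩ := rare_not_close hf hL hK hX hh R
  obtain ⟨r₀, hr₀, C, hC, hpert⟩ := hpert M hM
  obtain ⟨C', hC', hgood⟩ := hh.eventually_good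
  -- The linearized error is within C r of the slope of the estimate, and this slope is at most C
  -- (‖error‖ + r), so the multiple of r doubles.
  refine ⟨2 * C, by positivity, tendsto_measure_of_eventually_subset ?_ (hrare M le_rfl)⟩
  filter_upwards [hgood 1, hh.tendsto_rate.eventually (gt_mem_nhds hr₀)] with n hn hr ω
  simp only [Set.mem_ofPred_eq]
  refine mt fun hclose x₀ hx₀ => ?_
  have hrp := hn.rate_pos
  obtain ⟨h1, h2, h3⟩ := hpert _ _ hrp hr hclose x₀ hx₀ _ (hθ n ω x₀ hx₀)
  refine ⟨fun W hW => (h1 W hW).trans ?_, ?_⟩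
  · gcongr; linarith
  · have h4 := abs_sub_abs_le_abs_sub
      (inner ℝ (gradient f (filamentPoint f x₀)) (linErr f (fHat K h X n ω) (filamentPoint f x₀)))
      (slope (fHat K h X n ω) (filamentPoint f x₀))
    rw [abs_sub_comm] at h4
    have h5 : 0 ≤ C * ‖filamentError f K h X θhat n ω x₀‖ := by positivity
    rw [← filamentError] at h2
    linarith

end Main

end Filament

end

open Filament in
theorem corollary3p3 {Ω : Type*} [MeasurableSpace Ω] (P : Measure Ω) [IsProbabilityMeasure P]
    (f K : Plane → ℝ) (H L : Set Plane) (a : ℝ) (h : ℕ → ℝ) (X : ℕ → Ω → Plane)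
    (hf : DensityAssumptions f) (hL : FilamentAssumptions f H L a)
    (hK : KernelAssumptions K) (hh : BandwidthAssumptions h) (hX : IsSample P f X)
    (θhat : ℕ → Ω → Plane → ℝ)
    (hθ : ∀ n ω, ∀ x₀ ∈ startSet f L a,
      IsArgminChoice (ridgeTimes (fHat K h X n ω) x₀) (θhat n ω x₀))
    (Vperp : Plane → Plane) (hV : ∀ x ∈ L, IsFirstEigenvector f x (Vperp x))
    (hVb : ∃ C : ℝ, ∀ x ∈ L, ‖Vperp x‖ ≤ C) :
    IsBigOp P
      (fun n ω => ⨆ x₀ ∈ startSet f L a,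
        ‖inner ℝ (filamentError f K h X θhat n ω x₀) (Vperp (filamentPoint f x₀))‖ₑ)
      (fun n => Real.log n / (n * h n ^ 7)) ∧
    ∀ x₀ ∈ startSet f L a, gradient f (filamentPoint f x₀) ≠ 0 → ∀ ε : ℝ, 0 < ε →
      Tendsto (fun n : ℕ => P {ω |
          ε * |inner ℝ (filamentError f K h X θhat n ω x₀) (V f (filamentPoint f x₀))| ≤
            |inner ℝ (filamentError f K h X θhat n ω x₀) (Vperp (filamentPoint f x₀))|})
        atTop (𝓝 0) := by
  obtain ⟨C, hC, hbad⟩ := exists_tendsto_error_bounds hf hL hK hh hX hθ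
  obtain ⟨C', hC', hgood⟩ := hh.eventually_good
  have hperp : ∀ x₀ ∈ startSet f L a,
      inner ℝ (V f (filamentPoint f x₀)) (Vperp (filamentPoint f x₀)) = 0 := fun x₀ hx₀ =>
    have hx := hL.filamentPoint_mem hx₀
    (hV _ hx).inner_V_eq_zero (hL.distinct _ (hL.filament_subset hx))
  refine ⟨fun ε hε => ?_, fun x₀ hx₀ hgrad ε hε => ?_⟩
  · obtain ⟨B, hB⟩ := hVb
    refine ⟨C * (|B| + 1), by positivity, ?_⟩
    filter_upwards [hgood 1, hbad.eventually (ge_mem_nhds (ENNReal.ofReal_pos.2 hε))] with n hn hP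
    refine (measure_mono fun ω hω => ?_).trans hP
    simp only [Set.mem_ofPred_eq] at hω ⊢
    intro hall
    refine absurd hω (not_lt.2 (iSup₂_le fun x₀ hx₀ => ?_))
    rw [Real.enorm_eq_ofReal_abs]
    refine ENNReal.ofReal_le_ofReal (((hall x₀ hx₀).1 _ (hperp x₀ hx₀)).trans ?_)
    have hr : 0 < rate h n := hn.rate_pos
    have h1 := (hB _ (hL.filamentPoint_mem hx₀)).trans (le_abs_self B)
    calc C * rate h n * ‖Vperp (filamentPoint f x₀)‖ ≤ C * rate h n * (|B| + 1) := by
          gcongr; linarith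
      _ = C * (|B| + 1) * rate h n := by ring
  · set x := filamentPoint f x₀ with hx
    have hxL : x ∈ L := hL.filamentPoint_mem hx₀
    have hxH : x ∈ H := hL.filament_subset hxL
    have hv : V f x ≠ 0 := fun h0 => hL.transversal x hxL (by rw [h0, inner_zero_right])
    have hw : Vperp x ≠ 0 := (hV x hxL).2
    have hfx : 0 < f x := by
      obtain ⟨ε₀, hε₀, hpos⟩ := hL.pos_near
      exact hpos x (Metric.self_subset_thickening hε₀ H hxH)
    -- Transversality excludes V f x = 0, so a nonzero gradient leaves a genuinely random linear
    -- combination of second derivative errors.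
    have hcoef : linCoef (d20 f x) (d11 f x) (d02 f x) (gradient f x) ≠ 0 :=
      linCoef_ne_zero (hL.gap_pos hxH) hv hgrad
    have hv' : 0 < ‖V f x‖ := norm_pos_iff.2 hv
    have hw' : 0 < ‖Vperp x‖ := norm_pos_iff.2 hw
    -- If ε times the tangential component were at most the normal one, which is O(r), then ‖e‖ ≤ D
    -- r by orthogonal expansion. This forces the linearized error below C (D + 1) r, an improbable
    -- event by anti-concentration.
    set D := C * ‖Vperp x‖ / ε / ‖V f x‖ + C with hD
    have hDp : 0 < D := by positivity
    refine tendsto_measure_of_eventually_subset ?_ (tendsto_measure_union hbad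
      (tendsto_measure_secondComb_le hf hK hX hh hcoef hfx (M := C * (D + 1)) (by positivity)))
    filter_upwards [hgood 1] with n hn ω hω
    have hr := hn.rate_pos
    simp only [Set.mem_union, Set.mem_ofPred_eq] at hω ⊢
    refine or_iff_not_imp_left.2 fun hall => ?_
    obtain ⟨h1, h2⟩ := not_not.1 hall x₀ hx₀
    rw [← hx] at h1 h2
    have h3 := h1 _ (hperp x₀ hx₀)
    rw [← inner_linErr]
    refine h2.trans ?_
    set e := filamentError f K h X θhat n ω x₀
    have h4 : |inner ℝ e (V f x)| ≤ C * rate h n * ‖Vperp x‖ / ε := by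
      rw [le_div_iff₀ hε, mul_comm]; exact hω.trans h3
    have h5 : ‖e‖ ≤ D * rate h n := by
      calc ‖e‖ ≤ |inner ℝ e (V f x)| / ‖V f x‖ + |inner ℝ e (Vperp x)| / ‖Vperp x‖ :=
            norm_le_of_orthogonal hv hw (hperp x₀ hx₀) e
        _ ≤ C * rate h n * ‖Vperp x‖ / ε / ‖V f x‖ + C * rate h n * ‖Vperp x‖ / ‖Vperp x‖ := by
            gcongr
        _ = D * rate h n := by rw [hD]; field_simp
    calc C * (‖e‖ + rate h n) ≤ C * (D * rate h n + rate h n) := by gcongr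
      _ = C * (D + 1) * rate h n := by ring
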